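/- Let $n\ge 2$, let $\mathbb T^n=\mathbb R^n/\Gamma$ for a lattice $\Gamma\subset\mathbb R^n$ of full rank, let $I\subseteq\mathbb R$ be an open interval, and let $1/2<\alpha<1$. Let $v$ be a (measurable) vector field on $I\times\mathbb T^n$ with $$\sup_{t\in I}\|v(t,\cdot)\|_{C^\alpha(\mathbb T^n)}<\infty ,$$ and let $p$ be a distribution on $I\times\mathbb T^n$, normalized to have integral $0$ over $\mathbb T^n$ (that is, $p$ vanishes on test functions depending on $t$ only), such that $(v,p)$ solves the incompressible Euler equations $$\partial_t v^l+\partial_j(v^jv^l)+\partial_l p=0,\qquad \partial_jv^j=0\qquad (1\le l\le n)$$ on $I\times\mathbb T^n$ in the sense of distributions (repeated indices are summed). Here $C^0$ denotes the bounded continuous functions on $I\times\mathbb T^n$, and $C^\beta_{t,x}$ those that in addition satisfy $|f(t,x)-f(s,y)|\le C(|t-s|+|x-y|)^\beta$ on all of $I\times\mathbb R^n$ for some constant $C$ (functions on $I \times \mathbb T^n$ being regarded as periodic functions on $I\times\mathbb R^n$). For a continuous tensor field $T$ on $I\times\mathbb T^n$, $D_tT$ denotes the distribution $\partial_tT+\partial_j(v^jT)$.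 Then: 1. The distributions $\partial_tp$ and $\nabla p$ are functions, and $(\partial_tp,\nabla p)\in C^\beta_{t,x}$ for all $0\le\beta<2\alpha-1$. 2. If $\alpha>2/3$, then the distribution $D_t\nabla p=\partial_t\nabla p+\partial_j(v^j\nabla p)$, which is well defined by (1), is a function, and $D_t\nabla p\in C^\beta_{t,x}$ for all $0\le\beta<3\alpha-2$. 3. If $\alpha>3/4$, then moreover $D_t^2\nabla p=\partial_t D_t\nabla p+\partial_j(v^jD_t\nabla p)\in C^0$. -/

import Mathlib

open MeasureTheory TopologicalSpace
open scoped Distributions LineDeriv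

namespace EulerPressure

/-- Space `ℝⁿ` with its Euclidean norm. -/
abbrev Space (n : ℕ) : Type := EuclideanSpace ℝ (Fin n)

/-- The space-time slab `I × ℝⁿ`.  Functions and distributions on `I × 𝕋ⁿ`, where `𝕋ⁿ = ℝⁿ / Γ`,
are functions and distributions on this slab that are `Γ`-periodic in `x`. -/
abbrev slab (n : ℕ) (I : Opens ℝ) : Opens (ℝ × Space n) :=
  ⟨(I : Set ℝ) ×ˢ Set.univ, I.isOpen.prod isOpen_univ⟩

/-- The direction of the time derivative `∂_t`. -/
noncomputable def timeDir (n : ℕ) : ℝ × Space n := (1, 0)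

/-- The direction of the `j`-th spatial derivative `∂_j`. -/
noncomputable def spaceDir {n : ℕ} (j : Fin n) : ℝ × Space n := (0, EuclideanSpace.single j 1)

/-- The distribution `φ ↦ ∫ φ f` on `I × ℝⁿ` given by a function `f` that is locally integrable
on `I × ℝⁿ` (it is zero if `f` is not locally integrable there). -/
noncomputable def distOf {n : ℕ} (I : Opens ℝ) (f : ℝ × Space n → ℝ) : 𝓓'(slab n I, ℝ) :=
  UniformConvergenceCLM.ofFun (RingHom.id ℝ) ℝ _
    (TestFunction.integralAgainstBilinCLM (ContinuousLinearMap.mul ℝ ℝ) volume f)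

theorem distOf_apply {n : ℕ} {I : Opens ℝ} {f : ℝ × Space n → ℝ}
    (hf : LocallyIntegrableOn f (slab n I : Set (ℝ × Space n)) volume) (φ : 𝓓(slab n I, ℝ)) :
    distOf I f φ = ∫ z, φ z * f z :=
  TestFunction.integralAgainstBilinCLM_eq_integral
    (B := ContinuousLinearMap.mul ℝ ℝ) (μ := volume) hf

/-- `f` is `Γ`-periodic in `x`, at all times in `I`. -/
def IsPeriodicFun {n : ℕ} {F : Type*} (I : Opens ℝ) (Γ : Submodule ℤ (Space n))
    (f : ℝ × Space n → F) : Prop :=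
  ∀ t ∈ I, ∀ x : Space n, ∀ γ ∈ Γ, f (t, x + γ) = f (t, x)

/-- The distribution `T` on `I × ℝⁿ` is invariant under all translations `x ↦ x + γ`, `γ ∈ Γ`,
i.e. `T` is a distribution on `I × 𝕋ⁿ`. -/
def IsPeriodicDist {n : ℕ} {I : Opens ℝ} (Γ : Submodule ℤ (Space n))
    (T : 𝓓'(slab n I, ℝ)) : Prop :=
  ∀ γ ∈ Γ, ∀ φ ψ : 𝓓(slab n I, ℝ), (∀ (t : ℝ) (x : Space n), ψ (t, x) = φ (t, x + γ)) → T ψ = T φ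

/-- The periodic distribution `T` has integral `0` over the torus at (almost) every time: it
vanishes on all test functions on `I × 𝕋ⁿ` that depend on `t` alone.  A test function `φ` on
`I × ℝⁿ` represents the test function `(t, x) ↦ ∑ γ ∈ Γ, φ (t, x + γ)` on `I × 𝕋ⁿ` (for fixed
`(t, x)` only finitely many terms are nonzero). -/
def HasZeroMean {n : ℕ} {I : Opens ℝ} (Γ : Submodule ℤ (Space n))
    (T : 𝓓'(slab n I, ℝ)) : Prop :=
  ∀ φ : 𝓓(slab n I, ℝ),
    (∀ (t : ℝ) (x y : Space n),
      ∑ᶠ γ : Γ, φ (t, x + (γ : Space n)) = ∑ᶠ γ : Γ, φ (t, y + (γ : Space n))) →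
    T φ = 0

/-- The class `C_t C_x^α` on `I × 𝕋ⁿ`: `v` is a periodic (measurable) vector field with
`sup_{t ∈ I} ‖v(t,·)‖_{C^α} < ∞`. -/
structure MemCtCx {n : ℕ} (I : Opens ℝ) (Γ : Submodule ℤ (Space n)) (α : ℝ)
    (v : ℝ × Space n → Space n) : Prop where
  aestronglyMeasurable : AEStronglyMeasurable v (volume.restrict (slab n I : Set (ℝ × Space n)))
  periodic : IsPeriodicFun I Γ v
  bound : ∃ C : ℝ, ∀ t ∈ I, (∀ x, ‖v (t, x)‖ ≤ C) ∧
    ∀ x y, ‖v (t, x) - v (t, y)‖ ≤ C * ‖x - y‖ ^ α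

/-- `(v, p)` solves the incompressible Euler equations
`∂_t v^l + ∂_j (v^j v^l) + ∂_l p = 0`, `∂_j v^j = 0` on `I × ℝⁿ` in the sense of distributions. -/
structure IsWeakEulerSolution {n : ℕ} (I : Opens ℝ) (v : ℝ × Space n → Space n)
    (p : 𝓓'(slab n I, ℝ)) : Prop where
  momentum : ∀ l : Fin n,
    ∂_{timeDir n} (distOf I fun z => v z l)
      + ∑ j : Fin n, ∂_{spaceDir j} (distOf I fun z => v z j * v z l)
      + ∂_{spaceDir l} p = 0
  incompressible : ∑ j : Fin n, ∂_{spaceDir j} (distOf I fun z => v z j) = 0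

/-- The material derivative `D_t f = ∂_t f + ∂_j (v^j f)` of a function `f`, as a distribution. -/
noncomputable def materialDeriv {n : ℕ} (I : Opens ℝ) (v : ℝ × Space n → Space n)
    (f : ℝ × Space n → ℝ) : 𝓓'(slab n I, ℝ) :=
  ∂_{timeDir n} (distOf I f) + ∑ j : Fin n, ∂_{spaceDir j} (distOf I fun z => v z j * f z)

/-- The class `C⁰` on `I × 𝕋ⁿ`: periodic, continuous and bounded functions on `I × ℝⁿ`. -/
structure MemC0 {n : ℕ} {F : Type*} [NormedAddCommGroup F] (I : Opens ℝ)
    (Γ : Submodule ℤ (Space n)) (f : ℝ × Space n → F) : Prop where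
  periodic : IsPeriodicFun I Γ f
  continuousOn : ContinuousOn f (slab n I : Set (ℝ × Space n))
  bounded : ∃ C : ℝ, ∀ z ∈ slab n I, ‖f z‖ ≤ C

/-- The Hölder class `C^β_{t,x}` on `I × 𝕋ⁿ` (jointly in time and space). -/
structure MemHolder {n : ℕ} {F : Type*} [NormedAddCommGroup F] (I : Opens ℝ)
    (Γ : Submodule ℤ (Space n)) (β : ℝ) (f : ℝ × Space n → F) : Prop extends MemC0 I Γ f where
  holder : ∃ C : ℝ, ∀ z ∈ slab n I, ∀ w ∈ slab n I, ‖f z - f w‖ ≤ C * ‖z - w‖ ^ β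

end EulerPressure

namespace EulerPressure

open scoped ContDiff Topology
open Filter Function
set_option linter.unusedSectionVars false

/-! ### Weak transport along a rough divergence-free field, and its product rule -/

section

/-! Write δv for the increment v(t,x+z) - v(t,x). The theorem comes from expressing the derivatives
of p through integrals of products of increments of v against smooth, compactly supported kernels,
one for each dyadic scale 2^(-q), and then counting exponents. A kernel of order s at scale q has
size 2^(sq). Against a function vanishing like |z|^a it contributes 2^((s-a)q), which sums over q →
∞ when a > s. For q → -∞, boundedness is enough when s > 0. A Hölder difference of exponent β in
(t,x) costs β powers of |z|, so the sum is C^β when s < a - β.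

Representation. A compactly supported G with ΔG = 2^n η(2·) - η (`exists_kernel`) turns -Δp =
∂_i∂_j(v^i v^j) into a telescoping sum. Its fine end recovers p, because η has integral one. Its
coarse end disappears, because p has mean zero and the periodizations of wide kernels are almost
constant (`WeakEuler.tendsto_sum_block`). Incompressibility allows every product of velocities to be
replaced by a product of increments (`HolderField.sum_kint_two`), so ∇p becomes a sum of kernels of
order 1 against δv δv.

Time regularity. At first v is only bounded in time. Averages of v at scale 2^(-k) have weak time
derivative O(2^((1-α)k)) and differ from v by O(2^(-αk)). Taking 2^(-k) comparable to |t-s| makes v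
Hölder of exponent α in time off a null set, and an extension gives a representative that is Hölder
in (t,x) everywhere (`exists_holder_velocity`). Then ∇p is in C^β for β < 2α-1, and D_t v = -∇p.

Material derivatives. Two tools are needed. The first is the product rule for D_t along the
non-Lipschitz field v. A commutator argument in the style of Constantin, E and Titi proves it as
soon as the Hölder exponents of the two factors and of the field add up to more than 1
(`HasDiv.mul`). The second is the transport of a two-point function F(t,x,y) by the field (1,
v(t,x), v(t,y)). Integrating F against L(y-x) produces D_t F against L, plus δv F against ∇L
(`HasDiv.integral_kernel`, `HolderField.hasDiv_sing`). Each D_t thus either differentiates an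
increment or raises the order of the kernel by one while adding one factor δv.

Counting. The first D_t of ∇p gives order 1 against δ(D_t v) δv and order 2 against three
increments. The binding condition is β + 2 < 3α. The second D_t gives at worst order 3 against four
increments, whence 4α > 3, and the other terms require nothing more. For ∂_t p, the identity ∂_t(v^j
v^i) = D_t(v^j v^i) - ∂_k(v^k v^j v^i) leads to one term of order 0 in D_t(v^j v^i), summable at
coarse scales by periodicity. It also leads to terms of order 1 in which the triple product is again
written with increments (`HolderField.sum_kint_three`). -/

/-- Smooth functions with compact support in `U`. -/
structure IsTest {X : Type*} [NormedAddCommGroup X] [NormedSpace ℝ X] (U : Set X) (φ : X → ℝ) :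
    Prop where
  contDiff : ContDiff ℝ ∞ φ
  hasCompactSupport : HasCompactSupport φ
  tsupport_subset : tsupport φ ⊆ U

/-- `div (a W) = A` on `U` in the sense of distributions. -/
def HasDiv {X : Type*} [NormedAddCommGroup X] [NormedSpace ℝ X] [MeasurableSpace X]
    (μ : Measure X) (U : Set X) (W : X → X) (a A : X → ℝ) : Prop :=
  ∀ φ : X → ℝ, IsTest U φ → ∫ x, a x * fderiv ℝ φ x (W x) ∂μ = - ∫ x, A x * φ x ∂μ

theorem integrable_add_fun {Y : Type*} [MeasurableSpace Y] {μ : Measure Y} {f g : Y → ℝ}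
    (hf : Integrable f μ) (hg : Integrable g μ) : Integrable (fun x => f x + g x) μ :=
  hf.add hg

theorem integrable_sub_fun {Y : Type*} [MeasurableSpace Y] {μ : Measure Y} {f g : Y → ℝ}
    (hf : Integrable f μ) (hg : Integrable g μ) : Integrable (fun x => f x - g x) μ :=
  hf.sub hg

section Basic

variable {X : Type*} [NormedAddCommGroup X] [NormedSpace ℝ X]

theorem IsTest.continuous {U : Set X} {φ : X → ℝ} (h : IsTest U φ) : Continuous φ :=
  h.contDiff.continuous

theorem IsTest.continuous_fderiv {U : Set X} {φ : X → ℝ} (h : IsTest U φ) :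
    Continuous (fderiv ℝ φ) :=
  h.contDiff.continuous_fderiv (by simp)

theorem IsTest.differentiable {U : Set X} {φ : X → ℝ} (h : IsTest U φ) : Differentiable ℝ φ :=
  h.contDiff.differentiable (by simp)

theorem IsTest.fderiv_apply {U : Set X} {φ : X → ℝ} (h : IsTest U φ) (e : X) :
    IsTest U fun x => fderiv ℝ φ x e where
  contDiff := (h.contDiff.fderiv_right (m := ∞) (by simp)).clm_apply contDiff_const
  hasCompactSupport := h.hasCompactSupport.fderiv_apply ℝ e
  tsupport_subset := (tsupport_fderiv_apply_subset ℝ e).trans h.tsupport_subset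

theorem fderiv_eq_zero_of_notMem_tsupport {φ : X → ℝ} {x : X} (hx : x ∉ tsupport φ) :
    fderiv ℝ φ x = 0 := by
  by_contra h
  exact hx (support_fderiv_subset ℝ h)

theorem IsTest.mono {U V : Set X} {φ : X → ℝ} (h : IsTest U φ) (hUV : U ⊆ V) : IsTest V φ :=
  ⟨h.contDiff, h.hasCompactSupport, h.tsupport_subset.trans hUV⟩

variable [MeasurableSpace X] [BorelSpace X]

theorem IsTest.integrable_mul {U : Set X} {φ : X → ℝ} (h : IsTest U φ) {a : X → ℝ}
    (ha : Continuous a) (μ : Measure X) [IsFiniteMeasureOnCompacts μ] :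
    Integrable (fun x => a x * φ x) μ :=
  (ha.mul h.continuous).integrable_of_hasCompactSupport h.hasCompactSupport.mul_left

theorem IsTest.integrable_mul_fderiv {U : Set X} {φ : X → ℝ} (h : IsTest U φ) {a : X → ℝ}
    {W : X → X} (ha : Continuous a) (hW : Continuous W) (μ : Measure X)
    [IsFiniteMeasureOnCompacts μ] :
    Integrable (fun x => a x * fderiv ℝ φ x (W x)) μ := by
  refine (ha.mul (h.continuous_fderiv.clm_apply hW)).integrable_of_hasCompactSupport ?_
  refine HasCompactSupport.intro h.hasCompactSupport fun x hx => ?_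
  simp [fderiv_eq_zero_of_notMem_tsupport hx]

theorem HasDiv.add {μ : Measure X} [IsFiniteMeasureOnCompacts μ] {U : Set X} {W : X → X}
    {a A b B : X → ℝ} (h₁ : HasDiv μ U W a A) (h₂ : HasDiv μ U W b B) (hW : Continuous W)
    (ha : Continuous a) (hA : Continuous A) (hb : Continuous b) (hB : Continuous B) :
    HasDiv μ U W (fun x => a x + b x) (fun x => A x + B x) := by
  intro φ hφ
  simp only [add_mul]
  rw [integral_add (hφ.integrable_mul_fderiv ha hW μ) (hφ.integrable_mul_fderiv hb hW μ),
    integral_add (hφ.integrable_mul hA μ) (hφ.integrable_mul hB μ), h₁ φ hφ, h₂ φ hφ]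
  ring

theorem HasDiv.neg {μ : Measure X} {U : Set X} {W : X → X}
    {a A : X → ℝ} (h₁ : HasDiv μ U W a A) :
    HasDiv μ U W (fun x => - a x) (fun x => - A x) := by
  intro φ hφ
  simp only [neg_mul, integral_neg, h₁ φ hφ]

theorem HasDiv.sub {μ : Measure X} [IsFiniteMeasureOnCompacts μ] {U : Set X} {W : X → X}
    {a A b B : X → ℝ} (h₁ : HasDiv μ U W a A) (h₂ : HasDiv μ U W b B) (hW : Continuous W)
    (ha : Continuous a) (hA : Continuous A) (hb : Continuous b) (hB : Continuous B) :
    HasDiv μ U W (fun x => a x - b x) (fun x => A x - B x) := by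
  simpa only [sub_eq_add_neg] using h₁.add h₂.neg hW ha hA hb.neg hB.neg

theorem HasDiv.sum {ι : Type*} (s : Finset ι) {μ : Measure X} [IsFiniteMeasureOnCompacts μ]
    {U : Set X} {W : X → X} {a A : ι → X → ℝ} (h : ∀ i ∈ s, HasDiv μ U W (a i) (A i))
    (hW : Continuous W) (ha : ∀ i ∈ s, Continuous (a i)) (hA : ∀ i ∈ s, Continuous (A i)) :
    HasDiv μ U W (fun x => ∑ i ∈ s, a i x) (fun x => ∑ i ∈ s, A i x) := by
  intro φ hφ
  simp only [Finset.sum_mul]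
  rw [integral_finsetSum _ fun i hi => hφ.integrable_mul_fderiv (ha i hi) hW μ,
    integral_finsetSum _ fun i hi => hφ.integrable_mul (hA i hi) μ, ← Finset.sum_neg_distrib]
  exact Finset.sum_congr rfl fun i hi => h i hi φ hφ

/-- Stability of `HasDiv` under bounded pointwise convergence. -/
theorem HasDiv.of_tendsto {μ : Measure X} [IsFiniteMeasureOnCompacts μ] {U : Set X} {W : X → X}
    {a A : ℕ → X → ℝ} {a' A' : X → ℝ} (h : ∀ m, HasDiv μ U W (a m) (A m)) (hW : Continuous W)
    (ha : ∀ m, Continuous (a m)) (hA : ∀ m, Continuous (A m)) {C : ℝ}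
    (haC : ∀ m x, |a m x| ≤ C) (hAC : ∀ m x, |A m x| ≤ C)
    (hta : ∀ x, Tendsto (fun m => a m x) atTop (𝓝 (a' x)))
    (htA : ∀ x, Tendsto (fun m => A m x) atTop (𝓝 (A' x))) : HasDiv μ U W a' A' := by
  intro φ hφ
  have h1 : Tendsto (fun m => ∫ x, a m x * fderiv ℝ φ x (W x) ∂μ) atTop
      (𝓝 (∫ x, a' x * fderiv ℝ φ x (W x) ∂μ)) := by
    refine tendsto_integral_of_dominated_convergence (fun x => |C * fderiv ℝ φ x (W x)|)
      (fun m => (hφ.integrable_mul_fderiv (ha m) hW μ).aestronglyMeasurable)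
      (hφ.integrable_mul_fderiv continuous_const hW μ).abs (fun m => ae_of_all _ fun x => ?_)
      (ae_of_all _ fun x => (hta x).mul_const _)
    rw [Real.norm_eq_abs, abs_mul, abs_mul]
    exact mul_le_mul_of_nonneg_right ((haC m x).trans (le_abs_self C)) (abs_nonneg _)
  have h2 : Tendsto (fun m => ∫ x, A m x * φ x ∂μ) atTop (𝓝 (∫ x, A' x * φ x ∂μ)) := by
    refine tendsto_integral_of_dominated_convergence (fun x => |C * φ x|)
      (fun m => (hφ.integrable_mul (hA m) μ).aestronglyMeasurable)
      (hφ.integrable_mul continuous_const μ).abs (fun m => ae_of_all _ fun x => ?_)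
      (ae_of_all _ fun x => (htA x).mul_const _)
    rw [Real.norm_eq_abs, abs_mul, abs_mul]
    exact mul_le_mul_of_nonneg_right ((hAC m x).trans (le_abs_self C)) (abs_nonneg _)
  refine tendsto_nhds_unique h1 ?_
  simpa only [h _ φ hφ] using h2.neg

end Basic

section Product

variable {X : Type*} [NormedAddCommGroup X] [NormedSpace ℝ X] [FiniteDimensional ℝ X]
  [MeasurableSpace X] [BorelSpace X] {μ : Measure X} [μ.IsAddHaarMeasure]

theorem integral_fderiv_apply_eq_zero {φ : X → ℝ} (h : ContDiff ℝ ∞ φ)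
    (hc : HasCompactSupport φ) (e : X) : ∫ x, fderiv ℝ φ x e ∂μ = 0 := by
  have hφ : IsTest Set.univ φ := ⟨h, hc, Set.subset_univ _⟩
  have := integral_mul_fderiv_eq_neg_fderiv_mul_of_integrable (μ := μ) (f := fun _ : X => (1 : ℝ))
    (g := φ) (v := e) (by simp)
    (hφ.integrable_mul_fderiv continuous_const continuous_const μ)
    (hφ.integrable_mul continuous_const μ) (by simp)
    (fun x _ => hφ.differentiable x)
  simpa using this

theorem integrable_two {G : X → X → ℝ} (hG : Continuous (uncurry G)) {K K' : Set X}
    (hK : IsCompact K) (hK' : IsCompact K') (h : ∀ x y, G x y ≠ 0 → x ∈ K ∧ x - y ∈ K') :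
    Integrable (uncurry G) (μ.prod μ) := by
  refine hG.integrable_of_hasCompactSupport ?_
  refine HasCompactSupport.intro
    ((hK.prod hK').image (f := fun p : X × X => (p.1, p.1 - p.2)) (by fun_prop)) ?_
  rintro ⟨x, y⟩ hxy
  by_contra h'
  obtain ⟨h1, h2⟩ := h x y h'
  exact hxy ⟨(x, x - y), ⟨h1, h2⟩, by simp⟩

theorem integral_two {G : X → X → ℝ} (hG : Integrable (uncurry G) (μ.prod μ)) :
    ∫ p, G p.1 p.2 ∂(μ.prod μ) = ∫ x, ∫ y, G x y ∂μ ∂μ :=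
  integral_prod _ hG

theorem integral_two_symm {G : X → X → ℝ} (hG : Integrable (uncurry G) (μ.prod μ)) :
    ∫ p, G p.1 p.2 ∂(μ.prod μ) = ∫ y, ∫ x, G x y ∂μ ∂μ :=
  integral_prod_symm _ hG

theorem fderiv_comp_sub_left {k : X → ℝ} (hk : Differentiable ℝ k) (x y e : X) :
    fderiv ℝ (fun y => k (x - y)) y e = - fderiv ℝ k (x - y) e := by
  have : HasFDerivAt (fun y => k (x - y)) ((fderiv ℝ k (x - y)).comp (-ContinuousLinearMap.id ℝ X)) y :=
    (hk (x - y)).hasFDerivAt.comp y ((hasFDerivAt_id y).const_sub x)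
  rw [this.fderiv]; simp

theorem fderiv_comp_sub_right_mul {k φ : X → ℝ} (hk : Differentiable ℝ k)
    (hφ : Differentiable ℝ φ) (x y e : X) :
    fderiv ℝ (fun x => k (x - y) * φ x) x e
      = fderiv ℝ k (x - y) e * φ x + k (x - y) * fderiv ℝ φ x e := by
  have h1 : HasFDerivAt (fun x => k (x - y)) (fderiv ℝ k (x - y)) x :=
    (hk (x - y)).hasFDerivAt.comp x ((hasFDerivAt_id x).sub_const y)
  have h2 : HasFDerivAt (fun x => k (x - y) * φ x) _ x := h1.mul (hφ x).hasFDerivAt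
  rw [h2.fderiv]
  simp; ring

theorem IsTest.comp_sub_mul {U : Set X} {φ k : X → ℝ} (hφ : IsTest U φ) (hk : ContDiff ℝ ∞ k)
    (y : X) : IsTest U fun x => k (x - y) * φ x where
  contDiff := (hk.comp (contDiff_id.sub contDiff_const)).mul hφ.contDiff
  hasCompactSupport := hφ.hasCompactSupport.mul_left
  tsupport_subset := (tsupport_mul_subset_right).trans hφ.tsupport_subset

theorem isTest_comp_sub_left {U : Set X} {k : X → ℝ} (hk : ContDiff ℝ ∞ k)
    (hkc : HasCompactSupport k) {x : X} (h : ∀ z ∈ tsupport k, x - z ∈ U) :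
    IsTest U fun y => k (x - y) where
  contDiff := hk.comp (contDiff_const.sub contDiff_id)
  hasCompactSupport := hkc.comp_homeomorph (Homeomorph.subLeft x)
  tsupport_subset := by
    intro y hy
    have : x - y ∈ tsupport k :=
      tsupport_comp_subset_preimage k (f := fun y => x - y) (by fun_prop) hy
    simpa using h _ this

variable {U : Set X} {W : X → X} {a b A B φ k : X → ℝ}

/-- Doubling of variables. The equation of a is tested in x with k(x-y)φ(x), and that of b in y with
k(x-y). Since ∂_y k(x-y) = -(∂k)(x-y), the derivatives of k combine into the increment W(x) - W(y).
The support hypothesis makes y ↦ k(x-y) admissible for every x in the support of φ. -/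
theorem HasDiv.doubling (ha : HasDiv μ U W a A) (hb : HasDiv μ U W b B)
    (hWc : Continuous W) (hac : Continuous a) (hbc : Continuous b) (hAc : Continuous A)
    (hBc : Continuous B) (hφ : IsTest U φ) (hk : ContDiff ℝ ∞ k) (hkc : HasCompactSupport k)
    (hUk : ∀ x ∈ tsupport φ, ∀ z ∈ tsupport k, x - z ∈ U) :
    ∫ p, a p.1 * b p.2 * (fderiv ℝ k (p.1 - p.2) (W p.1 - W p.2) * φ p.1
        + k (p.1 - p.2) * fderiv ℝ φ p.1 (W p.1)) ∂(μ.prod μ)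
      = - ∫ p, (A p.1 * b p.2 + a p.1 * B p.2) * (k (p.1 - p.2) * φ p.1) ∂(μ.prod μ) := by
  have hkf : Continuous (fderiv ℝ k) := hk.continuous_fderiv (by simp)
  have hkcont := hk.continuous
  have hφcont := hφ.continuous
  have hφf := hφ.continuous_fderiv
  have hkd : Differentiable ℝ k := hk.differentiable (by simp)
  have key : ∀ G : X → X → ℝ, Continuous (uncurry G) →
      (∀ x y, φ x = 0 → fderiv ℝ φ x = 0 → G x y = 0) →
      (∀ x y, k (x - y) = 0 → fderiv ℝ k (x - y) = 0 → G x y = 0) →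
      Integrable (uncurry G) (μ.prod μ) := by
    intro G hG h1 h2
    refine integrable_two hG hφ.hasCompactSupport hkc fun x y hxy => ⟨?_, ?_⟩
    · by_contra h
      exact hxy (h1 x y (image_eq_zero_of_notMem_tsupport h) (fderiv_eq_zero_of_notMem_tsupport h))
    · by_contra h
      exact hxy (h2 x y (image_eq_zero_of_notMem_tsupport h) (fderiv_eq_zero_of_notMem_tsupport h))
  have i1 := key (fun x y => a x * b y * (fderiv ℝ k (x - y) (W x) * φ x
    + k (x - y) * fderiv ℝ φ x (W x))) (by simp only [uncurry_def]; fun_prop) (by simp +contextual)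
    (by simp +contextual)
  have i2 := key (fun x y => a x * b y * (fderiv ℝ k (x - y) (W y) * φ x))
    (by simp only [uncurry_def]; fun_prop) (by simp +contextual) (by simp +contextual)
  have i3 := key (fun x y => A x * b y * (k (x - y) * φ x))
    (by simp only [uncurry_def]; fun_prop) (by simp +contextual) (by simp +contextual)
  have i4 := key (fun x y => a x * B y * (k (x - y) * φ x))
    (by simp only [uncurry_def]; fun_prop) (by simp +contextual) (by simp +contextual)
  have e1 : ∫ p, a p.1 * b p.2 * (fderiv ℝ k (p.1 - p.2) (W p.1) * φ p.1
        + k (p.1 - p.2) * fderiv ℝ φ p.1 (W p.1)) ∂(μ.prod μ)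
      = - ∫ p, A p.1 * b p.2 * (k (p.1 - p.2) * φ p.1) ∂(μ.prod μ) := by
    rw [integral_two_symm i1, integral_two_symm i3, ← integral_neg]
    congr 1; ext y
    have := ha _ (hφ.comp_sub_mul hk y)
    simp only [fderiv_comp_sub_right_mul hkd hφ.differentiable] at this
    have e : ∀ x, a x * b y * (fderiv ℝ k (x - y) (W x) * φ x
        + k (x - y) * fderiv ℝ φ x (W x)) = b y * (a x * (fderiv ℝ k (x - y) (W x) * φ x
        + k (x - y) * fderiv ℝ φ x (W x))) := fun x => by ring
    have e' : ∀ x, A x * b y * (k (x - y) * φ x) = b y * (A x * (k (x - y) * φ x)) :=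
      fun x => by ring
    simp only [e, e', integral_const_mul, this]
    ring
  have e2 : ∫ p, a p.1 * b p.2 * (fderiv ℝ k (p.1 - p.2) (W p.2) * φ p.1) ∂(μ.prod μ)
      = ∫ p, a p.1 * B p.2 * (k (p.1 - p.2) * φ p.1) ∂(μ.prod μ) := by
    rw [integral_two i2, integral_two i4]
    congr 1; ext x
    by_cases hx : x ∈ tsupport φ
    · have := hb _ (isTest_comp_sub_left hk hkc (hUk x hx))
      simp only [fderiv_comp_sub_left hkd, mul_neg, integral_neg, neg_inj] at this
      have e : ∀ y, a x * b y * (fderiv ℝ k (x - y) (W y) * φ x)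
          = (a x * φ x) * (b y * fderiv ℝ k (x - y) (W y)) := fun y => by ring
      have e' : ∀ y, a x * B y * (k (x - y) * φ x) = (a x * φ x) * (B y * k (x - y)) :=
        fun y => by ring
      simp only [e, e', integral_const_mul, this]
    · simp [image_eq_zero_of_notMem_tsupport hx]
  have e3 : ∀ p : X × X, a p.1 * b p.2 * (fderiv ℝ k (p.1 - p.2) (W p.1 - W p.2) * φ p.1
        + k (p.1 - p.2) * fderiv ℝ φ p.1 (W p.1)) = a p.1 * b p.2 * (fderiv ℝ k (p.1 - p.2) (W p.1)
          * φ p.1 + k (p.1 - p.2) * fderiv ℝ φ p.1 (W p.1))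
        - a p.1 * b p.2 * (fderiv ℝ k (p.1 - p.2) (W p.2) * φ p.1) := fun p => by
    rw [map_sub]; ring
  simp only [e3, add_mul]
  simp only [uncurry_def] at i1 i2 i3 i4
  rw [integral_sub i1 i2, e1, e2, integral_add i3 i4]
  ring

/-- The doubled identity for (a,b) and the one for (b,a) are completed by the same expressions with
ab taken entirely at x or entirely at y. These vanish or reduce to terms in ∇φ because W is
divergence-free. The four terms assemble to (a(x)-a(y))(b(x)-b(y)), so the only singular factor ∇k
meets three increments, while the left side has a limit when k concentrates. -/
theorem HasDiv.commutator (hW : HasDiv μ U W (fun _ => 1) fun _ => 0)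
    (ha : HasDiv μ U W a A) (hb : HasDiv μ U W b B)
    (hWc : Continuous W) (hac : Continuous a) (hbc : Continuous b) (hAc : Continuous A)
    (hBc : Continuous B) (hφ : IsTest U φ) (hk : ContDiff ℝ ∞ k) (hkc : HasCompactSupport k)
    (hUk : ∀ x ∈ tsupport φ, ∀ z ∈ tsupport k, x - z ∈ U) :
    ∫ p, ((a p.1 * b p.2 + b p.1 * a p.2) * fderiv ℝ φ p.1 (W p.1)
        - a p.2 * b p.2 * fderiv ℝ φ p.1 (W p.1 - W p.2)
        + (A p.1 * b p.2 + a p.1 * B p.2 + B p.1 * a p.2 + b p.1 * A p.2) * φ p.1)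
          * k (p.1 - p.2) ∂(μ.prod μ)
      = ∫ p, (a p.1 - a p.2) * (b p.1 - b p.2) * fderiv ℝ k (p.1 - p.2) (W p.1 - W p.2) * φ p.1
          ∂(μ.prod μ) := by
  have hkf : Continuous (fderiv ℝ k) := hk.continuous_fderiv (by simp)
  have hkcont := hk.continuous
  have hφcont := hφ.continuous
  have hφf := hφ.continuous_fderiv
  have hkd : Differentiable ℝ k := hk.differentiable (by simp)
  have key : ∀ G : X → X → ℝ, Continuous (uncurry G) →
      (∀ x y, φ x = 0 → fderiv ℝ φ x = 0 → G x y = 0) →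
      (∀ x y, k (x - y) = 0 → fderiv ℝ k (x - y) = 0 → G x y = 0) →
      Integrable (uncurry G) (μ.prod μ) := by
    intro G hG h1 h2
    refine integrable_two hG hφ.hasCompactSupport hkc fun x y hxy => ⟨?_, ?_⟩
    · by_contra h
      exact hxy (h1 x y (image_eq_zero_of_notMem_tsupport h) (fderiv_eq_zero_of_notMem_tsupport h))
    · by_contra h
      exact hxy (h2 x y (image_eq_zero_of_notMem_tsupport h) (fderiv_eq_zero_of_notMem_tsupport h))
  have d1 := HasDiv.doubling ha hb hWc hac hbc hAc hBc hφ hk hkc hUk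
  have d2 := HasDiv.doubling hb ha hWc hbc hac hBc hAc hφ hk hkc hUk
  have i1 := key (fun x y => a x * b y * (fderiv ℝ k (x - y) (W x - W y) * φ x
    + k (x - y) * fderiv ℝ φ x (W x))) (by simp only [uncurry_def]; fun_prop) (by simp +contextual)
    (by simp +contextual)
  have i2 := key (fun x y => b x * a y * (fderiv ℝ k (x - y) (W x - W y) * φ x
    + k (x - y) * fderiv ℝ φ x (W x))) (by simp only [uncurry_def]; fun_prop) (by simp +contextual)
    (by simp +contextual)
  have i3 := key (fun x y => (A x * b y + a x * B y) * (k (x - y) * φ x))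
    (by simp only [uncurry_def]; fun_prop) (by simp +contextual) (by simp +contextual)
  have i4 := key (fun x y => (B x * a y + b x * A y) * (k (x - y) * φ x))
    (by simp only [uncurry_def]; fun_prop) (by simp +contextual) (by simp +contextual)
  have i5 := key (fun x y => a x * b x * φ x * fderiv ℝ k (x - y) (W x - W y))
    (by simp only [uncurry_def]; fun_prop) (by simp +contextual) (by simp +contextual)
  have i6 := key (fun x y => a y * b y * (fderiv ℝ k (x - y) (W x - W y) * φ x +
    k (x - y) * fderiv ℝ φ x (W x - W y)))
    (by simp only [uncurry_def]; fun_prop) (by simp +contextual) (by simp +contextual)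
  have z1 : ∫ p, a p.1 * b p.1 * φ p.1 * fderiv ℝ k (p.1 - p.2) (W p.1 - W p.2) ∂(μ.prod μ)
      = 0 := by
    rw [integral_two i5]
    refine integral_eq_zero_of_ae (ae_of_all _ fun x => ?_)
    by_cases hx : x ∈ tsupport φ
    · have ht := isTest_comp_sub_left hk hkc (hUk x hx)
      have h1 := hW _ ht
      have h2 := integral_fderiv_apply_eq_zero (μ := μ) ht.contDiff ht.hasCompactSupport (W x)
      have j1 := ht.integrable_mul_fderiv (a := fun _ => 1) continuous_const hWc μ
      have j2 := ht.integrable_mul_fderiv (a := fun _ => 1) (W := fun _ => W x) continuous_const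
        continuous_const μ
      simp only [fderiv_comp_sub_left hkd, one_mul, zero_mul, integral_zero, neg_zero] at h1 h2 j1 j2
      have : ∫ y, fderiv ℝ k (x - y) (W x - W y) ∂μ = 0 := by
        calc _ = ∫ y, (- fderiv ℝ k (x - y) (W y) - (- fderiv ℝ k (x - y) (W x))) ∂μ := by
              congr 1; ext y; rw [map_sub]; ring
          _ = 0 := by rw [integral_sub j1 j2, h1, h2, sub_zero]
      simp only [Pi.zero_apply, integral_const_mul, this, mul_zero]
    · simp [image_eq_zero_of_notMem_tsupport hx]
  have z2 : ∫ p, a p.2 * b p.2 * (fderiv ℝ k (p.1 - p.2) (W p.1 - W p.2) * φ p.1 +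
      k (p.1 - p.2) * fderiv ℝ φ p.1 (W p.1 - W p.2)) ∂(μ.prod μ) = 0 := by
    rw [integral_two_symm i6]
    refine integral_eq_zero_of_ae (ae_of_all _ fun y => ?_)
    have ht := hφ.comp_sub_mul hk y
    have h1 := hW _ ht
    have h2 := integral_fderiv_apply_eq_zero (μ := μ) ht.contDiff ht.hasCompactSupport (W y)
    have j1 := ht.integrable_mul_fderiv (a := fun _ => 1) continuous_const hWc μ
    have j2 := ht.integrable_mul_fderiv (a := fun _ => 1) (W := fun _ => W y) continuous_const
      continuous_const μ
    simp only [one_mul, zero_mul, integral_zero, neg_zero] at h1 j1 j2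
    have : ∫ x, fderiv ℝ (fun x => k (x - y) * φ x) x (W x - W y) ∂μ = 0 := by
      simp only [map_sub]
      rw [integral_sub j1 j2, h1, h2, sub_zero]
    simp only [fderiv_comp_sub_right_mul hkd hφ.differentiable] at this
    simp only [Pi.zero_apply, integral_const_mul, this, mul_zero]
  have e : ∀ p : X × X, ((a p.1 * b p.2 + b p.1 * a p.2) * fderiv ℝ φ p.1 (W p.1)
        - a p.2 * b p.2 * fderiv ℝ φ p.1 (W p.1 - W p.2)
        + (A p.1 * b p.2 + a p.1 * B p.2 + B p.1 * a p.2 + b p.1 * A p.2) * φ p.1)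
          * k (p.1 - p.2)
      = (((a p.1 * b p.2 * (fderiv ℝ k (p.1 - p.2) (W p.1 - W p.2) * φ p.1
        + k (p.1 - p.2) * fderiv ℝ φ p.1 (W p.1))
        + (A p.1 * b p.2 + a p.1 * B p.2) * (k (p.1 - p.2) * φ p.1))
        + (b p.1 * a p.2 * (fderiv ℝ k (p.1 - p.2) (W p.1 - W p.2) * φ p.1
        + k (p.1 - p.2) * fderiv ℝ φ p.1 (W p.1))
        + (B p.1 * a p.2 + b p.1 * A p.2) * (k (p.1 - p.2) * φ p.1)))
        - a p.2 * b p.2 * (fderiv ℝ k (p.1 - p.2) (W p.1 - W p.2) * φ p.1 +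
      k (p.1 - p.2) * fderiv ℝ φ p.1 (W p.1 - W p.2)))
        - (a p.1 * b p.1 * φ p.1 * fderiv ℝ k (p.1 - p.2) (W p.1 - W p.2)
          - (a p.1 - a p.2) * (b p.1 - b p.2) * fderiv ℝ k (p.1 - p.2) (W p.1 - W p.2) * φ p.1) :=
    fun p => by ring
  have i7 := key (fun x y => (a x - a y) * (b x - b y) * fderiv ℝ k (x - y) (W x - W y) * φ x)
    (by simp only [uncurry_def]; fun_prop) (by simp +contextual) (by simp +contextual)
  simp only [uncurry_def] at i1 i2 i3 i4 i5 i6 i7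
  simp only [e]
  have i13 := integrable_add_fun i1 i3
  have i24 := integrable_add_fun i2 i4
  have i57 := integrable_sub_fun i5 i7
  have i1234 := integrable_add_fun i13 i24
  have i12346 := integrable_sub_fun i1234 i6
  rw [integral_sub i12346 i57, integral_sub i1234 i6, integral_add i13 i24,
    integral_add i1 i3, integral_add i2 i4, integral_sub i5 i7, d1, d2, z1, z2]
  ring

theorem integral_eq_rescale (h : X → ℝ) (x : X) {ε : ℝ} (hε : 0 < ε) :
    ∫ y, h y ∂μ = ε ^ Module.finrank ℝ X * ∫ u, h (x - ε • u) ∂μ := by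
  have h1 := Measure.integral_comp_smul μ (fun z => h (x - z)) ε
  rw [h1, integral_sub_left_eq_self h μ x, smul_eq_mul, abs_of_pos (by positivity),
    mul_inv_cancel_left₀ (by positivity)]

theorem integral_two_rescale {H : X → X → ℝ} (hH : Continuous (uncurry H)) {K K' : Set X}
    (hK : IsCompact K) (hK' : IsCompact K') {ε : ℝ} (hε : 0 < ε)
    (h : ∀ x y, H x y ≠ 0 → x ∈ K ∧ ε⁻¹ • (x - y) ∈ K') :
    ∫ p, H p.1 p.2 ∂(μ.prod μ)
      = ε ^ Module.finrank ℝ X * ∫ p, H p.1 (p.1 - ε • p.2) ∂(μ.prod μ) := by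
  have hi : Integrable (uncurry H) (μ.prod μ) := by
    refine integrable_two hH hK (hK'.smul ε) fun x y hxy => ⟨(h x y hxy).1, ?_⟩
    exact ⟨_, (h x y hxy).2, by simp [smul_smul, hε.ne']⟩
  have hj : Integrable (uncurry fun x u => H x (x - ε • u)) (μ.prod μ) := by
    refine Continuous.integrable_of_hasCompactSupport ?_
      (HasCompactSupport.intro (hK.prod hK') fun p hp => ?_)
    · exact hH.comp (f := fun p : X × X => (p.1, p.1 - ε • p.2)) (by fun_prop)
    · by_contra h'
      obtain ⟨h1, h2⟩ := h _ _ h'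
      simp [smul_smul, hε.ne'] at h2
      exact hp ⟨h1, h2⟩
  rw [integral_two hi, integral_two hj, ← integral_const_mul]
  congr 1; ext x
  exact integral_eq_rescale (fun y => H x y) x hε

theorem fderiv_comp_smul_apply {η : X → ℝ} (hη : Differentiable ℝ η) (c : ℝ) (z e : X) :
    fderiv ℝ (fun z => η (c • z)) z e = c * fderiv ℝ η (c • z) e := by
  have : HasFDerivAt (fun z => η (c • z)) ((fderiv ℝ η (c • z)).comp (c • ContinuousLinearMap.id ℝ X)) z :=
    (hη (c • z)).hasFDerivAt.comp z ((hasFDerivAt_id z).const_smul c)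
  rw [this.fderiv]; simp

/-- The product rule for weak divergences along a rough divergence-free field. -/
theorem HasDiv.mul (hU : IsOpen U) (hW : HasDiv μ U W (fun _ => 1) fun _ => 0)
    (ha : HasDiv μ U W a A) (hb : HasDiv μ U W b B)
    (hWc : Continuous W) (hac : Continuous a) (hbc : Continuous b) (hAc : Continuous A)
    (hBc : Continuous B) {C r : ℝ} (hr : 1 < r)
    (hC : ∀ x y, |a x - a y| * |b x - b y| * ‖W x - W y‖ ≤ C * ‖x - y‖ ^ r) :
    HasDiv μ U W (fun x => a x * b x) fun x => A x * b x + a x * B x := by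
  intro φ hφ
  -- Kernels of radius below d, centred on the support of φ, stay inside U.
  obtain ⟨d, hd, hdU⟩ := hφ.hasCompactSupport.isCompact.exists_cthickening_subset_open hU
    hφ.tsupport_subset
  let η : ContDiffBump (0 : X) := ⟨1 / 2, 1, by norm_num, by norm_num⟩
  have hηs : ContDiff ℝ ∞ (η : X → ℝ) := η.contDiff
  have hηc : HasCompactSupport (η : X → ℝ) := η.hasCompactSupport
  have hηd : Differentiable ℝ (η : X → ℝ) := hηs.differentiable (by simp)
  have hηf : Continuous (fderiv ℝ (η : X → ℝ)) := hηs.continuous_fderiv (by simp)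
  have hηt : tsupport (η : X → ℝ) = Metric.closedBall 0 1 := η.tsupport_eq
  have hφcont := hφ.continuous
  have hφf := hφ.continuous_fderiv
  -- The factor of k(x-y) on the left of the commutator identity. On the diagonal it is twice the
  -- expression whose integral has to vanish.
  let Tot : X → X → ℝ := fun x y => (a x * b y + b x * a y) * fderiv ℝ φ x (W x)
        - a y * b y * fderiv ℝ φ x (W x - W y)
        + (A x * b y + a x * B y + B x * a y + b x * A y) * φ x
  have hTot : Continuous (uncurry Tot) := by simp only [Tot, uncurry_def]; fun_prop
  have hTot0 : ∀ x y, x ∉ tsupport φ → Tot x y = 0 := fun x y hx => by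
    simp [Tot, fderiv_eq_zero_of_notMem_tsupport hx, image_eq_zero_of_notMem_tsupport hx]
  let F : ℝ → X × X → ℝ := fun ε p => Tot p.1 (p.1 - ε • p.2) * η p.2
  let M : ℝ := ∫ p, |C| * |φ p.1| * ‖fderiv ℝ (η : X → ℝ) p.2‖ ∂(μ.prod μ)
  -- With k(z) = η(z/ε), substituting y = x - εu produces the same power of ε on both sides, which
  -- cancels. What remains on the right is ε^(-1) from ∇k times ε^r from the increments.
  have hbound : ∀ ε ∈ Set.Ioo (0 : ℝ) d, |∫ p, F ε p ∂(μ.prod μ)| ≤ ε ^ (r - 1) * M := by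
    rintro ε ⟨hε, hεd⟩
    let k : X → ℝ := fun z => η (ε⁻¹ • z)
    have hk : ContDiff ℝ ∞ k := hηs.comp (contDiff_const_smul _)
    have hkc : HasCompactSupport k := hηc.comp_smul (inv_ne_zero hε.ne')
    have hkz : ∀ z, ε⁻¹ • z ∉ Metric.closedBall (0 : X) 1 → k z = 0 := fun z hz =>
      image_eq_zero_of_notMem_tsupport (f := (η : X → ℝ)) (by rwa [hηt])
    have hUk : ∀ x ∈ tsupport φ, ∀ z ∈ tsupport k, x - z ∈ U := by
      intro x hx z hz
      refine hdU (Metric.mem_cthickening_of_dist_le _ x _ _ hx ?_)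
      have : ε⁻¹ • z ∈ tsupport (η : X → ℝ) :=
        tsupport_comp_subset_preimage (η : X → ℝ) (f := fun z => ε⁻¹ • z) (by fun_prop) hz
      rw [hηt, mem_closedBall_zero_iff, norm_smul, Real.norm_eq_abs,
        abs_of_pos (inv_pos.2 hε), inv_mul_le_iff₀ hε] at this
      simpa using this.trans (by linarith)
    have hcomm := HasDiv.commutator hW ha hb hWc hac hbc hAc hBc hφ hk hkc hUk
    have hkf : Continuous (fderiv ℝ k) := hk.continuous_fderiv (by simp)
    have hKφ := hφ.hasCompactSupport.isCompact
    have hKη := isCompact_closedBall (0 : X) 1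
    have e1 := integral_two_rescale (μ := μ) (H := fun x y => Tot x y * k (x - y))
      (by
        have : Continuous k := hk.continuous
        simp only [uncurry_def] at hTot ⊢
        fun_prop) hKφ hKη hε (by
        intro x y hxy
        constructor
        · by_contra h
          exact hxy (by simp [hTot0 x y h])
        · by_contra h
          exact hxy (by simp [hkz _ h]))
    have e2 := integral_two_rescale (μ := μ) (H := fun x y => (a x - a y) * (b x - b y) *
        fderiv ℝ k (x - y) (W x - W y) * φ x)
      (by simp only [uncurry_def]; fun_prop) hKφ hKη hε (by
        intro x y hxy
        constructor
        · by_contra h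
          exact hxy (by simp [image_eq_zero_of_notMem_tsupport h])
        · by_contra h
          refine hxy ?_
          rw [fderiv_comp_smul_apply hηd, fderiv_eq_zero_of_notMem_tsupport (by rwa [hηt])]
          simp)
    simp only [Tot] at e1
    rw [hcomm, e2] at e1
    have e3 := mul_left_cancel₀ (by positivity) e1
    have e4 : ∫ p, F ε p ∂(μ.prod μ) = _ :=
      Eq.trans (by simp only [F, Tot, k, sub_sub_cancel, smul_smul, inv_mul_cancel₀ hε.ne',
        one_smul]) e3.symm
    rw [e4, ← Real.norm_eq_abs, ← integral_const_mul]
    refine norm_integral_le_of_norm_le (Integrable.const_mul ?_ _) (ae_of_all _ fun p => ?_)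
    · refine Continuous.integrable_of_hasCompactSupport (by fun_prop)
        (HasCompactSupport.intro (hKφ.prod hKη) fun p hp => ?_)
      by_cases h1 : p.1 ∈ tsupport φ
      · have h2 : p.2 ∉ tsupport (η : X → ℝ) := fun h2 => hp ⟨h1, by rwa [hηt] at h2⟩
        simp [fderiv_eq_zero_of_notMem_tsupport h2]
      · simp [image_eq_zero_of_notMem_tsupport h1]
    · rw [fderiv_comp_smul_apply hηd, sub_sub_cancel, smul_smul, inv_mul_cancel₀ hε.ne', one_smul]
      by_cases h2 : p.2 ∈ tsupport (η : X → ℝ)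
      · rw [hηt, mem_closedBall_zero_iff] at h2
        have h3 := hC p.1 (p.1 - ε • p.2)
        rw [sub_sub_cancel, norm_smul, Real.norm_eq_abs, abs_of_pos hε] at h3
        have h4 : (ε * ‖p.2‖) ^ r ≤ ε ^ r :=
          Real.rpow_le_rpow (by positivity) (by nlinarith [norm_nonneg p.2]) (by linarith)
        have h5 : C * (ε * ‖p.2‖) ^ r ≤ |C| * ε ^ r :=
          mul_le_mul (le_abs_self C) h4 (by positivity) (abs_nonneg C)
        have h6 := (fderiv ℝ (η : X → ℝ) p.2).le_opNorm (W p.1 - W (p.1 - ε • p.2))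
        rw [Real.norm_eq_abs] at h6
        rw [Real.norm_eq_abs, abs_mul, abs_mul, abs_mul, abs_mul, abs_of_pos (inv_pos.2 hε),
          Real.rpow_sub hε, Real.rpow_one]
        calc _ ≤ |a p.1 - a (p.1 - ε • p.2)| * |b p.1 - b (p.1 - ε • p.2)| * (ε⁻¹ *
              (‖fderiv ℝ (η : X → ℝ) p.2‖ * ‖W p.1 - W (p.1 - ε • p.2)‖)) * |φ p.1| := by gcongr
          _ = (|a p.1 - a (p.1 - ε • p.2)| * |b p.1 - b (p.1 - ε • p.2)| *
              ‖W p.1 - W (p.1 - ε • p.2)‖) * (ε⁻¹ * ‖fderiv ℝ (η : X → ℝ) p.2‖ * |φ p.1|) := by ring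
          _ ≤ (|C| * ε ^ r) * (ε⁻¹ * ‖fderiv ℝ (η : X → ℝ) p.2‖ * |φ p.1|) := by
              have := h3.trans h5
              gcongr
          _ = _ := by ring
      · simp only [fderiv_eq_zero_of_notMem_tsupport h2]
        simp
  have hlim0 : Tendsto (fun ε => ∫ p, F ε p ∂(μ.prod μ)) (𝓝[>] 0) (𝓝 0) := by
    refine squeeze_zero_norm' (a := fun ε => ε ^ (r - 1) * M) ?_ ?_
    · filter_upwards [Ioo_mem_nhdsGT hd] with ε hε using hbound ε hε
    · have : Tendsto (fun ε : ℝ => ε ^ (r - 1) * M) (𝓝 0) (𝓝 ((0 : ℝ) ^ (r - 1) * M)) :=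
        ((Real.continuousAt_rpow_const 0 (r - 1) (Or.inr (by linarith))).tendsto).mul_const M
      rw [Real.zero_rpow (by linarith), zero_mul] at this
      exact this.mono_left nhdsWithin_le_nhds
  have hlim1 : Tendsto (fun ε => ∫ p, F ε p ∂(μ.prod μ)) (𝓝[>] 0)
      (𝓝 (∫ p, F 0 p ∂(μ.prod μ))) := by
    have : Continuous fun ε => ∫ p, F ε p ∂(μ.prod μ) := by
      rw [← continuousOn_univ]
      refine continuousOn_integral_of_compact_support
        (hφ.hasCompactSupport.isCompact.prod hηc.isCompact) (Continuous.continuousOn ?_) ?_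
      · have h1 : Continuous fun q : ℝ × X × X => Tot q.2.1 (q.2.1 - q.1 • q.2.2) :=
          hTot.comp (f := fun q : ℝ × X × X => (q.2.1, q.2.1 - q.1 • q.2.2)) (by fun_prop)
        have h2 : Continuous (η : X → ℝ) := hηs.continuous
        simp only [F, uncurry_def]
        fun_prop
      · intro ε p _ hp
        by_cases h1 : p.1 ∈ tsupport φ
        · have h2 : p.2 ∉ tsupport (η : X → ℝ) := fun h2 => hp ⟨h1, h2⟩
          simp [F, image_eq_zero_of_notMem_tsupport h2]
        · simp [F, hTot0 _ _ h1]
    exact (this.tendsto 0).mono_left nhdsWithin_le_nhds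
  have hz := tendsto_nhds_unique hlim1 hlim0
  simp only [F, zero_smul, sub_zero] at hz
  rw [integral_prod_mul (μ := μ) (ν := μ) (fun x => Tot x x) (fun x => η x)] at hz
  have hηpos : 0 < ∫ x, η x ∂μ := η.integral_pos
  have hz' := (mul_eq_zero.1 hz).resolve_right hηpos.ne'
  have e : ∀ x, Tot x x = 2 * (a x * b x * fderiv ℝ φ x (W x)) + 2 * ((A x * b x + a x * B x) * φ x) :=
    fun x => by simp only [Tot, sub_self, map_zero]; ring
  simp only [e] at hz'
  have k1 := hφ.integrable_mul_fderiv (a := fun x => a x * b x) (hac.mul hbc) hWc μ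
  have k2 := hφ.integrable_mul (a := fun x => A x * b x + a x * B x)
    ((hAc.mul hbc).add (hac.mul hBc)) μ
  rw [integral_add (k1.const_mul 2) (k2.const_mul 2), integral_const_mul, integral_const_mul] at hz'
  linarith

end Product
end

section

/-- The space-time vector field `(1, v)`. -/
def spaceTimeField {n : ℕ} (v : ℝ × Space n → Space n) (P : ℝ × Space n) : ℝ × Space n := (1, v P)

/-- The vector field `(1, v(t,x), v(t,y))` on `ℝ × ℝⁿ × ℝⁿ`. -/
def pairField {n : ℕ} (v : ℝ × Space n → Space n) (Q : ℝ × (Space n × Space n)) :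
    ℝ × (Space n × Space n) := (1, (v (Q.1, Q.2.1), v (Q.1, Q.2.2)))

variable {n : ℕ} {I : Opens ℝ} {v : ℝ × Space n → Space n}

theorem continuous_spaceTimeField (hv : Continuous v) : Continuous (spaceTimeField v) := by
  unfold spaceTimeField; fun_prop

theorem continuous_pairField (hv : Continuous v) : Continuous (pairField v) := by
  unfold pairField; fun_prop

theorem continuous_integral_mul {Y Z : Type*} [TopologicalSpace Y] [FirstCountableTopology Y]
    [TopologicalSpace Z] [MeasurableSpace Z] [OpensMeasurableSpace Z] {μ : Measure Z}
    [IsFiniteMeasureOnCompacts μ] {L : Z → ℝ} (hL : Continuous L) (hLc : HasCompactSupport L)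
    {H : Y → Z → ℝ} (hH : Continuous (uncurry H)) :
    Continuous fun P => ∫ z, L z * H P z ∂μ := by
  rw [← continuousOn_univ]
  refine continuousOn_integral_of_compact_support hLc.isCompact (Continuous.continuousOn ?_) ?_
  · simp only [uncurry_def] at hH ⊢
    exact (hL.comp continuous_snd).mul hH
  · intro p x _ hx
    simp [image_eq_zero_of_notMem_tsupport hx]

theorem isTest_mul_prod {E F : Type*} [NormedAddCommGroup E] [NormedSpace ℝ E]
    [NormedAddCommGroup F] [NormedSpace ℝ F] {U : Set E} {V : Set F} {θ : E → ℝ} {χ : F → ℝ}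
    (hθ : IsTest U θ) (hχ : IsTest V χ) : IsTest (U ×ˢ V) fun p : E × F => θ p.1 * χ p.2 := by
  have h : tsupport (fun p : E × F => θ p.1 * χ p.2) ⊆ tsupport θ ×ˢ tsupport χ := by
    refine closure_minimal (fun p hp => ?_) ((isClosed_tsupport θ).prod (isClosed_tsupport χ))
    exact ⟨subset_tsupport θ (left_ne_zero_of_mul hp), subset_tsupport χ (right_ne_zero_of_mul hp)⟩
  exact ⟨(hθ.contDiff.comp contDiff_fst).mul (hχ.contDiff.comp contDiff_snd),
    (hθ.hasCompactSupport.isCompact.prod hχ.hasCompactSupport.isCompact).of_isClosed_subset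
      (isClosed_tsupport _) h,
    h.trans (Set.prod_mono hθ.tsupport_subset hχ.tsupport_subset)⟩

theorem fderiv_mul_prod {E F : Type*} [NormedAddCommGroup E] [NormedSpace ℝ E]
    [NormedAddCommGroup F] [NormedSpace ℝ F] {θ : E → ℝ} {χ : F → ℝ}
    (hθ : Differentiable ℝ θ) (hχ : Differentiable ℝ χ) (p e : E × F) :
    fderiv ℝ (fun p : E × F => θ p.1 * χ p.2) p e
      = fderiv ℝ θ p.1 e.1 * χ p.2 + θ p.1 * fderiv ℝ χ p.2 e.2 := by
  have h1 : HasFDerivAt (fun p : E × F => θ p.1) _ p :=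
    (hθ p.1).hasFDerivAt.comp p hasFDerivAt_fst
  have h2 : HasFDerivAt (fun p : E × F => χ p.2) _ p :=
    (hχ p.2).hasFDerivAt.comp p hasFDerivAt_snd
  have h3 : HasFDerivAt (fun p : E × F => θ p.1 * χ p.2) _ p := h1.mul h2
  rw [h3.fderiv]; simp; ring

/-- Restriction of a test function to an affine subspace. -/
theorem IsTest.comp_affine {E F : Type*} [NormedAddCommGroup E] [NormedSpace ℝ E]
    [NormedAddCommGroup F] [NormedSpace ℝ F] {U : Set E} {V : Set F} {φ : E → ℝ} (hφ : IsTest U φ)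
    {ι : F → E} (hι : ContDiff ℝ ∞ ι) (hc : Topology.IsClosedEmbedding ι) (h : ι ⁻¹' U ⊆ V) :
    IsTest V fun y => φ (ι y) :=
  ⟨hφ.contDiff.comp hι, hφ.hasCompactSupport.comp_isClosedEmbedding hc,
    (tsupport_comp_subset_preimage φ hι.continuous).trans
      ((Set.preimage_mono hφ.tsupport_subset).trans h)⟩

/-- A divergence-free continuous field is divergence-free at every time. -/
theorem integral_fderiv_slice_eq_zero (hv : Continuous v)
    (h : HasDiv volume (slab n I : Set (ℝ × Space n)) (spaceTimeField v) (fun _ => 1) fun _ => 0)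
    {t : ℝ} (ht : t ∈ I) {χ : Space n → ℝ} (hχ : ContDiff ℝ ∞ χ) (hχc : HasCompactSupport χ) :
    ∫ x, fderiv ℝ χ x (v (t, x)) = 0 := by
  have hχt : IsTest Set.univ χ := ⟨hχ, hχc, Set.subset_univ _⟩
  have hχf := hχt.continuous_fderiv
  have hχcont := hχt.continuous
  have hm : Continuous fun t => ∫ x, fderiv ℝ χ x (v (t, x)) := by
    rw [← continuousOn_univ]
    refine continuousOn_integral_of_compact_support hχc.isCompact (Continuous.continuousOn ?_) ?_
    · simp only [uncurry_def]; fun_prop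
    · intro p x _ hx
      simp [fderiv_eq_zero_of_notMem_tsupport hx]
  -- Testing with θ(t)χ(x): the time derivative contributes (∫ θ')(∫ χ) = 0, and only the spatial
  -- flux survives.
  have hz : ∀ θ : ℝ → ℝ, ContDiff ℝ ∞ θ → HasCompactSupport θ → tsupport θ ⊆ (I : Set ℝ) →
      ∫ t, θ t • ∫ x, fderiv ℝ χ x (v (t, x)) = 0 := by
    intro θ h1 h2 h3
    have hθ : IsTest (I : Set ℝ) θ := ⟨h1, h2, h3⟩
    have hφ := isTest_mul_prod hθ hχt
    have hθf := hθ.continuous_fderiv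
    have hθcont := hθ.continuous
    have := h _ hφ
    simp only [fderiv_mul_prod hθ.differentiable hχt.differentiable, spaceTimeField, one_mul,
      zero_mul, integral_zero, neg_zero] at this
    have i1 : Integrable (fun p : ℝ × Space n => fderiv ℝ θ p.1 1 * χ p.2) := by
      refine Continuous.integrable_of_hasCompactSupport (by fun_prop)
        (HasCompactSupport.intro (h2.isCompact.prod hχc.isCompact) fun p hp => ?_)
      by_cases hp1 : p.1 ∈ tsupport θ
      · simp [image_eq_zero_of_notMem_tsupport fun hp2 => hp ⟨hp1, hp2⟩]
      · simp [fderiv_eq_zero_of_notMem_tsupport hp1]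
    have i2 : Integrable (fun p : ℝ × Space n => θ p.1 * fderiv ℝ χ p.2 (v p)) := by
      refine Continuous.integrable_of_hasCompactSupport (by fun_prop)
        (HasCompactSupport.intro (h2.isCompact.prod hχc.isCompact) fun p hp => ?_)
      by_cases hp1 : p.1 ∈ tsupport θ
      · simp [fderiv_eq_zero_of_notMem_tsupport fun hp2 => hp ⟨hp1, hp2⟩]
      · simp [image_eq_zero_of_notMem_tsupport hp1]
    rw [integral_add i1 i2] at this
    have e1 : ∫ p : ℝ × Space n, fderiv ℝ θ p.1 1 * χ p.2 = 0 := by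
      rw [Measure.volume_eq_prod, integral_prod_mul (fun t => fderiv ℝ θ t 1) χ,
        integral_fderiv_apply_eq_zero h1 h2 1, zero_mul]
    rw [e1, zero_add, Measure.volume_eq_prod, integral_prod _ i2] at this
    simpa only [smul_eq_mul, ← integral_const_mul] using this
  -- This gives the claim for almost every time. Continuity of v in t then extends it to every t in
  -- I.
  have hae := I.isOpen.ae_eq_zero_of_integral_contDiff_smul_eq_zero
    (hm.locallyIntegrable.locallyIntegrableOn _ : LocallyIntegrableOn _ _ volume) hz
  have hae' : (fun t => ∫ x, fderiv ℝ χ x (v (t, x))) =ᵐ[volume.restrict (I : Set ℝ)]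
      fun _ => 0 := by
    rw [EventuallyEq, ae_restrict_iff' I.isOpen.measurableSet]
    exact hae
  exact Measure.eqOn_open_of_ae_eq hae' I.isOpen hm.continuousOn continuousOn_const ht

/-- The reordering `(x, (t, y)) ↦ (t, (x, y))`. -/
theorem measurePreserving_reorder : MeasurePreserving
    (fun p : Space n × (ℝ × Space n) => (p.2.1, (p.1, p.2.2))) volume volume := by
  have h1 := (volume_preserving_prodAssoc (α₁ := Space n) (β₁ := ℝ) (γ₁ := Space n)).symm
  have h2 : MeasurePreserving (Prod.map (Prod.swap : Space n × ℝ → ℝ × Space n)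
      (id : Space n → Space n)) volume volume :=
    (Measure.measurePreserving_swap (μ := (volume : Measure (Space n)))
      (ν := (volume : Measure ℝ))).prod (MeasurePreserving.id (volume : Measure (Space n)))
  have h3 := volume_preserving_prodAssoc (α₁ := ℝ) (β₁ := Space n) (γ₁ := Space n)
  exact h3.comp (h2.comp h1)

theorem measurableEmbedding_reorder : MeasurableEmbedding
    (fun p : Space n × (ℝ × Space n) => (p.2.1, (p.1, p.2.2))) := by
  refine Topology.IsClosedEmbedding.measurableEmbedding ?_
  let e : Space n × (ℝ × Space n) ≃ₜ ℝ × (Space n × Space n) :=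
    { toFun := fun p => (p.2.1, (p.1, p.2.2))
      invFun := fun q => (q.2.1, (q.1, q.2.2))
      left_inv := fun _ => rfl
      right_inv := fun _ => rfl
      continuous_toFun := by fun_prop
      continuous_invFun := by fun_prop }
  exact e.isClosedEmbedding

/-- For fixed x, φ(t,x,y) is a test function of (t,y) and sees the transport of f. For fixed (t,y)
it is a test function of x, and the remaining component v(t,x) integrates to zero because f does not
involve x and v is divergence-free in each time slice. -/
theorem HasDiv.pair_snd (hv : Continuous v)
    (h : HasDiv volume (slab n I : Set (ℝ × Space n)) (spaceTimeField v) (fun _ => 1) fun _ => 0)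
    {f A : ℝ × Space n → ℝ} (hf : Continuous f) (hA : Continuous A)
    (hfA : HasDiv volume (slab n I : Set (ℝ × Space n)) (spaceTimeField v) f A) :
    HasDiv volume ((I : Set ℝ) ×ˢ (Set.univ : Set (Space n × Space n))) (pairField v)
      (fun Q => f (Q.1, Q.2.2)) (fun Q => A (Q.1, Q.2.2)) := by
  intro φ hφ
  have hφf := hφ.continuous_fderiv
  have hφcont := hφ.continuous
  have comp : ∀ G : ℝ × (Space n × Space n) → ℝ, ∫ Q, G Q
      = ∫ p : Space n × (ℝ × Space n), G (p.2.1, (p.1, p.2.2)) := fun G =>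
    (measurePreserving_reorder.integral_comp measurableEmbedding_reorder G).symm
  have hint : ∀ G : ℝ × (Space n × Space n) → ℝ, Continuous G →
      (∀ Q, Q ∉ tsupport φ → G Q = 0) →
      Integrable G ∧ Integrable (fun p : Space n × (ℝ × Space n) => G (p.2.1, (p.1, p.2.2)))
        (volume.prod volume) := by
    intro G hG h0
    have : Integrable G := hG.integrable_of_hasCompactSupport
      (HasCompactSupport.intro hφ.hasCompactSupport h0)
    exact ⟨this, (measurePreserving_reorder.integrable_comp_emb measurableEmbedding_reorder).2 this⟩
  have hx : ∀ (x : Space n), IsTest (slab n I : Set (ℝ × Space n))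
      fun P : ℝ × Space n => φ (P.1, (x, P.2)) := fun x => by
    refine hφ.comp_affine (ι := fun P : ℝ × Space n => (P.1, (x, P.2)))
      (by fun_prop) ?_ (fun P hP => ⟨hP.1, trivial⟩)
    exact LeftInverse.isClosedEmbedding (f := fun Q : ℝ × (Space n × Space n) => (Q.1, Q.2.2))
      (fun _ => rfl) (by fun_prop) (by fun_prop)
  have hy : ∀ (t : ℝ) (y : Space n), IsTest Set.univ fun x : Space n => φ (t, (x, y)) :=
    fun t y => by
    refine hφ.comp_affine (ι := fun x : Space n => (t, (x, y))) (by fun_prop) ?_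
      (Set.subset_univ _)
    exact LeftInverse.isClosedEmbedding (f := fun Q : ℝ × (Space n × Space n) => Q.2.1)
      (fun _ => rfl) (by fun_prop) (by fun_prop)
  have hxd : ∀ (x : Space n) (P e : ℝ × Space n),
      fderiv ℝ (fun P : ℝ × Space n => φ (P.1, (x, P.2))) P e
        = fderiv ℝ φ (P.1, (x, P.2)) (e.1, (0, e.2)) := fun x P e => by
    have h1 : HasFDerivAt (fun P : ℝ × Space n => (P.1, (x, P.2)))
        ((ContinuousLinearMap.fst ℝ ℝ (Space n)).prod
          ((0 : ℝ × Space n →L[ℝ] Space n).prod (ContinuousLinearMap.snd ℝ ℝ (Space n)))) P :=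
      hasFDerivAt_fst.prodMk ((hasFDerivAt_const x P).prodMk hasFDerivAt_snd)
    have h2 : HasFDerivAt (fun P : ℝ × Space n => φ (P.1, (x, P.2))) _ P :=
      (hφ.differentiable _).hasFDerivAt.comp P h1
    rw [h2.fderiv]; rfl
  have hyd : ∀ (t : ℝ) (y x e : Space n), fderiv ℝ (fun x : Space n => φ (t, (x, y))) x e
        = fderiv ℝ φ (t, (x, y)) (0, (e, 0)) := fun t y x e => by
    have h1 : HasFDerivAt (fun x : Space n => (t, (x, y)))
        ((0 : Space n →L[ℝ] ℝ).prod
          ((ContinuousLinearMap.id ℝ (Space n)).prod (0 : Space n →L[ℝ] Space n))) x :=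
      (hasFDerivAt_const t x).prodMk ((hasFDerivAt_id x).prodMk (hasFDerivAt_const y x))
    have h2 : HasFDerivAt (fun x : Space n => φ (t, (x, y))) _ x :=
      (hφ.differentiable _).hasFDerivAt.comp x h1
    rw [h2.fderiv]; rfl
  have split : ∀ Q : ℝ × (Space n × Space n), f (Q.1, Q.2.2) * fderiv ℝ φ Q (pairField v Q)
      = f (Q.1, Q.2.2) * fderiv ℝ φ Q (1, (0, v (Q.1, Q.2.2)))
        + f (Q.1, Q.2.2) * fderiv ℝ φ Q (0, (v (Q.1, Q.2.1), 0)) := fun Q => by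
    rw [← mul_add, ← map_add]; simp [pairField]
  obtain ⟨i1, j1⟩ := hint (fun Q => f (Q.1, Q.2.2) * fderiv ℝ φ Q (1, (0, v (Q.1, Q.2.2))))
    (by fun_prop) (fun Q hQ => by simp [fderiv_eq_zero_of_notMem_tsupport hQ])
  obtain ⟨i2, j2⟩ := hint (fun Q => f (Q.1, Q.2.2) * fderiv ℝ φ Q (0, (v (Q.1, Q.2.1), 0)))
    (by fun_prop) (fun Q hQ => by simp [fderiv_eq_zero_of_notMem_tsupport hQ])
  obtain ⟨i3, j3⟩ := hint (fun Q => A (Q.1, Q.2.2) * φ Q)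
    (by fun_prop) (fun Q hQ => by simp [image_eq_zero_of_notMem_tsupport hQ])
  simp only [split]
  rw [integral_add i1 i2, comp, comp, comp, Measure.volume_eq_prod, integral_prod _ j1,
    integral_prod_symm _ j2, integral_prod _ j3]
  have z2 : ∀ P : ℝ × Space n, ∫ x, f (P.1, P.2) * fderiv ℝ φ (P.1, (x, P.2))
      (0, (v (P.1, x), 0)) = 0 := by
    intro P
    by_cases ht : P.1 ∈ I
    · have := integral_fderiv_slice_eq_zero hv h ht (hy P.1 P.2).contDiff
        (hy P.1 P.2).hasCompactSupport
      simp only [hyd] at this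
      rw [integral_const_mul, this, mul_zero]
    · refine integral_eq_zero_of_ae (ae_of_all _ fun x => ?_)
      have : ((P.1, (x, P.2)) : ℝ × (Space n × Space n)) ∉ tsupport φ := fun hQ =>
        ht (hφ.tsupport_subset hQ).1
      simp [fderiv_eq_zero_of_notMem_tsupport this]
  have z1 : ∀ x : Space n, ∫ P : ℝ × Space n, f (P.1, P.2) * fderiv ℝ φ (P.1, (x, P.2))
      (1, (0, v (P.1, P.2))) = - ∫ P : ℝ × Space n, A (P.1, P.2) * φ (P.1, (x, P.2)) := fun x => by
    have := hfA _ (hx x)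
    simpa only [hxd, spaceTimeField] using this
  simp only [z1, z2, integral_neg, integral_zero, add_zero]

/-- Reduced to `HasDiv.pair_snd` by exchanging the two points. -/
theorem HasDiv.pair_fst (hv : Continuous v)
    (h : HasDiv volume (slab n I : Set (ℝ × Space n)) (spaceTimeField v) (fun _ => 1) fun _ => 0)
    {f A : ℝ × Space n → ℝ} (hf : Continuous f) (hA : Continuous A)
    (hfA : HasDiv volume (slab n I : Set (ℝ × Space n)) (spaceTimeField v) f A) :
    HasDiv volume ((I : Set ℝ) ×ˢ (Set.univ : Set (Space n × Space n))) (pairField v)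
      (fun Q => f (Q.1, Q.2.1)) (fun Q => A (Q.1, Q.2.1)) := by
  intro φ hφ
  let s : (ℝ × (Space n × Space n)) ≃L[ℝ] (ℝ × (Space n × Space n)) :=
    (ContinuousLinearEquiv.refl ℝ ℝ).prodCongr (ContinuousLinearEquiv.prodComm ℝ (Space n) (Space n))
  have hs : MeasurePreserving s volume volume :=
    (MeasurePreserving.id (volume : Measure ℝ)).prod Measure.measurePreserving_swap
  have hse : MeasurableEmbedding s := s.toHomeomorph.isClosedEmbedding.measurableEmbedding
  have ht : IsTest ((I : Set ℝ) ×ˢ (Set.univ : Set (Space n × Space n))) fun Q => φ (s Q) :=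
    hφ.comp_affine s.contDiff s.toHomeomorph.isClosedEmbedding fun Q hQ => ⟨hQ.1, trivial⟩
  have := HasDiv.pair_snd hv h hf hA hfA _ ht
  have hd : ∀ Q e, fderiv ℝ (fun Q => φ (s Q)) Q e = fderiv ℝ φ (s Q) (s e) := fun Q e => by
    have h2 : HasFDerivAt (fun Q => φ (s Q)) _ Q :=
      (hφ.differentiable _).hasFDerivAt.comp Q s.hasFDerivAt
    rw [h2.fderiv]; rfl
  simp only [hd] at this
  rw [← hs.integral_comp hse (fun Q => f (Q.1, Q.2.1) * fderiv ℝ φ Q (pairField v Q)),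
    ← hs.integral_comp hse (fun Q => A (Q.1, Q.2.1) * φ Q)]
  exact this

theorem integral_pair {G : ℝ × (Space n × Space n) → ℝ} (hG : Integrable G) :
    ∫ Q, G Q = ∫ P : ℝ × Space n, ∫ z, G (P.1, (P.2, P.2 + z)) := by
  have h3 := (volume_preserving_prodAssoc (α₁ := ℝ) (β₁ := Space n) (γ₁ := Space n))
  rw [← h3.integral_comp MeasurableEquiv.prodAssoc.measurableEmbedding, Measure.volume_eq_prod,
    integral_prod]
  · congr 1; ext P
    exact (integral_add_left_eq_self (fun y => G (P.1, (P.2, y))) P.2).symm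
  · exact (h3.integrable_comp_emb MeasurableEquiv.prodAssoc.measurableEmbedding).2 hG

/-- Transport of an average against a kernel `L (y - x)`. -/
theorem HasDiv.integral_kernel (hv : Continuous v) {F F' : ℝ × (Space n × Space n) → ℝ}
    (hF : Continuous F) (hF' : Continuous F')
    (h : HasDiv volume ((I : Set ℝ) ×ˢ (Set.univ : Set (Space n × Space n))) (pairField v) F F')
    {L : Space n → ℝ} (hL : ContDiff ℝ ∞ L) (hLc : HasCompactSupport L) :
    HasDiv volume (slab n I : Set (ℝ × Space n)) (spaceTimeField v)
      (fun P => ∫ z, L z * F (P.1, (P.2, P.2 + z)))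
      (fun P => (∫ z, L z * F' (P.1, (P.2, P.2 + z)))
        + ∫ z, fderiv ℝ L z (v (P.1, P.2 + z) - v P) * F (P.1, (P.2, P.2 + z))) := by
  intro φ hφ
  have hφf := hφ.continuous_fderiv
  have hφcont := hφ.continuous
  have hLt : IsTest Set.univ L := ⟨hL, hLc, Set.subset_univ _⟩
  have hLf := hLt.continuous_fderiv
  have hLcont := hLt.continuous
  -- The coordinates ((t,x), y-x), in which the two-point test function φ(t,x)L(y-x) is a product.
  -- Differentiating L(y-x) along the pair field brings out v(t,y) - v(t,x).
  let σ : (ℝ × (Space n × Space n)) ≃L[ℝ] ((ℝ × Space n) × Space n) :=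
    ContinuousLinearEquiv.equivOfInverse
      (((ContinuousLinearMap.fst ℝ ℝ (Space n × Space n)).prod
        ((ContinuousLinearMap.fst ℝ _ _).comp (ContinuousLinearMap.snd ℝ ℝ (Space n × Space n)))).prod
        ((ContinuousLinearMap.snd ℝ _ _).comp (ContinuousLinearMap.snd ℝ ℝ (Space n × Space n)) -
          (ContinuousLinearMap.fst ℝ _ _).comp (ContinuousLinearMap.snd ℝ ℝ (Space n × Space n))))
      (((ContinuousLinearMap.fst ℝ _ _).comp (ContinuousLinearMap.fst ℝ (ℝ × Space n) (Space n))).prod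
        (((ContinuousLinearMap.snd ℝ _ _).comp
            (ContinuousLinearMap.fst ℝ (ℝ × Space n) (Space n))).prod
          ((ContinuousLinearMap.snd ℝ _ _).comp
            (ContinuousLinearMap.fst ℝ (ℝ × Space n) (Space n))
            + (ContinuousLinearMap.snd ℝ (ℝ × Space n) (Space n)))))
      (fun Q => by simp) (fun Q => by simp)
  have hσ : ∀ Q, σ Q = ((Q.1, Q.2.1), Q.2.2 - Q.2.1) := fun Q => rfl
  have hΨ := isTest_mul_prod hφ hLt
  have ht : IsTest ((I : Set ℝ) ×ˢ (Set.univ : Set (Space n × Space n)))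
      fun Q => (fun p : (ℝ × Space n) × Space n => φ p.1 * L p.2) (σ Q) :=
    hΨ.comp_affine σ.contDiff σ.toHomeomorph.isClosedEmbedding fun Q hQ => ⟨hQ.1.1, trivial⟩
  have hd : ∀ (Q e : ℝ × (Space n × Space n)),
      fderiv ℝ (fun Q => φ (Q.1, Q.2.1) * L (Q.2.2 - Q.2.1)) Q e
      = fderiv ℝ φ (Q.1, Q.2.1) (e.1, e.2.1) * L (Q.2.2 - Q.2.1)
        + φ (Q.1, Q.2.1) * fderiv ℝ L (Q.2.2 - Q.2.1) (e.2.2 - e.2.1) := fun Q e => by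
    have h2 : HasFDerivAt (fun Q => (fun p : (ℝ × Space n) × Space n => φ p.1 * L p.2) (σ Q)) _ Q :=
      (hΨ.differentiable _).hasFDerivAt.comp Q σ.hasFDerivAt
    rw [show fderiv ℝ (fun Q : ℝ × (Space n × Space n) =>
      φ (Q.1, Q.2.1) * L (Q.2.2 - Q.2.1)) Q = _ from h2.fderiv]
    change fderiv ℝ (fun p : (ℝ × Space n) × Space n => φ p.1 * L p.2) (σ Q) (σ e) = _
    rw [fderiv_mul_prod hφ.differentiable hLt.differentiable]
    simp only [hσ]
  have key := h _ ht
  have k1 := ht.integrable_mul_fderiv hF (continuous_pairField hv) volume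
  have k2 := ht.integrable_mul hF' volume
  rw [integral_pair k1, integral_pair k2] at key
  simp only [hσ] at key
  simp only [hd, pairField, add_sub_cancel_left] at key
  have cF : Continuous (uncurry fun (P : ℝ × Space n) z => F (P.1, (P.2, P.2 + z))) := by
    simp only [uncurry_def]; fun_prop
  have cF' : Continuous (uncurry fun (P : ℝ × Space n) z => F' (P.1, (P.2, P.2 + z))) := by
    simp only [uncurry_def]; fun_prop
  have c1 := continuous_integral_mul (μ := volume) hLcont hLc cF
  have c2 := continuous_integral_mul (μ := volume) hLcont hLc cF'
  have c3 : Continuous fun P : ℝ × Space n =>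
      ∫ z, fderiv ℝ L z (v (P.1, P.2 + z) - v P) * F (P.1, (P.2, P.2 + z)) := by
    rw [← continuousOn_univ]
    refine continuousOn_integral_of_compact_support hLc.isCompact (Continuous.continuousOn ?_) ?_
    · simp only [uncurry_def] at cF ⊢; fun_prop
    · intro p x _ hx
      simp [fderiv_eq_zero_of_notMem_tsupport hx]
  have inner1 : ∀ P : ℝ × Space n, ∫ z, F (P.1, (P.2, P.2 + z)) *
      (fderiv ℝ φ (P.1, P.2) (1, v (P.1, P.2)) * L z +
        φ (P.1, P.2) * fderiv ℝ L z (v (P.1, P.2 + z) - v (P.1, P.2)))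
      = (∫ z, L z * F (P.1, (P.2, P.2 + z))) * fderiv ℝ φ P (spaceTimeField v P)
        + (∫ z, fderiv ℝ L z (v (P.1, P.2 + z) - v P) * F (P.1, (P.2, P.2 + z))) * φ P := by
    intro P
    rw [← integral_mul_const, ← integral_mul_const, ← integral_add]
    · congr 1; ext z; simp only [spaceTimeField, Prod.mk.eta]; ring
    · refine Integrable.mul_const ?_ _
      refine Continuous.integrable_of_hasCompactSupport (by fun_prop) hLc.mul_right
    · refine Integrable.mul_const ?_ _
      refine Continuous.integrable_of_hasCompactSupport (by fun_prop)
        (HasCompactSupport.intro hLc fun z hz => by simp [fderiv_eq_zero_of_notMem_tsupport hz])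
  have inner2 : ∀ P : ℝ × Space n, ∫ z, F' (P.1, (P.2, P.2 + z)) * (φ (P.1, P.2) * L z)
      = (∫ z, L z * F' (P.1, (P.2, P.2 + z))) * φ P := by
    intro P
    rw [← integral_mul_const]
    congr 1; ext z; simp only [Prod.mk.eta]; ring
  simp only [inner1, inner2] at key
  simp only [add_mul]
  rw [integral_add (hφ.integrable_mul_fderiv c1 (continuous_spaceTimeField hv) volume)
    (hφ.integrable_mul c3 volume)] at key
  rw [integral_add (hφ.integrable_mul c2 volume) (hφ.integrable_mul c3 volume)]
  linarith

end

/-! ### Dyadically rescaled kernels, Hölder classes and summation over scales -/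

section

variable {n : ℕ}

/-- The rescaled kernel `2^{(n+s)q} L(2^q z)`. -/
noncomputable def scaled (s q : ℤ) (L : Space n → ℝ) (z : Space n) : ℝ :=
  (2 : ℝ) ^ ((n + s) * q) * L ((2 : ℝ) ^ q • z)

/-- The pairing of the rescaled kernel with `H`. -/
noncomputable def kint (s q : ℤ) (L H : Space n → ℝ) : ℝ := ∫ z, scaled s q L z * H z

/-- The `j`-th partial derivative. -/
noncomputable def partialDeriv (j : Fin n) (L : Space n → ℝ) (z : Space n) : ℝ :=
  fderiv ℝ L z (EuclideanSpace.single j 1)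

theorem IsTest.partialDeriv {U : Set (Space n)} {L : Space n → ℝ} (hL : IsTest U L) (j : Fin n) :
    IsTest U (partialDeriv j L) :=
  hL.fderiv_apply _

theorem fderiv_apply_eq_sum (L : Space n → ℝ) (z e : Space n) :
    fderiv ℝ L z e = ∑ j, partialDeriv j L z * e j := by
  conv_lhs => rw [← (EuclideanSpace.basisFun (Fin n) ℝ).sum_repr e]
  simp [partialDeriv, map_sum, mul_comm]

theorem IsTest.scaled {L : Space n → ℝ} (hL : IsTest Set.univ L) (s q : ℤ) :
    IsTest Set.univ (scaled s q L) where
  contDiff := contDiff_const.mul (hL.contDiff.comp (contDiff_const_smul _))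
  hasCompactSupport := (hL.hasCompactSupport.comp_smul (zpow_ne_zero q two_ne_zero)).mul_left
  tsupport_subset := Set.subset_univ _

/-- The chain rule supplies a factor 2^q, so each derivative of the kernel raises its order s by
one. -/
theorem partialDeriv_scaled {L : Space n → ℝ} (hL : Differentiable ℝ L) (s q : ℤ) (j : Fin n) :
    partialDeriv j (scaled s q L) = scaled (s + 1) q (partialDeriv j L) := by
  ext z
  have h : HasFDerivAt (fun z => (2 : ℝ) ^ ((n + s) * q) * L ((2 : ℝ) ^ q • z))
      ((2 : ℝ) ^ ((n + s) * q) • (fderiv ℝ L ((2 : ℝ) ^ q • z)).comp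
        ((2 : ℝ) ^ q • ContinuousLinearMap.id ℝ (Space n))) z :=
    ((hL _).hasFDerivAt.comp z ((hasFDerivAt_id z).const_smul ((2 : ℝ) ^ q))).const_mul _
  simp only [partialDeriv, scaled]
  rw [show fderiv ℝ (scaled s q L) z = _ from h.fderiv,
    show ((n : ℤ) + (s + 1)) * q = (n + s) * q + q by ring, zpow_add₀ two_ne_zero]
  simp; ring

/-- The substitution u = 2^q z. It exhibits s as the order of the kernel: the pairing has size
2^(sq) against a bounded function. -/
theorem kint_eq (s q : ℤ) (L H : Space n → ℝ) :
    kint s q L H = (2 : ℝ) ^ (s * q) * ∫ u, L u * H (((2 : ℝ) ^ q)⁻¹ • u) := by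
  have h := Measure.integral_comp_smul (volume : Measure (Space n))
    (fun u => L u * H (((2 : ℝ) ^ q)⁻¹ • u)) ((2 : ℝ) ^ q)
  have h2 : (2 : ℝ) ^ q ≠ 0 := zpow_ne_zero q two_ne_zero
  simp only [smul_smul, inv_mul_cancel₀ h2, one_smul, finrank_euclideanSpace_fin,
    smul_eq_mul] at h
  have e : ((2 : ℝ) ^ q) ^ n = (2 : ℝ) ^ ((n : ℤ) * q) := by
    rw [← zpow_natCast, ← zpow_mul, mul_comm]
  rw [abs_of_pos (by positivity), e] at h
  simp only [kint, scaled, mul_assoc, integral_const_mul]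
  rw [h, ← mul_assoc, add_mul, zpow_add₀ two_ne_zero]
  field_simp

/-- A two-sided geometric weight. -/
noncomputable def geo (δ : ℝ) (q : ℤ) : ℝ := (2 : ℝ) ^ (-δ * |(q : ℝ)|)

theorem geo_nonneg (δ : ℝ) (q : ℤ) : 0 ≤ geo δ q := by unfold geo; positivity

theorem summable_geo {δ : ℝ} (hδ : 0 < δ) : Summable (geo δ) := by
  have h1 : (2 : ℝ) ^ (-δ) < 1 := Real.rpow_lt_one_of_one_lt_of_neg one_lt_two (by linarith)
  have h2 : Summable fun m : ℕ => ((2 : ℝ) ^ (-δ)) ^ m :=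
    summable_geometric_of_lt_one (by positivity) h1
  have e : ∀ m : ℕ, ((2 : ℝ) ^ (-δ)) ^ m = (2 : ℝ) ^ (-δ * m) := fun m => by
    rw [Real.rpow_mul zero_le_two, Real.rpow_natCast]
  refine Summable.of_nat_of_neg ?_ ?_ <;> simpa [geo, e] using h2

theorem rpow_two_le {x y : ℝ} (h : x ≤ y) : (2 : ℝ) ^ x ≤ (2 : ℝ) ^ y :=
  Real.rpow_le_rpow_of_exponent_le one_le_two h

theorem integrable_norm_rpow_mul {L : Space n → ℝ} (hL : IsTest Set.univ L) {a : ℝ} (ha : 0 ≤ a) :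
    Integrable fun u => |L u| * (1 + ‖u‖ ^ a) := by
  have h1 := hL.continuous
  have h2 : Continuous fun u : Space n => ‖u‖ ^ a := continuous_norm.rpow_const fun _ => Or.inr ha
  exact (h1.abs.mul (continuous_const.add h2)).integrable_of_hasCompactSupport
    (hL.hasCompactSupport.norm.mul_right)

/-- After rescaling, a function that vanishes like |z|^a gains 2^(-aq). The weight 1 + |u|^a is
convenient for every a ≥ 0; the case a = 0 is the bound for merely bounded functions. -/
theorem abs_kint_le {L H : Space n → ℝ} (hL : IsTest Set.univ L) (s q : ℤ) {a A : ℝ} (ha : 0 ≤ a)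
    (hA : 0 ≤ A) (hH : ∀ z, |H z| ≤ A * ‖z‖ ^ a) :
    |kint s q L H| ≤ A * (∫ u, |L u| * (1 + ‖u‖ ^ a)) * (2 : ℝ) ^ ((s - a) * q) := by
  have h2 : (0 : ℝ) < (2 : ℝ) ^ q := by positivity
  have key : |∫ u, L u * H (((2 : ℝ) ^ q)⁻¹ • u)|
      ≤ ∫ u, (A * (((2 : ℝ) ^ q)⁻¹) ^ a) * (|L u| * (1 + ‖u‖ ^ a)) := by
    rw [← Real.norm_eq_abs]
    refine norm_integral_le_of_norm_le ((integrable_norm_rpow_mul hL ha).const_mul _)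
      (ae_of_all _ fun u => ?_)
    have h := hH (((2 : ℝ) ^ q)⁻¹ • u)
    rw [norm_smul, Real.norm_eq_abs, abs_of_pos (inv_pos.2 h2),
      Real.mul_rpow (by positivity) (norm_nonneg _)] at h
    rw [Real.norm_eq_abs, abs_mul]
    calc _ ≤ |L u| * (A * ((((2 : ℝ) ^ q)⁻¹) ^ a * ‖u‖ ^ a)) := by gcongr
      _ = (A * (((2 : ℝ) ^ q)⁻¹) ^ a) * (|L u| * ‖u‖ ^ a) := by ring
      _ ≤ _ := by gcongr; linarith
  rw [integral_const_mul] at key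
  rw [kint_eq, abs_mul, abs_of_pos (by positivity : (0 : ℝ) < 2 ^ (s * q))]
  have e : (2 : ℝ) ^ ((s - a) * q) = (2 : ℝ) ^ (s * q) * (((2 : ℝ) ^ q)⁻¹) ^ a := by
    rw [← Real.rpow_intCast, ← Real.rpow_intCast, ← Real.rpow_neg zero_le_two,
      ← Real.rpow_mul zero_le_two, ← Real.rpow_add zero_lt_two]
    push_cast; ring_nf
  rw [e]
  calc _ ≤ (2 : ℝ) ^ (s * q) * _ := mul_le_mul_of_nonneg_left key (by positivity)
    _ = _ := by ring

/-- The constant in the kernel bounds. -/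
noncomputable def kerConst (L : Space n → ℝ) (a : ℝ) : ℝ :=
  (∫ u, |L u| * (1 + ‖u‖ ^ a)) + ∫ u, |L u| * (1 + ‖u‖ ^ (0 : ℝ))

theorem kerConst_nonneg (L : Space n → ℝ) (a : ℝ) : 0 ≤ kerConst L a := by
  unfold kerConst
  have : ∀ a : ℝ, 0 ≤ ∫ u, |L u| * (1 + ‖u‖ ^ a) := fun a =>
    integral_nonneg fun u => by positivity
  exact add_nonneg (this a) (this 0)

/-- At fine scales (q ≥ 0) the order of vanishing a > s provides the decay; at coarse scales (q ≤ 0)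
boundedness is enough because s > 0. The result decays geometrically in both directions. -/
theorem abs_kint_le_geo {L H : Space n → ℝ} (hL : IsTest Set.univ L) {s : ℤ} (q : ℤ) {a A : ℝ}
    (hs : 0 < s) (ha : s < a) (hA : 0 ≤ A) (hH : ∀ z, |H z| ≤ A) (hHa : ∀ z, |H z| ≤ A * ‖z‖ ^ a) :
    |kint s q L H| ≤ A * kerConst L a * geo (min s (a - s)) q := by
  have hs' : (0 : ℝ) < s := by exact_mod_cast hs
  have k1 := abs_kint_le hL s q (hs'.trans ha).le hA hHa
  have k2 := abs_kint_le hL s q le_rfl hA (by simpa using hH)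
  have p1 : 0 ≤ ∫ u, |L u| * (1 + ‖u‖ ^ a) := integral_nonneg fun u => by positivity
  have p2 : 0 ≤ ∫ u, |L u| * (1 + ‖u‖ ^ (0 : ℝ)) := integral_nonneg fun u => by positivity
  have g0 := geo_nonneg (min s (a - s)) q
  have kc : kerConst L a = (∫ u, |L u| * (1 + ‖u‖ ^ a)) + ∫ u, |L u| * (1 + ‖u‖ ^ (0 : ℝ)) := rfl
  rcases le_total 0 q with hq | hq
  · have hq' : (0 : ℝ) ≤ q := by exact_mod_cast hq
    have g : (2 : ℝ) ^ ((s - a) * q) ≤ geo (min s (a - s)) q := by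
      refine rpow_two_le ?_
      rw [abs_of_nonneg hq']
      nlinarith [min_le_right (s : ℝ) (a - s)]
    refine k1.trans (mul_le_mul (mul_le_mul_of_nonneg_left ?_ hA) g (by positivity)
      (mul_nonneg hA (kerConst_nonneg _ _)))
    linarith
  · have hq' : (q : ℝ) ≤ 0 := by exact_mod_cast hq
    have g : (2 : ℝ) ^ (((s : ℝ) - 0) * q) ≤ geo (min s (a - s)) q := by
      refine rpow_two_le ?_
      rw [abs_of_nonpos hq']
      nlinarith [min_le_left (s : ℝ) (a - s)]
    refine k2.trans (mul_le_mul (mul_le_mul_of_nonneg_left ?_ hA) g (by positivity)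
      (mul_nonneg hA (kerConst_nonneg _ _)))
    linarith

/-- Families of functions summable in the Hölder space of exponent `β`. -/
def SumHolder (β : ℝ) (k : ℤ → ℝ × Space n → ℝ) : Prop :=
  ∃ c : ℤ → ℝ, Summable c ∧ (∀ q P, |k q P| ≤ c q) ∧
    ∀ q P Q, |k q P - k q Q| ≤ c q * ‖P - Q‖ ^ β

/-- Bounded functions that are globally Hölder continuous of exponent `β`. -/
def BddHolder {X : Type*} [NormedAddCommGroup X] (β : ℝ) (f : X → ℝ) : Prop :=
  ∃ C : ℝ, (∀ P, |f P| ≤ C) ∧ ∀ P Q, |f P - f Q| ≤ C * ‖P - Q‖ ^ β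

theorem SumHolder.summable {β : ℝ} {k : ℤ → ℝ × Space n → ℝ} (h : SumHolder β k)
    (P : ℝ × Space n) : Summable fun q => k q P := by
  obtain ⟨c, hc, h1, -⟩ := h
  exact hc.of_norm_bounded fun q => h1 q P

theorem SumHolder.bddHolder_tsum {β : ℝ} {k : ℤ → ℝ × Space n → ℝ} (h : SumHolder β k) :
    BddHolder β fun P => ∑' q, k q P := by
  have hs := h.summable
  obtain ⟨c, hc, h1, h2⟩ := h
  refine ⟨∑' q, c q, fun P => ?_, fun P Q => ?_⟩
  · exact tsum_of_norm_bounded (f := fun q => k q P) hc.hasSum fun q => h1 q P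
  · rw [← (hs P).tsum_sub (hs Q), ← tsum_mul_right]
    exact tsum_of_norm_bounded (f := fun q => k q P - k q Q) (hc.mul_right _).hasSum
      fun q => h2 q P Q

theorem SumHolder.exists_abs_sum_le {β : ℝ} {k : ℤ → ℝ × Space n → ℝ} (h : SumHolder β k) :
    ∃ C, ∀ (S : Finset ℤ) P, |∑ q ∈ S, k q P| ≤ C := by
  obtain ⟨c, hc, h1, -⟩ := h
  refine ⟨∑' q, c q, fun S P => ?_⟩
  calc |∑ q ∈ S, k q P| ≤ ∑ q ∈ S, |k q P| := Finset.abs_sum_le_sum_abs _ _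
    _ ≤ ∑ q ∈ S, c q := Finset.sum_le_sum fun q _ => h1 q P
    _ ≤ ∑' q, c q := hc.sum_le_tsum S fun q _ => (abs_nonneg _).trans (h1 q 0)

theorem tendsto_Ico_neg_atTop : Tendsto (fun M : ℕ => Finset.Ico (-(M : ℤ)) M) atTop atTop := by
  refine tendsto_atTop_finset_of_monotone (fun a b hab => ?_) fun q => ?_
  · exact Finset.Ico_subset_Ico (by simpa using hab) (by simpa using hab)
  · refine ⟨q.natAbs + 1, ?_⟩
    simp only [Finset.mem_Ico, Nat.cast_add, Nat.cast_one]
    omega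

theorem SumHolder.tendsto {β : ℝ} {k : ℤ → ℝ × Space n → ℝ} (h : SumHolder β k)
    (P : ℝ × Space n) : Tendsto (fun M : ℕ => ∑ q ∈ Finset.Ico (-(M : ℤ)) M, k q P) atTop
      (𝓝 (∑' q, k q P)) :=
  (h.summable P).hasSum.comp tendsto_Ico_neg_atTop

theorem SumHolder.sum {ι : Type*} {β : ℝ} (s : Finset ι) {k : ι → ℤ → ℝ × Space n → ℝ}
    (h : ∀ i ∈ s, SumHolder β (k i)) : SumHolder β fun q P => ∑ i ∈ s, k i q P := by
  classical
  choose! c hc h1 h2 using h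
  refine ⟨fun q => ∑ i ∈ s, c i q, summable_sum hc, fun q P => ?_, fun q P Q => ?_⟩
  · exact (Finset.abs_sum_le_sum_abs _ _).trans (Finset.sum_le_sum fun i hi => h1 i hi q P)
  · rw [← Finset.sum_sub_distrib, Finset.sum_mul]
    exact (Finset.abs_sum_le_sum_abs _ _).trans (Finset.sum_le_sum fun i hi => h2 i hi q P Q)

theorem SumHolder.add {β : ℝ} {k l : ℤ → ℝ × Space n → ℝ} (hk : SumHolder β k)
    (hl : SumHolder β l) : SumHolder β fun q P => k q P + l q P := by
  obtain ⟨c, hc, h1, h2⟩ := hk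
  obtain ⟨d, hd, g1, g2⟩ := hl
  refine ⟨fun q => c q + d q, hc.add hd, fun q P => ?_, fun q P Q => ?_⟩
  · exact (abs_add_le _ _).trans (add_le_add (h1 q P) (g1 q P))
  · rw [add_sub_add_comm, add_mul]
    exact (abs_add_le _ _).trans (add_le_add (h2 q P Q) (g2 q P Q))

theorem SumHolder.neg {β : ℝ} {k : ℤ → ℝ × Space n → ℝ} (hk : SumHolder β k) :
    SumHolder β fun q P => - k q P := by
  obtain ⟨c, hc, h1, h2⟩ := hk
  refine ⟨c, hc, fun q P => by rw [abs_neg]; exact h1 q P, fun q P Q => ?_⟩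
  rw [neg_sub_neg, abs_sub_comm]
  exact h2 q P Q

section BddHolder

variable {X : Type*} [NormedAddCommGroup X]

theorem BddHolder.continuous {β : ℝ} (hβ : 0 < β) {f : X → ℝ} (h : BddHolder β f) :
    Continuous f := by
  obtain ⟨C, -, hC⟩ := h
  rw [continuous_iff_continuousAt]
  intro P
  rw [ContinuousAt, tendsto_iff_norm_sub_tendsto_zero]
  refine squeeze_zero (fun _ => norm_nonneg _) (fun Q => hC Q P) ?_
  have : Continuous fun Q : X => C * ‖Q - P‖ ^ β :=
    continuous_const.mul ((continuous_id.sub continuous_const).norm.rpow_const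
      fun _ => Or.inr hβ.le)
  have h := this.tendsto P
  simpa [Real.zero_rpow hβ.ne'] using h

theorem BddHolder.mono {β β' : ℝ} {f : X → ℝ} (h : BddHolder β f) (h0 : 0 ≤ β')
    (hβ : β' ≤ β) : BddHolder β' f := by
  obtain ⟨C, h1, h2⟩ := h
  have hC : 0 ≤ C := (abs_nonneg _).trans (h1 0)
  refine ⟨2 * C, fun P => (h1 P).trans (by linarith), fun P Q => ?_⟩
  rcases le_total ‖P - Q‖ 1 with h | h
  · rcases (norm_nonneg (P - Q)).eq_or_lt with h3 | h3
    · have : P = Q := sub_eq_zero.1 (norm_eq_zero.1 h3.symm)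
      simp only [this, sub_self, abs_zero]; positivity
    · have := Real.rpow_le_rpow_of_exponent_ge h3 h hβ
      have h4 : 0 ≤ ‖P - Q‖ ^ β' := by positivity
      refine (h2 P Q).trans ?_
      nlinarith
  · have h3 : 1 ≤ ‖P - Q‖ ^ β' := Real.one_le_rpow h h0
    have := (abs_sub (f P) (f Q)).trans (add_le_add (h1 P) (h1 Q))
    nlinarith

theorem BddHolder.mul {β : ℝ} {f g : X → ℝ} (hf : BddHolder β f) (hg : BddHolder β g) :
    BddHolder β fun P => f P * g P := by
  obtain ⟨C, h1, h2⟩ := hf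
  obtain ⟨D, g1, g2⟩ := hg
  have hC : 0 ≤ C := (abs_nonneg _).trans (h1 0)
  have hD : 0 ≤ D := (abs_nonneg _).trans (g1 0)
  refine ⟨2 * (C * D), fun P => ?_, fun P Q => ?_⟩
  · rw [abs_mul]
    have := mul_le_mul (h1 P) (g1 P) (abs_nonneg _) hC
    nlinarith [mul_nonneg hC hD]
  · have e : f P * g P - f Q * g Q = f P * (g P - g Q) + (f P - f Q) * g Q := by ring
    rw [e]
    refine (abs_add_le _ _).trans ?_
    rw [abs_mul, abs_mul]
    have a1 := mul_le_mul (h1 P) (g2 P Q) (abs_nonneg _) hC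
    have a2 := mul_le_mul (h2 P Q) (g1 Q) (abs_nonneg _) (by positivity)
    linarith

theorem BddHolder.add {β : ℝ} {f g : X → ℝ} (hf : BddHolder β f) (hg : BddHolder β g) :
    BddHolder β fun P => f P + g P := by
  obtain ⟨C, h1, h2⟩ := hf
  obtain ⟨D, g1, g2⟩ := hg
  refine ⟨C + D, fun P => (abs_add_le _ _).trans (add_le_add (h1 P) (g1 P)), fun P Q => ?_⟩
  rw [add_sub_add_comm, add_mul]
  exact (abs_add_le _ _).trans (add_le_add (h2 P Q) (g2 P Q))

theorem BddHolder.neg {β : ℝ} {f : X → ℝ} (hf : BddHolder β f) :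
    BddHolder β fun P => - f P := by
  obtain ⟨C, h1, h2⟩ := hf
  refine ⟨C, fun P => by rw [abs_neg]; exact h1 P, fun P Q => ?_⟩
  rw [neg_sub_neg, abs_sub_comm]
  exact h2 P Q

theorem BddHolder.sum {ι : Type*} {β : ℝ} (s : Finset ι) {f : ι → X → ℝ}
    (h : ∀ i ∈ s, BddHolder β (f i)) : BddHolder β fun P => ∑ i ∈ s, f i P := by
  classical
  choose! C h1 h2 using h
  refine ⟨∑ i ∈ s, C i, fun P => ?_, fun P Q => ?_⟩
  · exact (Finset.abs_sum_le_sum_abs _ _).trans (Finset.sum_le_sum fun i hi => h1 i hi P)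
  · rw [← Finset.sum_sub_distrib, Finset.sum_mul]
    exact (Finset.abs_sum_le_sum_abs _ _).trans (Finset.sum_le_sum fun i hi => h2 i hi P Q)

end BddHolder

/-- Functions of `(P, z)` that vanish like `|z|^a` at `z = 0` and are Hölder continuous of
exponent `β` in `P`. -/
def Inc (β a : ℝ) (F : ℝ × Space n → Space n → ℝ) : Prop :=
  ∃ A : ℝ, 0 ≤ A ∧ (∀ P z, |F P z| ≤ A) ∧ (∀ P z, |F P z| ≤ A * ‖z‖ ^ a) ∧
    (∀ P Q z, |F P z - F Q z| ≤ A * ‖P - Q‖ ^ β) ∧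
    ∀ P Q z, |F P z - F Q z| ≤ A * ‖P - Q‖ ^ β * ‖z‖ ^ (a - β)

/-- Orders of vanishing add up. In a difference between P and Q only one factor at a time is
differenced, so the loss β is paid once. -/
theorem Inc.mul {β a b : ℝ} (hβa : β ≤ a) (ha : 0 < a) (hb : 0 < b) (hβb : β ≤ b)
    {F G : ℝ × Space n → Space n → ℝ}
    (hF : Inc β a F) (hG : Inc β b G) : Inc β (a + b) fun P z => F P z * G P z := by
  obtain ⟨A, hA, f1, f2, f3, f4⟩ := hF
  obtain ⟨B, hB, g1, g2, g3, g4⟩ := hG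
  have hAB := mul_nonneg hA hB
  have e : ∀ P Q z, F P z * G P z - F Q z * G Q z = F P z * (G P z - G Q z)
    + (F P z - F Q z) * G Q z := fun P Q z => by ring
  refine ⟨2 * (A * B), by positivity, fun P z => ?_, fun P z => ?_, fun P Q z => ?_,
    fun P Q z => ?_⟩
  · rw [abs_mul]
    have := mul_le_mul (f1 P z) (g1 P z) (abs_nonneg _) hA
    linarith
  · rw [abs_mul, Real.rpow_add_of_nonneg (norm_nonneg z) ha.le hb.le]
    have := mul_le_mul (f2 P z) (g2 P z) (abs_nonneg _) (by positivity)
    have h : 0 ≤ A * B * (‖z‖ ^ a * ‖z‖ ^ b) := by positivity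
    linarith
  · rw [e]
    refine (abs_add_le _ _).trans ?_
    rw [abs_mul, abs_mul]
    have a1 := mul_le_mul (f1 P z) (g3 P Q z) (abs_nonneg _) hA
    have a2 := mul_le_mul (f3 P Q z) (g1 Q z) (abs_nonneg _) (by positivity)
    linarith
  · rw [e]
    refine (abs_add_le _ _).trans ?_
    rw [abs_mul, abs_mul]
    have a1 := mul_le_mul (f2 P z) (g4 P Q z) (abs_nonneg _) (by positivity)
    have a2 := mul_le_mul (f4 P Q z) (g2 Q z) (abs_nonneg _) (by positivity)
    have r1 : ‖z‖ ^ (a + b - β) = ‖z‖ ^ a * ‖z‖ ^ (b - β) := by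
      rw [← Real.rpow_add_of_nonneg (norm_nonneg z) ha.le (by linarith)]; ring_nf
    have r2 : ‖z‖ ^ (a + b - β) = ‖z‖ ^ (a - β) * ‖z‖ ^ b := by
      rw [← Real.rpow_add_of_nonneg (norm_nonneg z) (by linarith) hb.le]; ring_nf
    calc _ ≤ _ := add_le_add a1 a2
      _ = A * B * ‖P - Q‖ ^ β * (‖z‖ ^ a * ‖z‖ ^ (b - β))
          + A * B * ‖P - Q‖ ^ β * (‖z‖ ^ (a - β) * ‖z‖ ^ b) := by ring
      _ = _ := by rw [← r1, ← r2]; ring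

theorem Inc.add {β a : ℝ} {F G : ℝ × Space n → Space n → ℝ} (hF : Inc β a F) (hG : Inc β a G) :
    Inc β a fun P z => F P z + G P z := by
  obtain ⟨A, hA, f1, f2, f3, f4⟩ := hF
  obtain ⟨B, hB, g1, g2, g3, g4⟩ := hG
  refine ⟨A + B, by positivity, fun P z => ?_, fun P z => ?_, fun P Q z => ?_,
    fun P Q z => ?_⟩
  · exact (abs_add_le _ _).trans (add_le_add (f1 P z) (g1 P z))
  · rw [add_mul]
    exact (abs_add_le _ _).trans (add_le_add (f2 P z) (g2 P z))
  · rw [add_sub_add_comm, add_mul]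
    exact (abs_add_le _ _).trans (add_le_add (f3 P Q z) (g3 P Q z))
  · rw [add_sub_add_comm, add_mul, add_mul]
    exact (abs_add_le _ _).trans (add_le_add (f4 P Q z) (g4 P Q z))

/-- The spatial increment `f(t, x + z) - f(t, x)`. -/
def incr (f : ℝ × Space n → ℝ) (P : ℝ × Space n) (z : Space n) : ℝ := f (P.1, P.2 + z) - f P

/-- Interpolation between two bounds for the difference of increments. If |P-Q| ≤ |z|, compare the
values at P and Q; otherwise estimate each increment by |z|^a. Either way |P-Q|^β |z|^(a-β)
dominates. -/
theorem Inc.incr {β a : ℝ} (hβ : 0 ≤ β) (hβa : β ≤ a) {f : ℝ × Space n → ℝ}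
    (hf : BddHolder a f) : Inc β a (incr f) := by
  obtain ⟨D, d1, d2⟩ := hf.mono hβ hβa
  obtain ⟨C, c1, c2⟩ := hf
  have hC : 0 ≤ C := (abs_nonneg _).trans (c1 0)
  have hD : 0 ≤ D := (abs_nonneg _).trans (d1 0)
  have n1 : ∀ (P : ℝ × Space n) z, ‖(P.1, P.2 + z) - P‖ = ‖z‖ := fun P z => by
    rw [show (P.1, P.2 + z) - P = (0, z) by ext <;> simp]
    simp [Prod.norm_def]
  have n2 : ∀ (P Q : ℝ × Space n) z, (P.1, P.2 + z) - (Q.1, Q.2 + z) = P - Q := fun P Q z => by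
    ext <;> simp
  have b2 : ∀ P z, |EulerPressure.incr f P z| ≤ C * ‖z‖ ^ a := fun P z => by
    simpa only [n1, EulerPressure.incr] using c2 (P.1, P.2 + z) P
  have e : ∀ P Q z, EulerPressure.incr f P z - EulerPressure.incr f Q z
      = (f (P.1, P.2 + z) - f (Q.1, Q.2 + z)) - (f P - f Q) := fun P Q z => by
    simp only [EulerPressure.incr]; ring
  have b3 : ∀ {E γ : ℝ}, (∀ P Q, |f P - f Q| ≤ E * ‖P - Q‖ ^ γ) → ∀ P Q z,
      |EulerPressure.incr f P z - EulerPressure.incr f Q z| ≤ 2 * E * ‖P - Q‖ ^ γ := by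
    intro E γ hE P Q z
    rw [e]
    have h1 := hE (P.1, P.2 + z) (Q.1, Q.2 + z)
    rw [n2] at h1
    refine (abs_sub _ _).trans ?_
    linarith [hE P Q]
  refine ⟨2 * C + 2 * D, by positivity, fun P z => ?_, fun P z => ?_, fun P Q z => ?_,
    fun P Q z => ?_⟩
  · refine (abs_sub _ _).trans ?_
    linarith [c1 (P.1, P.2 + z), c1 P]
  · refine (b2 P z).trans ?_
    gcongr
    linarith
  · refine (b3 d2 P Q z).trans ?_
    gcongr
    linarith
  · have p1 := norm_nonneg (P - Q)
    have p2 := norm_nonneg z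
    have r : ∀ x : ℝ, 0 ≤ x → x ^ a = x ^ β * x ^ (a - β) := fun x hx => by
      rw [← Real.rpow_add_of_nonneg hx hβ (by linarith)]; ring_nf
    have main : |EulerPressure.incr f P z - EulerPressure.incr f Q z|
        ≤ 2 * C * (‖P - Q‖ ^ β * ‖z‖ ^ (a - β)) := by
      rcases le_total ‖P - Q‖ ‖z‖ with h | h
      · refine (b3 c2 P Q z).trans ?_
        rw [r _ p1]
        have := Real.rpow_le_rpow p1 h (by linarith : 0 ≤ a - β)
        gcongr
      · refine (abs_sub _ _).trans ((add_le_add (b2 P z) (b2 Q z)).trans ?_)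
        rw [r _ p2]
        have := Real.rpow_le_rpow p2 h hβ
        have h3 : ‖z‖ ^ β * ‖z‖ ^ (a - β) ≤ ‖P - Q‖ ^ β * ‖z‖ ^ (a - β) := by gcongr
        nlinarith
    refine main.trans ?_
    rw [← mul_assoc]
    gcongr
    linarith

theorem integrable_scaled_mul {L H : Space n → ℝ} (hL : IsTest Set.univ L) (s q : ℤ)
    (hH : Continuous H) : Integrable fun z => scaled s q L z * H z := by
  have := (hL.scaled s q).integrable_mul hH volume
  simpa only [mul_comm] using this

theorem kint_sub {L H H' : Space n → ℝ} (hL : IsTest Set.univ L) (s q : ℤ)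
    (hH : Continuous H) (hH' : Continuous H') :
    kint s q L H - kint s q L H' = kint s q L fun z => H z - H' z := by
  simp only [kint, mul_sub]
  rw [integral_sub (integrable_scaled_mul hL s q hH) (integrable_scaled_mul hL s q hH')]

theorem kint_add {L H H' : Space n → ℝ} (hL : IsTest Set.univ L) (s q : ℤ)
    (hH : Continuous H) (hH' : Continuous H') :
    kint s q L (fun z => H z + H' z) = kint s q L H + kint s q L H' := by
  simp only [kint, mul_add]
  rw [integral_add (integrable_scaled_mul hL s q hH) (integrable_scaled_mul hL s q hH')]

theorem kint_const_mul (L H : Space n → ℝ) (s q : ℤ) (c : ℝ) :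
    kint s q L (fun z => c * H z) = c * kint s q L H := by
  simp only [kint, ← integral_const_mul]
  congr 1; ext z; ring

theorem continuous_kint {L : Space n → ℝ} (hL : IsTest Set.univ L) (s q : ℤ)
    {F : ℝ × Space n → Space n → ℝ} (hF : Continuous (uncurry F)) :
    Continuous fun P => kint s q L (F P) :=
  continuous_integral_mul (hL.scaled s q).continuous (hL.scaled s q).hasCompactSupport hF

/-- The differences in P vanish only to order a - β at z = 0, which is why the order s of the kernel
must stay below a - β. -/
theorem Inc.sumHolder {β a : ℝ} {s : ℤ} {F : ℝ × Space n → Space n → ℝ} (hF : Inc β a F)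
    (hFc : ∀ P, Continuous (F P)) {L : Space n → ℝ} (hL : IsTest Set.univ L) (hβ : 0 ≤ β)
    (hs : 0 < s) (ha : s < a - β) : SumHolder β fun q P => kint s q L (F P) := by
  obtain ⟨A, hA, f1, f2, f3, f4⟩ := hF
  have hδ : ∀ {b : ℝ}, s < b → 0 < min (s : ℝ) (b - s) := fun h =>
    lt_min (by exact_mod_cast hs) (by linarith)
  refine ⟨fun q => A * kerConst L a * geo (min s (a - s)) q
    + A * kerConst L (a - β) * geo (min s (a - β - s)) q,
    ((summable_geo (hδ (by linarith))).mul_left _).add ((summable_geo (hδ ha)).mul_left _),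
    fun q P => ?_, fun q P Q => ?_⟩
  · refine (abs_kint_le_geo hL q hs (by linarith) hA (f1 P) (f2 P)).trans ?_
    have : 0 ≤ A * kerConst L (a - β) * geo (min s (a - β - s)) q :=
      mul_nonneg (mul_nonneg hA (kerConst_nonneg _ _)) (geo_nonneg _ _)
    linarith
  · rw [kint_sub hL s q (hFc P) (hFc Q)]
    refine (abs_kint_le_geo hL q hs ha (by positivity) (f3 P Q) (f4 P Q)).trans ?_
    have : 0 ≤ A * kerConst L a * geo (min s (a - s)) q :=
      mul_nonneg (mul_nonneg hA (kerConst_nonneg _ _)) (geo_nonneg _ _)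
    have h2 : 0 ≤ ‖P - Q‖ ^ β := by positivity
    calc _ = A * kerConst L (a - β) * geo (min s (a - β - s)) q * ‖P - Q‖ ^ β := by ring
      _ ≤ _ := mul_le_mul_of_nonneg_right (by linarith) h2

/-- Evaluation of a function on `ℝ × ℝⁿ × ℝⁿ` at `(t, x, x + z)`. -/
def atIncr (F : ℝ × (Space n × Space n) → ℝ) (P : ℝ × Space n) (z : Space n) : ℝ :=
  F (P.1, (P.2, P.2 + z))

theorem continuous_atIncr {F : ℝ × (Space n × Space n) → ℝ} (hF : Continuous F) :
    Continuous (uncurry (atIncr F)) := by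
  simp only [uncurry_def, atIncr]; fun_prop

theorem continuous_incr {f : ℝ × Space n → ℝ} (hf : Continuous f) :
    Continuous (uncurry (incr f)) := by
  simp only [uncurry_def, incr]; fun_prop

variable {I : Opens ℝ} {v : ℝ × Space n → Space n}

/-- The transport formula for a rescaled kernel: the term in ∇L has order s + 1 and is compensated
by an additional increment of v. -/
theorem HasDiv.kint (hv : Continuous v) {F F' : ℝ × (Space n × Space n) → ℝ}
    (hF : Continuous F) (hF' : Continuous F')
    (h : HasDiv volume ((I : Set ℝ) ×ˢ (Set.univ : Set (Space n × Space n))) (pairField v) F F')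
    {L : Space n → ℝ} (hL : IsTest Set.univ L) (s q : ℤ) :
    HasDiv volume (slab n I : Set (ℝ × Space n)) (spaceTimeField v)
      (fun P => kint s q L (atIncr F P))
      (fun P => kint s q L (atIncr F' P) + ∑ k, kint (s + 1) q (partialDeriv k L)
        fun z => incr (fun P => v P k) P z * atIncr F P z) := by
  have key := HasDiv.integral_kernel hv hF hF' h (hL.scaled s q).contDiff
    (hL.scaled s q).hasCompactSupport
  refine Eq.mp (congrArg _ (funext fun P => ?_)) key
  refine congrArg₂ _ rfl ?_
  have hFP : Continuous (atIncr F P) := by unfold atIncr; fun_prop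
  have hvP : ∀ k, Continuous (incr (fun P => v P k) P) := fun k => by unfold incr; fun_prop
  simp only [EulerPressure.kint]
  rw [← integral_finsetSum]
  · refine integral_congr_ae (ae_of_all _ fun z => ?_)
    simp only
    rw [fderiv_apply_eq_sum, Finset.sum_mul]
    refine Finset.sum_congr rfl fun k _ => ?_
    rw [partialDeriv_scaled hL.differentiable]
    simp only [incr, atIncr, PiLp.sub_apply]; ring
  · intro k _
    exact integrable_scaled_mul (hL.partialDeriv k) _ _ ((hvP k).mul hFP)

/-- Partial sums over -M ≤ q < M are uniformly bounded and converge pointwise on both sides, so the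
weak identity passes to the limit. -/
theorem HasDiv.tsum_kint (hv : Continuous v) {F F' : ℝ × (Space n × Space n) → ℝ}
    (hF : Continuous F) (hF' : Continuous F')
    (h : HasDiv volume ((I : Set ℝ) ×ˢ (Set.univ : Set (Space n × Space n))) (pairField v) F F')
    {L : Space n → ℝ} (hL : IsTest Set.univ L) {s : ℤ} {β : ℝ}
    (h1 : SumHolder β fun q P => EulerPressure.kint s q L (atIncr F P))
    (h2 : SumHolder β fun q P => EulerPressure.kint s q L (atIncr F' P)
      + ∑ k, EulerPressure.kint (s + 1) q (partialDeriv k L)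
        fun z => incr (fun P => v P k) P z * atIncr F P z) :
    HasDiv volume (slab n I : Set (ℝ × Space n)) (spaceTimeField v)
      (fun P => ∑' q, EulerPressure.kint s q L (atIncr F P))
      (fun P => ∑' q, (EulerPressure.kint s q L (atIncr F' P)
        + ∑ k, EulerPressure.kint (s + 1) q (partialDeriv k L)
          fun z => incr (fun P => v P k) P z * atIncr F P z)) := by
  obtain ⟨C₁, hC₁⟩ := h1.exists_abs_sum_le
  obtain ⟨C₂, hC₂⟩ := h2.exists_abs_sum_le
  have c1 : ∀ q, Continuous fun P => EulerPressure.kint s q L (atIncr F P) := fun q =>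
    continuous_kint hL s q (continuous_atIncr hF)
  have c2 : ∀ q, Continuous fun P => EulerPressure.kint s q L (atIncr F' P)
      + ∑ k, EulerPressure.kint (s + 1) q (partialDeriv k L)
        fun z => incr (fun P => v P k) P z * atIncr F P z := fun q => by
    refine (continuous_kint hL s q (continuous_atIncr hF')).add
      (continuous_finsetSum _ fun k _ => continuous_kint (hL.partialDeriv k) _ _ ?_)
    exact (continuous_incr (by fun_prop)).mul (continuous_atIncr hF)
  refine HasDiv.of_tendsto (C := max C₁ C₂) (fun M => HasDiv.sum (Finset.Ico (-(M : ℤ)) M)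
    (fun q _ => HasDiv.kint hv hF hF' h hL s q) (continuous_spaceTimeField hv)
    (fun q _ => c1 q) fun q _ => c2 q) (continuous_spaceTimeField hv)
    (fun M => continuous_finsetSum _ fun q _ => c1 q)
    (fun M => continuous_finsetSum _ fun q _ => c2 q)
    (fun M P => (hC₁ _ P).trans (le_max_left _ _)) (fun M P => (hC₂ _ P).trans (le_max_right _ _))
    (fun P => h1.tendsto P) (fun P => h2.tendsto P)

end

/-! ### A compactly supported dyadic kernel for the Laplacian -/

section

variable {n : ℕ}

/-- A profile equal to `s^(-n/2)` for large `s`, with a sign condition on the corresponding radial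
Laplacian. -/
theorem exists_profile (n : ℕ) : ∃ κ : ℝ → ℝ, ContDiff ℝ ∞ κ ∧ (∀ s ≤ 1 / 2, κ s = 0) ∧
    (∀ s, 1 ≤ s → κ s = s ^ (-(n : ℝ) / 2)) ∧ (∀ s, 0 ≤ 4 * s * deriv κ s + 2 * n * κ s) ∧
    ∃ s, 0 < s ∧ 4 * s * deriv κ s + 2 * n * κ s ≠ 0 := by
  let μ : ℝ → ℝ := fun s => Real.smoothTransition (2 * s - 1)
  have hμ : ContDiff ℝ ∞ μ := Real.smoothTransition.contDiff.comp (by fun_prop)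
  have hμd : Differentiable ℝ μ := hμ.differentiable (by simp)
  have hμ0 : ∀ s ≤ 1 / 2, μ s = 0 := fun s hs =>
    Real.smoothTransition.zero_of_nonpos (by linarith)
  have hμ1 : ∀ s, 1 ≤ s → μ s = 1 := fun s hs => Real.smoothTransition.one_of_one_le (by linarith)
  have hmono : Monotone μ := fun a b hab => Real.smoothTransition.monotone (by linarith)
  let κ : ℝ → ℝ := fun s => s ^ (-(n : ℝ) / 2) * μ s
  have hκ0 : ∀ s ≤ 1 / 2, κ s = 0 := fun s hs => by simp [κ, hμ0 s hs]
  -- The power s^(-n/2) is annihilated by 4s d/ds + 2n, hence only the derivative of the cutoff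
  -- remains, and it is nonnegative because the cutoff increases.
  have hpos : ∀ s, 0 < s → 4 * s * deriv κ s + 2 * n * κ s
      = 4 * s * s ^ (-(n : ℝ) / 2) * deriv μ s := by
    intro s hs
    have h1 : HasDerivAt (fun s : ℝ => s ^ (-(n : ℝ) / 2))
        (-(n : ℝ) / 2 * s ^ (-(n : ℝ) / 2 - 1)) s := Real.hasDerivAt_rpow_const (Or.inl hs.ne')
    have h2 : HasDerivAt κ _ s := h1.mul (hμd s).hasDerivAt
    rw [h2.deriv, Real.rpow_sub hs, Real.rpow_one]
    simp only [κ]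
    field_simp
    ring
  have hloc : ∀ s < 1 / 2, κ =ᶠ[𝓝 s] fun _ => 0 := fun s hs => by
    filter_upwards [Iio_mem_nhds hs] with y hy using hκ0 y (le_of_lt hy)
  refine ⟨κ, ?_, hκ0, fun s hs => by simp [κ, hμ1 s hs], fun s => ?_, ?_⟩
  · rw [contDiff_iff_contDiffAt]
    intro s
    rcases lt_or_ge s (1 / 2) with hs | hs
    · exact contDiffAt_const.congr_of_eventuallyEq (hloc s hs)
    · exact (Real.contDiffAt_rpow_const_of_ne (by linarith)).mul hμ.contDiffAt
  · rcases lt_or_ge s (1 / 2) with hs | hs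
    · rw [(hloc s hs).deriv_eq, hκ0 s hs.le]; simp
    · rw [hpos s (by linarith)]
      have : 0 ≤ deriv μ s := hmono.deriv_nonneg
      have hs' : 0 < s := by linarith
      positivity
  -- The cutoff climbs from 0 to 1 on [1/2, 1], so its derivative is nonzero somewhere.
  · obtain ⟨s, hs, hd⟩ := exists_deriv_eq_slope μ (by norm_num : (1 / 2 : ℝ) < 1)
      hμ.continuous.continuousOn hμd.differentiableOn
    have hs' : 0 < s := lt_trans (by norm_num) hs.1
    refine ⟨s, hs', ?_⟩
    rw [hpos s hs', hd, hμ1 1 le_rfl, hμ0 _ le_rfl]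
    have := Real.rpow_pos_of_pos hs' (-(n : ℝ) / 2)
    positivity

theorem partialDeriv_radial {Θ : ℝ → ℝ} (hΘ : Differentiable ℝ Θ) (j : Fin n) :
    partialDeriv j (fun z : Space n => Θ (‖z‖ ^ 2)) = fun z => 2 * deriv Θ (‖z‖ ^ 2) * z j := by
  ext z
  have h1 : HasFDerivAt (fun z : Space n => ‖z‖ ^ 2) _ z := (hasFDerivAt_id z).norm_sq
  have h2 : HasFDerivAt (fun z : Space n => Θ (‖z‖ ^ 2)) _ z :=
    (hΘ _).hasDerivAt.comp_hasFDerivAt z h1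
  rw [partialDeriv, h2.fderiv]
  simp [EuclideanSpace.inner_single_right]
  ring

theorem partialDeriv_partialDeriv_radial {Θ : ℝ → ℝ} (hΘ : ContDiff ℝ ∞ Θ) (j : Fin n)
    (z : Space n) : partialDeriv j (partialDeriv j (fun z : Space n => Θ (‖z‖ ^ 2))) z
      = 2 * deriv Θ (‖z‖ ^ 2) + 4 * deriv (deriv Θ) (‖z‖ ^ 2) * z j ^ 2 := by
  have hd : ContDiff ℝ ∞ (deriv Θ) := (contDiff_infty_iff_deriv.1 hΘ).2
  rw [partialDeriv_radial (hΘ.differentiable (by simp))]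
  have h1 : HasFDerivAt (fun z : Space n => ‖z‖ ^ 2) _ z := (hasFDerivAt_id z).norm_sq
  have h2 : HasFDerivAt (fun z : Space n => deriv Θ (‖z‖ ^ 2)) _ z :=
    (hd.differentiable (by simp) _).hasDerivAt.comp_hasFDerivAt z h1
  have h3 : HasFDerivAt (fun z : Space n => z j) (EuclideanSpace.proj j : Space n →L[ℝ] ℝ) z :=
    (EuclideanSpace.proj j : Space n →L[ℝ] ℝ).hasFDerivAt
  have h4 : HasFDerivAt (fun z : Space n => 2 * deriv Θ (‖z‖ ^ 2) * z j) _ z :=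
    (h2.const_mul 2).mul h3
  rw [partialDeriv, h4.fderiv]
  simp [EuclideanSpace.inner_single_right]
  ring

/-- A smooth compactly supported function whose Laplacian is the difference of two consecutive
dyadic rescalings of a mollifier. -/
theorem exists_kernel (hn : 0 < n) : ∃ G η : Space n → ℝ, IsTest Set.univ G ∧ IsTest Set.univ η ∧
    ∫ z, η z = 1 ∧
    ∀ z, ∑ j, partialDeriv j (partialDeriv j G) z = 2 ^ n * η ((2 : ℝ) • z) - η z := by
  obtain ⟨κ, hκ, hκ0, hκ1, hH0, s₀, hs₀, hs₀'⟩ := exists_profile n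
  have hκd : ContDiff ℝ ∞ (deriv κ) := (contDiff_infty_iff_deriv.1 hκ).2
  have hκdiff : Differentiable ℝ κ := hκ.differentiable (by simp)
  -- H(|z|²) is the divergence of the field 2κ(|z|²)z. For |z| ≥ 1 this is the divergence-free
  -- Newtonian field 2z/|z|^n, so H is supported in the unit ball.
  let H : ℝ → ℝ := fun s => 4 * s * deriv κ s + 2 * n * κ s
  have hH : ContDiff ℝ ∞ H := by simp only [H]; fun_prop
  have hH1 : ∀ s, 1 < s → H s = 0 := by
    intro s hs
    have h1 : κ =ᶠ[𝓝 s] fun s => s ^ (-(n : ℝ) / 2) := by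
      filter_upwards [Ioi_mem_nhds hs] with y hy using hκ1 y (le_of_lt hy)
    have hs' : 0 < s := by linarith
    have h2 : HasDerivAt (fun s : ℝ => s ^ (-(n : ℝ) / 2))
        (-(n : ℝ) / 2 * s ^ (-(n : ℝ) / 2 - 1)) s := Real.hasDerivAt_rpow_const (Or.inl hs'.ne')
    simp only [H]
    rw [h1.deriv_eq, h2.deriv, hκ1 s hs.le, Real.rpow_sub hs', Real.rpow_one]
    field_simp
    ring
  -- The radial profile of the difference between the field dilated by 2 (with factor 2^(n-1)) and
  -- the field itself. The Newtonian field is homogeneous of degree 1 - n, so the two cancel outside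
  -- the unit ball.
  let D : ℝ → ℝ := fun s => 2 ^ n * κ (4 * s) - κ s
  have hD : ContDiff ℝ ∞ D := by simp only [D]; fun_prop
  have hD1 : ∀ s, 1 ≤ s → D s = 0 := by
    intro s hs
    simp only [D]
    rw [hκ1 s hs, hκ1 (4 * s) (by linarith), Real.mul_rpow (by norm_num) (by linarith),
      show (4 : ℝ) = 2 ^ (2 : ℝ) by norm_num, ← Real.rpow_mul zero_le_two,
      show (2 : ℝ) * (-n / 2) = -n by ring, Real.rpow_neg zero_le_two, Real.rpow_natCast]
    field_simp
    ring
  -- The primitive starts at 1, so that it vanishes for s ≥ 1. The gradient of Θ(|z|²) is 2D(|z|²)z,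
  -- which makes Θ(|z|²) a potential with compact support.
  let Θ : ℝ → ℝ := fun s => ∫ r in (1 : ℝ)..s, D r
  have hΘd : ∀ s, HasDerivAt Θ (D s) s := fun s =>
    intervalIntegral.integral_hasDerivAt_right (hD.continuous.intervalIntegrable _ _)
      (hD.continuous.stronglyMeasurableAtFilter _ _) hD.continuous.continuousAt
  have hΘd' : deriv Θ = D := funext fun s => (hΘd s).deriv
  have hΘ : ContDiff ℝ ∞ Θ := contDiff_infty_iff_deriv.2
    ⟨fun s => (hΘd s).differentiableAt, by rwa [hΘd']⟩
  have hΘ1 : ∀ s, 1 ≤ s → Θ s = 0 := by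
    intro s hs
    refine intervalIntegral.integral_zero_ae (ae_of_all _ fun r hr => ?_)
    rw [Set.uIoc_of_le hs] at hr
    exact hD1 r hr.1.le
  have hns : ContDiff ℝ ∞ fun z : Space n => ‖z‖ ^ 2 := contDiff_norm_sq ℝ
  have hsupp : ∀ f : ℝ → ℝ, ContDiff ℝ ∞ f → (∀ s, 1 < s → f s = 0) →
      IsTest Set.univ fun z : Space n => f (‖z‖ ^ 2) := fun f hf h =>
    ⟨hf.comp hns, HasCompactSupport.intro (isCompact_closedBall (0 : Space n) 1) fun z hz => by
      rw [mem_closedBall_zero_iff, not_le] at hz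
      exact h _ (by nlinarith), Set.subset_univ _⟩
  have hHt := hsupp H hH hH1
  have hpos : 0 < ∫ z : Space n, H (‖z‖ ^ 2) := by
    refine hHt.continuous.integral_pos_of_hasCompactSupport_nonneg_nonzero hHt.hasCompactSupport
      (fun z => hH0 _) (x := EuclideanSpace.single ⟨0, hn⟩ (Real.sqrt s₀)) ?_
    simpa [Real.sq_sqrt hs₀.le, H] using hs₀'
  set c := (∫ z : Space n, H (‖z‖ ^ 2))⁻¹ with hc
  refine ⟨fun z => c * Θ (‖z‖ ^ 2), fun z => c * H (‖z‖ ^ 2),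
    hsupp (fun s => c * Θ s) (contDiff_const.mul hΘ) (fun s hs => by simp [hΘ1 s hs.le]),
    hsupp (fun s => c * H s) (contDiff_const.mul hH) (fun s hs => by simp [hH1 s hs]),
    by rw [integral_const_mul, hc, inv_mul_cancel₀ hpos.ne'], fun z => ?_⟩
  have hcΘ : ContDiff ℝ ∞ fun s => c * Θ s := contDiff_const.mul hΘ
  have hdc : deriv (fun s => c * Θ s) = fun s => c * D s :=
    funext fun s => ((hΘd s).const_mul c).deriv
  have hdD : ∀ s, deriv (fun s => c * D s) s = c * (2 ^ n * (4 * deriv κ (4 * s)) - deriv κ s) := by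
    intro s
    have h1 : HasDerivAt (fun s => κ (4 * s)) (4 * deriv κ (4 * s)) s := by
      have := (hκdiff (4 * s)).hasDerivAt.comp s ((hasDerivAt_id s).const_mul 4)
      simpa [mul_comm, Function.comp_def] using this
    exact (((h1.const_mul _).sub (hκdiff s).hasDerivAt).const_mul c).deriv
  have h := fun j => partialDeriv_partialDeriv_radial hcΘ j z
  simp only [h, hdc, hdD]
  rw [Finset.sum_add_distrib, ← Finset.mul_sum _ (fun j => z j ^ 2), ← EuclideanSpace.real_norm_sq_eq, norm_smul]
  simp only [Finset.sum_const, Finset.card_univ, Fintype.card_fin, nsmul_eq_mul, H, D,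
    Real.norm_ofNat, mul_pow]
  ring_nf

end

/-! ### Convolution in space and its bounds in all derivatives -/

section

variable {n : ℕ}

section Conv

variable {F : Type*} [NormedAddCommGroup F] [NormedSpace ℝ F]

/-- Convolution in the space variable. -/
noncomputable def conv (κ : Space n → ℝ) (Φ : ℝ × Space n → F) (P : ℝ × Space n) : F :=
  ∫ z, κ z • Φ (P.1, P.2 - z)

theorem eq_zero_of_notMem_image_snd {Φ : ℝ × Space n → F} {p : ℝ} {x : Space n}
    (hx : x ∉ Prod.snd '' tsupport Φ) : Φ (p, x) = 0 :=
  image_eq_zero_of_notMem_tsupport fun h => hx ⟨(p, x), h, rfl⟩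

/-- All derivatives fall on Φ, which has compact support, so κ need only be continuous. This matters
because κ will also be a periodized kernel, which is not compactly supported. -/
theorem hasFDerivAt_conv {κ : Space n → ℝ} (hκ : Continuous κ) {Φ : ℝ × Space n → F}
    (hΦ : ContDiff ℝ ∞ Φ) (hc : HasCompactSupport Φ) (P : ℝ × Space n) :
    HasFDerivAt (conv κ Φ) (conv κ (fderiv ℝ Φ) P) P := by
  have h := hasFDerivAt_convolution_right_with_param (μ := (volume : Measure (Space n)))
    (ContinuousLinearMap.lsmul ℝ ℝ) (g := fun p x => Φ (p, x)) isOpen_univ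
    (hc.isCompact.image continuous_snd) (fun p x _ hx => eq_zero_of_notMem_image_snd hx)
    hκ.locallyIntegrable (hΦ.of_le (by simp)).contDiffOn P (Set.mem_univ _)
  refine h.congr_fderiv ?_
  simp only [convolution, conv]
  rfl

theorem fderiv_conv {κ : Space n → ℝ} (hκ : Continuous κ) {Φ : ℝ × Space n → F}
    (hΦ : ContDiff ℝ ∞ Φ) (hc : HasCompactSupport Φ) :
    fderiv ℝ (conv κ Φ) = conv κ (fderiv ℝ Φ) :=
  funext fun P => (hasFDerivAt_conv hκ hΦ hc P).fderiv

theorem contDiff_conv {κ : Space n → ℝ} (hκ : Continuous κ) {Φ : ℝ × Space n → F}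
    (hΦ : ContDiff ℝ ∞ Φ) (hc : HasCompactSupport Φ) : ContDiff ℝ ∞ (conv κ Φ) := by
  have h := contDiffOn_convolution_right_with_param (μ := (volume : Measure (Space n)))
    (n := ⊤) (ContinuousLinearMap.lsmul ℝ ℝ) (g := fun p x => Φ (p, x)) isOpen_univ
    (hc.isCompact.image continuous_snd) (fun p x _ hx => eq_zero_of_notMem_image_snd hx)
    hκ.locallyIntegrable hΦ.contDiffOn
  rw [Set.univ_prod_univ, contDiffOn_univ] at h
  exact h

theorem integrable_conv {κ : Space n → ℝ} (hκ : Continuous κ) {Φ : ℝ × Space n → F}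
    (hΦ : Continuous Φ) (hc : HasCompactSupport Φ) (P : ℝ × Space n) :
    Integrable fun z => κ z • Φ (P.1, P.2 - z) := by
  refine Continuous.integrable_of_hasCompactSupport (by fun_prop) ?_
  refine HasCompactSupport.intro ((hc.isCompact.image continuous_snd).image
    (f := fun y => P.2 - y) (by fun_prop)) fun z hz => ?_
  rw [eq_zero_of_notMem_image_snd (Φ := Φ), smul_zero]
  exact fun h => hz ⟨P.2 - z, h, by simp⟩

/-- Convolution with small kernels is small. -/
theorem exists_norm_iteratedFDeriv_conv_le (k : ℕ) {Φ : ℝ × Space n → F}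
    (hΦ : ContDiff ℝ ∞ Φ) (hc : HasCompactSupport Φ) : ∃ C, 0 ≤ C ∧ ∀ (κ : Space n → ℝ) (ε : ℝ),
      Continuous κ → (∀ z, |κ z| ≤ ε) → ∀ P, ‖iteratedFDeriv ℝ k (conv κ Φ) P‖ ≤ C * ε := by
  -- The codomain varies since the inductive step replaces Φ by its derivative, which is
  -- operator-valued.
  induction k generalizing F with
  | zero =>
    have hint : ∀ P : ℝ × Space n, Integrable fun z : Space n => ‖Φ (P.1, P.2 - z)‖ := fun P => by
      simpa using (integrable_conv continuous_const (κ := fun _ => (1 : ℝ)) hΦ.continuous hc P).norm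
    obtain ⟨B, hB⟩ := hΦ.continuous.bounded_above_of_compact_support hc
    have hB0 : 0 ≤ B := (norm_nonneg _).trans (hB 0)
    have hK : IsCompact (Prod.snd '' tsupport Φ) := hc.isCompact.image continuous_snd
    set V := (volume : Measure (Space n)).real (Prod.snd '' tsupport Φ)
    have hV : ∀ P : ℝ × Space n, ∫ z, ‖Φ (P.1, P.2 - z)‖ ≤ B * V := fun P => by
      rw [integral_sub_left_eq_self (fun y => ‖Φ (P.1, y)‖) volume P.2]
      calc _ ≤ ∫ y, (Prod.snd '' tsupport Φ).indicator (fun _ => B) y := by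
            refine integral_mono_of_nonneg (ae_of_all _ fun _ => norm_nonneg _)
              ((integrable_indicator_iff hK.measurableSet).2
                (integrableOn_const hK.measure_lt_top.ne)) (ae_of_all _ fun y => ?_)
            by_cases hy : y ∈ Prod.snd '' tsupport Φ
            · simpa [hy] using hB _
            · simp [Set.indicator_of_notMem hy, eq_zero_of_notMem_image_snd hy]
        _ = B * V := by
            rw [integral_indicator hK.measurableSet, setIntegral_const, smul_eq_mul, mul_comm]
    refine ⟨B * V, by positivity, fun κ ε hκ hε P => ?_⟩
    rw [norm_iteratedFDeriv_zero]
    have hε0 : 0 ≤ ε := (abs_nonneg _).trans (hε 0)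
    calc ‖conv κ Φ P‖ ≤ ∫ z, ε * ‖Φ (P.1, P.2 - z)‖ := by
          refine norm_integral_le_of_norm_le ((hint P).const_mul ε) (ae_of_all _ fun z => ?_)
          rw [norm_smul, Real.norm_eq_abs]
          exact mul_le_mul_of_nonneg_right (hε z) (norm_nonneg _)
      _ ≤ _ := by
          rw [integral_const_mul, mul_comm]
          exact mul_le_mul_of_nonneg_right (hV P) hε0
  | succ k ih =>
    obtain ⟨C, hC, h⟩ := ih (hΦ.fderiv_right (m := ∞) (by simp)) (hc.fderiv ℝ)
    refine ⟨C, hC, fun κ ε hκ hε P => ?_⟩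
    rw [← norm_iteratedFDeriv_fderiv, fderiv_conv hκ hΦ hc]
    exact h κ ε hκ hε P

/-- Convolution with an approximate identity is close to the identity. -/
theorem exists_norm_iteratedFDeriv_conv_sub_le (k : ℕ) {Φ : ℝ × Space n → F}
    (hΦ : ContDiff ℝ ∞ Φ) (hc : HasCompactSupport Φ) [CompleteSpace F] :
    ∃ C, 0 ≤ C ∧ ∀ (κ : Space n → ℝ),
      Continuous κ → HasCompactSupport κ → ∫ z, κ z = 1 → ∀ P,
      ‖iteratedFDeriv ℝ k (fun P => conv κ Φ P - Φ P) P‖ ≤ C * ∫ z, |κ z| * ‖z‖ := by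
  induction k generalizing F with
  | zero =>
    obtain ⟨C, hC⟩ := hΦ.lipschitzWith_of_hasCompactSupport hc (by simp)
    refine ⟨C, C.2, fun κ hκ hκc h1 P => ?_⟩
    rw [norm_iteratedFDeriv_zero]
    have e : conv κ Φ P - Φ P = ∫ z, κ z • (Φ (P.1, P.2 - z) - Φ P) := by
      simp only [smul_sub]
      rw [integral_sub (integrable_conv hκ hΦ.continuous hc P)
        ((hκ.integrable_of_hasCompactSupport hκc).smul_const _), integral_smul_const, h1, one_smul]
      rfl
    rw [e, ← integral_const_mul]
    refine norm_integral_le_of_norm_le ?_ (ae_of_all _ fun z => ?_)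
    · refine Integrable.const_mul ?_ _
      exact Continuous.integrable_of_hasCompactSupport (by fun_prop) hκc.norm.mul_right
    · rw [norm_smul, Real.norm_eq_abs]
      have := hC.norm_sub_le (P.1, P.2 - z) P
      have e2 : (P.1, P.2 - z) - P = (0, -z) := by ext <;> simp
      have e3 : ‖((0 : ℝ), -z)‖ = ‖z‖ := by simp [Prod.norm_def]
      rw [e2, e3] at this
      calc _ ≤ |κ z| * (C * ‖z‖) := mul_le_mul_of_nonneg_left this (abs_nonneg _)
        _ = _ := by ring
  | succ k ih =>
    obtain ⟨C, hC, h⟩ := ih (hΦ.fderiv_right (m := ∞) (by simp)) (hc.fderiv ℝ)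
    refine ⟨C, hC, fun κ hκ hκc h1 P => ?_⟩
    rw [← norm_iteratedFDeriv_fderiv]
    have e : fderiv ℝ (fun P => conv κ Φ P - Φ P)
        = fun P => conv κ (fderiv ℝ Φ) P - fderiv ℝ Φ P := funext fun P =>
      ((hasFDerivAt_conv hκ hΦ hc P).sub
        (hΦ.differentiable (by simp) P).hasFDerivAt).fderiv
    rw [e]
    exact h κ hκ hκc h1 P

end Conv

theorem IsTest.conv {I : Opens ℝ} {Φ : ℝ × Space n → ℝ}
    (hΦ : IsTest (slab n I : Set (ℝ × Space n)) Φ) {κ : Space n → ℝ} (hκ : Continuous κ)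
    (hκc : HasCompactSupport κ) : IsTest (slab n I : Set (ℝ × Space n)) (conv κ Φ) ∧
      tsupport (EulerPressure.conv κ Φ) ⊆
        (fun p : (ℝ × Space n) × Space n => (p.1.1, p.1.2 + p.2)) '' (tsupport Φ ×ˢ tsupport κ) := by
  have hK := (hΦ.hasCompactSupport.isCompact.prod hκc.isCompact).image
    (f := fun p : (ℝ × Space n) × Space n => (p.1.1, p.1.2 + p.2)) (by fun_prop)
  have h0 : support (EulerPressure.conv κ Φ) ⊆
      (fun p : (ℝ × Space n) × Space n => (p.1.1, p.1.2 + p.2)) '' (tsupport Φ ×ˢ tsupport κ) := by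
    intro P hP
    by_contra h
    refine hP (integral_eq_zero_of_ae (ae_of_all _ fun z => ?_))
    by_cases hz : z ∈ tsupport κ
    · by_cases hy : (P.1, P.2 - z) ∈ tsupport Φ
      · exact absurd ⟨((P.1, P.2 - z), z), ⟨hy, hz⟩, by ext <;> simp⟩ h
      · simp [image_eq_zero_of_notMem_tsupport hy]
    · simp [image_eq_zero_of_notMem_tsupport hz]
  have h1 : tsupport (EulerPressure.conv κ Φ) ⊆ _ := closure_minimal h0 hK.isClosed
  refine ⟨⟨contDiff_conv hκ hΦ.contDiff hΦ.hasCompactSupport, hK.of_isClosed_subset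
    (isClosed_tsupport _) h1, h1.trans ?_⟩, h1⟩
  rintro _ ⟨p, hp, rfl⟩
  exact ⟨(hΦ.tsupport_subset hp.1).1, trivial⟩

theorem fderiv_conv_apply {κ : Space n → ℝ} (hκ : Continuous κ) {Φ : ℝ × Space n → ℝ}
    (hΦ : ContDiff ℝ ∞ Φ) (hc : HasCompactSupport Φ) (P e : ℝ × Space n) :
    fderiv ℝ (conv κ Φ) P e = conv κ (fun P => fderiv ℝ Φ P e) P := by
  rw [fderiv_conv hκ hΦ hc, conv,
    ContinuousLinearMap.integral_apply (integrable_conv hκ (hΦ.continuous_fderiv (by simp))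
      (hc.fderiv ℝ) P)]
  rfl

theorem conv_fderiv_apply_spaceDir {κ : Space n → ℝ} (hκ : IsTest Set.univ κ)
    {Φ : ℝ × Space n → ℝ} (hΦ : ContDiff ℝ ∞ Φ) (hc : HasCompactSupport Φ) (j : Fin n)
    (P : ℝ × Space n) :
    conv κ (fun P => fderiv ℝ Φ P (spaceDir j)) P = conv (partialDeriv j κ) Φ P := by
  have hs : HasCompactSupport fun z => Φ (P.1, P.2 - z) :=
    HasCompactSupport.intro ((hc.isCompact.image continuous_snd).image
      (f := fun y => P.2 - y) (by fun_prop)) fun z hz =>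
        eq_zero_of_notMem_image_snd fun h => hz ⟨P.2 - z, h, by simp⟩
  have hd : ∀ z e : Space n, fderiv ℝ (fun z => Φ (P.1, P.2 - z)) z e
      = - fderiv ℝ Φ (P.1, P.2 - z) (0, e) := fun z e => by
    have h1 : HasFDerivAt (fun z : Space n => (P.1, P.2 - z))
        ((0 : Space n →L[ℝ] ℝ).prod (-ContinuousLinearMap.id ℝ (Space n))) z :=
      (hasFDerivAt_const P.1 z).prodMk ((hasFDerivAt_id z).const_sub P.2)
    have h2 : HasFDerivAt (fun z => Φ (P.1, P.2 - z)) _ z :=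
      (hΦ.differentiable (by simp) _).hasFDerivAt.comp z h1
    rw [h2.fderiv]
    simp only [ContinuousLinearMap.comp_apply, ContinuousLinearMap.prod_apply,
      neg_apply, ContinuousLinearMap.id_apply, zero_apply]
    rw [← map_neg]; simp
  have hcf := hκ.continuous_fderiv
  have hkc := hκ.continuous
  have hΦf : Continuous (fderiv ℝ Φ) := hΦ.continuous_fderiv (by simp)
  have hΦc := hΦ.continuous
  have := integral_mul_fderiv_eq_neg_fderiv_mul_of_integrable (μ := (volume : Measure (Space n)))
    (f := κ) (g := fun z => Φ (P.1, P.2 - z)) (v := EuclideanSpace.single j 1)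
    (Continuous.integrable_of_hasCompactSupport (by fun_prop) hs.mul_left)
    (by simp only [hd]
        exact Continuous.integrable_of_hasCompactSupport (by fun_prop)
          hκ.hasCompactSupport.mul_right)
    (Continuous.integrable_of_hasCompactSupport (by fun_prop) hs.mul_left)
    (fun z _ => hκ.differentiable z)
    (fun z _ => (hΦ.differentiable (by simp) _).comp z (by fun_prop))
  simp only [hd, mul_neg, integral_neg, neg_inj] at this
  simpa only [conv, smul_eq_mul, partialDeriv, spaceDir] using this

/-- Duality between convolution in a time slice and averaging. -/
theorem integral_mul_conv {κ w ψ : Space n → ℝ} (hκ : Continuous κ) (hκc : HasCompactSupport κ)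
    (hw : Continuous w) (hψ : Continuous ψ) (hψc : HasCompactSupport ψ) :
    ∫ x, w x * ∫ z, κ z * ψ (x - z) = ∫ x, ψ x * ∫ z, κ z * w (x + z) := by
  have hi : Integrable (uncurry fun x z => w x * (κ z * ψ (x - z))) (volume.prod volume) := by
    refine Continuous.integrable_of_hasCompactSupport
      (by simp only [uncurry_def]; fun_prop)
      (HasCompactSupport.intro ((hψc.isCompact.prod hκc.isCompact).image
        (f := fun p : Space n × Space n => (p.1 + p.2, p.2)) (by fun_prop)) fun p hp => ?_)
    simp only [uncurry_def]
    by_cases h1 : p.2 ∈ tsupport κ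
    · by_cases h2 : p.1 - p.2 ∈ tsupport ψ
      · exact absurd ⟨(p.1 - p.2, p.2), ⟨h2, h1⟩, by ext <;> simp⟩ hp
      · simp [image_eq_zero_of_notMem_tsupport h2]
    · simp [image_eq_zero_of_notMem_tsupport h1]
  have hj : Integrable (uncurry fun x z => ψ x * (κ z * w (x + z))) (volume.prod volume) := by
    refine Continuous.integrable_of_hasCompactSupport
      (by simp only [uncurry_def]; fun_prop)
      (HasCompactSupport.intro (hψc.isCompact.prod hκc.isCompact) fun p hp => ?_)
    simp only [uncurry_def]
    by_cases h1 : p.2 ∈ tsupport κ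
    · by_cases h2 : p.1 ∈ tsupport ψ
      · exact absurd ⟨h2, h1⟩ hp
      · simp [image_eq_zero_of_notMem_tsupport h2]
    · simp [image_eq_zero_of_notMem_tsupport h1]
  simp only [← integral_const_mul]
  rw [integral_integral_swap hi, integral_integral_swap hj]
  congr 1; ext z
  rw [← integral_add_right_eq_self _ z]
  congr 1; ext x
  simp; ring

end

/-! ### Distributions acting on functions, and their sequential continuity -/

section

variable {n : ℕ} {I : Opens ℝ}

/-- The test function given by a smooth function with compact support in the slab. -/
def IsTest.toTestFunction {φ : ℝ × Space n → ℝ} (h : IsTest (slab n I : Set (ℝ × Space n)) φ) :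
    𝓓(slab n I, ℝ) :=
  ⟨φ, h.contDiff, h.hasCompactSupport, h.tsupport_subset⟩

theorem isTest_testFunction (φ : 𝓓(slab n I, ℝ)) :
    IsTest (slab n I : Set (ℝ × Space n)) φ :=
  ⟨φ.contDiff, φ.hasCompactSupport, φ.tsupport_subset⟩

open Classical in
/-- The value of a distribution at a function, `0` unless the function is a test function. -/
noncomputable def act (T : 𝓓'(slab n I, ℝ)) (φ : ℝ × Space n → ℝ) : ℝ :=
  if h : IsTest (slab n I : Set (ℝ × Space n)) φ then T h.toTestFunction else 0

theorem act_of_isTest (T : 𝓓'(slab n I, ℝ)) {φ : ℝ × Space n → ℝ}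
    (h : IsTest (slab n I : Set (ℝ × Space n)) φ) : act T φ = T h.toTestFunction := by
  unfold act; exact dif_pos h

theorem act_coe (T : 𝓓'(slab n I, ℝ)) (φ : 𝓓(slab n I, ℝ)) : act T φ = T φ := by
  rw [act_of_isTest T (isTest_testFunction φ)]; rfl

theorem IsTest.add {X : Type*} [NormedAddCommGroup X] [NormedSpace ℝ X] {U : Set X} {φ ψ : X → ℝ}
    (hφ : IsTest U φ) (hψ : IsTest U ψ) : IsTest U fun P => φ P + ψ P where
  contDiff := hφ.contDiff.add hψ.contDiff
  hasCompactSupport := hφ.hasCompactSupport.add hψ.hasCompactSupport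
  tsupport_subset := (tsupport_add φ ψ).trans (Set.union_subset hφ.tsupport_subset hψ.tsupport_subset)

theorem IsTest.neg {X : Type*} [NormedAddCommGroup X] [NormedSpace ℝ X] {U : Set X} {φ : X → ℝ}
    (hφ : IsTest U φ) : IsTest U fun P => - φ P where
  contDiff := hφ.contDiff.neg
  hasCompactSupport := hφ.hasCompactSupport.neg
  tsupport_subset := by
    have : tsupport (fun P => - φ P) = tsupport φ := by
      simp only [tsupport]; congr 1; ext; simp
    rw [this]; exact hφ.tsupport_subset

theorem IsTest.sub {X : Type*} [NormedAddCommGroup X] [NormedSpace ℝ X] {U : Set X} {φ ψ : X → ℝ}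
    (hφ : IsTest U φ) (hψ : IsTest U ψ) : IsTest U fun P => φ P - ψ P := by
  simpa only [sub_eq_add_neg] using hφ.add hψ.neg

theorem IsTest.zero {X : Type*} [NormedAddCommGroup X] [NormedSpace ℝ X] {U : Set X} :
    IsTest U fun _ : X => (0 : ℝ) where
  contDiff := contDiff_const
  hasCompactSupport := HasCompactSupport.zero
  tsupport_subset := by
    have : tsupport (fun _ : X => (0 : ℝ)) = ∅ := by simp
    simp [this]

theorem IsTest.sum {X ι : Type*} [NormedAddCommGroup X] [NormedSpace ℝ X] {U : Set X}
    {φ : ι → X → ℝ} (s : Finset ι) (h : ∀ i ∈ s, IsTest U (φ i)) :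
    IsTest U fun P => ∑ i ∈ s, φ i P := by
  classical
  induction s using Finset.induction_on with
  | empty => simpa using IsTest.zero
  | insert i s hi ih =>
    simp only [Finset.sum_insert hi]
    exact (h i (by simp)).add (ih fun j hj => h j (by simp [hj]))

theorem act_add (T : 𝓓'(slab n I, ℝ)) {φ ψ : ℝ × Space n → ℝ}
    (hφ : IsTest (slab n I : Set (ℝ × Space n)) φ) (hψ : IsTest (slab n I : Set (ℝ × Space n)) ψ) :
    act T (fun P => φ P + ψ P) = act T φ + act T ψ := by
  rw [act_of_isTest T hφ, act_of_isTest T hψ, act_of_isTest T (hφ.add hψ), ← map_add]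
  rfl

theorem act_neg (T : 𝓓'(slab n I, ℝ)) {φ : ℝ × Space n → ℝ}
    (hφ : IsTest (slab n I : Set (ℝ × Space n)) φ) :
    act T (fun P => - φ P) = - act T φ := by
  rw [act_of_isTest T hφ, act_of_isTest T hφ.neg, ← map_neg]
  rfl

theorem act_sub (T : 𝓓'(slab n I, ℝ)) {φ ψ : ℝ × Space n → ℝ}
    (hφ : IsTest (slab n I : Set (ℝ × Space n)) φ) (hψ : IsTest (slab n I : Set (ℝ × Space n)) ψ) :
    act T (fun P => φ P - ψ P) = act T φ - act T ψ := by
  simp only [sub_eq_add_neg]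
  rw [act_add T hφ hψ.neg, act_neg T hψ]

theorem act_sum {ι : Type*} (T : 𝓓'(slab n I, ℝ)) (s : Finset ι) {φ : ι → ℝ × Space n → ℝ}
    (h : ∀ i ∈ s, IsTest (slab n I : Set (ℝ × Space n)) (φ i)) :
    act T (fun P => ∑ i ∈ s, φ i P) = ∑ i ∈ s, act T (φ i) := by
  classical
  induction s using Finset.induction_on with
  | empty =>
    simp only [Finset.sum_empty]
    rw [act_of_isTest T IsTest.zero]
    exact map_zero T
  | insert i s hi ih =>
    simp only [Finset.sum_insert hi]
    rw [act_add T (h i (by simp)) (IsTest.sum s fun j hj => h j (by simp [hj])),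
      ih fun j hj => h j (by simp [hj])]

theorem act_lineDerivOp (T : 𝓓'(slab n I, ℝ)) {φ : ℝ × Space n → ℝ}
    (h : IsTest (slab n I : Set (ℝ × Space n)) φ) (m : ℝ × Space n) :
    act (∂_{m} T) φ = - act T fun P => fderiv ℝ φ P m := by
  rw [act_of_isTest _ h, act_of_isTest _ (h.fderiv_apply m), Distribution.lineDerivOp_apply_apply,
    map_neg]
  rfl

theorem act_distOf {f : ℝ × Space n → ℝ}
    (hf : LocallyIntegrableOn f (slab n I : Set (ℝ × Space n)) volume) {φ : ℝ × Space n → ℝ}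
    (h : IsTest (slab n I : Set (ℝ × Space n)) φ) :
    act (distOf I f) φ = ∫ P, φ P * f P := by
  rw [act_of_isTest _ h, distOf_apply hf]; rfl

theorem ext_act {S T : 𝓓'(slab n I, ℝ)}
    (h : ∀ φ, IsTest (slab n I : Set (ℝ × Space n)) φ → act S φ = act T φ) : S = T := by
  ext φ
  rw [← act_coe, ← act_coe]
  exact h φ (isTest_testFunction φ)

/-- Sequential continuity of distributions. -/
theorem tendsto_act_of_iteratedFDeriv (T : 𝓓'(slab n I, ℝ)) {K : Set (ℝ × Space n)}
    (hK : IsCompact K) (hKs : K ⊆ (slab n I : Set (ℝ × Space n))) {φ : ℕ → ℝ × Space n → ℝ}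
    (hφ : ∀ m, ContDiff ℝ ∞ (φ m)) (hsupp : ∀ m, support (φ m) ⊆ K)
    (h : ∀ k : ℕ, ∃ b : ℕ → ℝ, Tendsto b atTop (𝓝 0) ∧ ∀ m P, ‖iteratedFDeriv ℝ k (φ m) P‖ ≤ b m) :
    Tendsto (fun m => act T (φ m)) atTop (𝓝 0) := by
  let K' : Compacts (ℝ × Space n) := ⟨K, hK⟩
  let f : ℕ → 𝓓_{K'}(ℝ × Space n, ℝ) := fun m =>
    ContDiffMapSupportedIn.of_support_subset (hφ m) (hsupp m)
  let S : 𝓓_{K'}(ℝ × Space n, ℝ) → ℝ := fun g => T (TestFunction.ofSupportedInCLM ℝ hKs g)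
  have hS : Continuous S := T.continuous.comp (TestFunction.ofSupportedInCLM ℝ hKs).continuous
  have hf : Tendsto f atTop (𝓝 0) := by
    rw [(ContDiffMapSupportedIn.withSeminorms ℝ (ℝ × Space n) ℝ ⊤ K').tendsto_nhds]
    intro i ε hε
    obtain ⟨b, hb, hbk⟩ := h i
    filter_upwards [hb.eventually (gt_mem_nhds hε)] with m hm
    rw [sub_zero]
    have h0 : 0 ≤ b m := (norm_nonneg _).trans (hbk m 0)
    refine lt_of_le_of_lt ?_ hm
    rw [ContDiffMapSupportedIn.seminorm_top_le_iff ℝ h0]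
    exact fun P _ => hbk m P
  have := (hS.tendsto 0).comp hf
  have h0 : S 0 = 0 := by simp only [S, map_zero]
  rw [h0] at this
  refine this.congr fun m => ?_
  have ht : IsTest (slab n I : Set (ℝ × Space n)) (φ m) := by
    have h1 : tsupport (φ m) ⊆ K := closure_minimal (hsupp m) hK.isClosed
    exact ⟨hφ m, hK.of_isClosed_subset (isClosed_tsupport _) h1, h1.trans hKs⟩
  rw [act_of_isTest T ht]
  rfl

/-- Distributions are continuous along approximate identities in space. -/
theorem tendsto_act_conv (T : 𝓓'(slab n I, ℝ)) {Φ : ℝ × Space n → ℝ}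
    (hΦ : IsTest (slab n I : Set (ℝ × Space n)) Φ) {κ : ℕ → Space n → ℝ} {r : ℝ}
    (hκ : ∀ m, Continuous (κ m)) (hκs : ∀ m z, r < ‖z‖ → κ m z = 0) (hκ1 : ∀ m, ∫ z, κ m z = 1)
    (h0 : Tendsto (fun m => ∫ z, |κ m z| * ‖z‖) atTop (𝓝 0)) :
    Tendsto (fun m => act T (conv (κ m) Φ)) atTop (𝓝 (act T Φ)) := by
  have hκc : ∀ m, HasCompactSupport (κ m) := fun m =>
    HasCompactSupport.intro (isCompact_closedBall (0 : Space n) r) fun z hz => hκs m z (by simpa using hz)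
  have hκt : ∀ m, tsupport (κ m) ⊆ Metric.closedBall 0 r := fun m =>
    closure_minimal (fun z hz => by
      by_contra h
      exact hz (hκs m z (by simpa using h))) Metric.isClosed_closedBall
  have hc := fun m => hΦ.conv (hκ m) (hκc m)
  have ht := fun m => (hc m).1.sub hΦ
  set K := (fun p : (ℝ × Space n) × Space n => (p.1.1, p.1.2 + p.2)) ''
    (tsupport Φ ×ˢ Metric.closedBall 0 r) ∪ tsupport Φ with hKdef
  have hK : IsCompact K := ((hΦ.hasCompactSupport.isCompact.prod
    (isCompact_closedBall (0 : Space n) r)).image (by fun_prop)).union hΦ.hasCompactSupport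
  have hKs : K ⊆ (slab n I : Set (ℝ × Space n)) := by
    rintro _ (⟨p, hp, rfl⟩ | hp)
    · exact ⟨(hΦ.tsupport_subset hp.1).1, trivial⟩
    · exact hΦ.tsupport_subset hp
  have key := tendsto_act_of_iteratedFDeriv T hK hKs (φ := fun m P => conv (κ m) Φ P - Φ P)
    (fun m => (ht m).contDiff) (fun m P hP => ?_) fun k => ?_
  · simp only [act_sub T (hc _).1 hΦ] at key
    simpa using key.add_const (act T Φ)
  · by_contra hPK
    refine hP ?_
    have h1 : Φ P = 0 := image_eq_zero_of_notMem_tsupport fun h => hPK (Or.inr h)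
    have h2 : conv (κ m) Φ P = 0 := image_eq_zero_of_notMem_tsupport fun h =>
      hPK (Or.inl (Set.image_mono (Set.prod_mono_right (hκt m)) ((hc m).2 h)))
    simp [h1, h2]
  · obtain ⟨C, -, hC⟩ := exists_norm_iteratedFDeriv_conv_sub_le k hΦ.contDiff hΦ.hasCompactSupport
    exact ⟨fun m => C * ∫ z, |κ m z| * ‖z‖, by simpa using h0.const_mul C,
      fun m P => hC (κ m) (hκ m) (hκc m) (hκ1 m) P⟩

end

/-! ### Lattices, fundamental domains and periodizations -/

section

variable {n : ℕ} {Γ : Submodule ℤ (Space n)} [DiscreteTopology Γ]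

theorem finite_lattice_ball (Γ : Submodule ℤ (Space n)) [DiscreteTopology Γ] (r : ℝ) :
    {γ : Γ | ‖(γ : Space n)‖ ≤ r}.Finite := by
  have h1 : IsClosed (Γ : Set (Space n)) := by
    change IsClosed (Γ.toAddSubgroup : Set (Space n))
    have : DiscreteTopology Γ.toAddSubgroup := ‹DiscreteTopology Γ›
    exact AddSubgroup.isClosed_of_discrete
  have h2 : (Metric.closedBall (0 : Space n) r ∩ (Γ : Set (Space n))).Finite :=
    Metric.finite_isBounded_inter_isClosed DiscreteTopology.isDiscrete Metric.isBounded_closedBall h1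
  refine Set.Finite.of_finite_image (f := fun γ : Γ => (γ : Space n)) (h2.subset ?_)
    Subtype.val_injective.injOn
  rintro _ ⟨γ, hγ, rfl⟩
  exact ⟨by simpa using hγ, γ.2⟩

/-- The lattice points in a ball. -/
noncomputable def latticeBall (Γ : Submodule ℤ (Space n)) [DiscreteTopology Γ] (r : ℝ) : Finset Γ :=
  (finite_lattice_ball Γ r).toFinset

theorem mem_latticeBall {r : ℝ} {γ : Γ} : γ ∈ latticeBall Γ r ↔ ‖(γ : Space n)‖ ≤ r := by
  simp [latticeBall]

/-- The sum of the translates of `κ` by lattice vectors. -/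
noncomputable def per (Γ : Submodule ℤ (Space n)) (κ : Space n → ℝ) (z : Space n) : ℝ :=
  ∑ᶠ γ : Γ, κ (z + (γ : Space n))

theorem per_eq_sum {κ : Space n → ℝ} {R : ℝ} (hκ : ∀ z, R < ‖z‖ → κ z = 0) {S : Finset Γ}
    {z : Space n} (hS : ∀ γ : Γ, ‖(γ : Space n)‖ ≤ R + ‖z‖ → γ ∈ S) :
    per Γ κ z = ∑ γ ∈ S, κ (z + (γ : Space n)) := by
  refine finsum_eq_sum_of_support_subset _ fun γ hγ => hS γ ?_
  have h1 : ‖z + (γ : Space n)‖ ≤ R := by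
    by_contra h
    exact hγ (hκ _ (not_le.1 h))
  have h2 := norm_sub_le (z + (γ : Space n)) z
  rw [add_sub_cancel_left] at h2
  linarith

theorem per_eq_sum_latticeBall {κ : Space n → ℝ} {R r : ℝ} (hκ : ∀ z, R < ‖z‖ → κ z = 0)
    {z : Space n} (hz : ‖z‖ ≤ r) :
    per Γ κ z = ∑ γ ∈ latticeBall Γ (R + r), κ (z + (γ : Space n)) :=
  per_eq_sum hκ fun γ h => mem_latticeBall.2 (by linarith)

theorem per_add (κ : Space n → ℝ) (z : Space n) (γ : Γ) :
    per Γ κ (z + (γ : Space n)) = per Γ κ z := by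
  simp only [per, add_assoc]
  exact finsum_comp_equiv (Equiv.addLeft γ) (f := fun γ : Γ => κ (z + (γ : Space n)))

theorem continuous_per {κ : Space n → ℝ} {R : ℝ} (hκ : ∀ z, R < ‖z‖ → κ z = 0)
    (hc : Continuous κ) : Continuous (per Γ κ) := by
  rw [continuous_iff_continuousAt]
  intro z
  have : Continuous fun w => ∑ γ ∈ latticeBall Γ (R + (‖z‖ + 1)), κ (w + (γ : Space n)) := by
    fun_prop
  refine this.continuousAt.congr ?_
  filter_upwards [Metric.ball_mem_nhds z one_pos] with w hw
  refine (per_eq_sum_latticeBall hκ ?_).symm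
  have h1 := norm_sub_norm_le w z
  rw [Metric.mem_ball, dist_eq_norm] at hw
  linarith

/-- A bounded measurable fundamental domain. -/
structure IsDomain (Γ : Submodule ℤ (Space n)) (D : Set (Space n)) (d : ℝ) : Prop where
  measurableSet : MeasurableSet D
  nonneg : 0 ≤ d
  norm_le : ∀ x ∈ D, ‖x‖ ≤ d
  isAddFundamentalDomain : IsAddFundamentalDomain Γ D
  exists_add_mem : ∀ x, ∃ γ : Γ, x + (γ : Space n) ∈ D
  pos : 0 < (volume : Measure (Space n)).real D

theorem exists_isDomain (Γ : Submodule ℤ (Space n)) [DiscreteTopology Γ] [IsZLattice ℝ Γ] :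
    ∃ D d, IsDomain Γ D d := by
  let b := Module.Free.chooseBasis ℤ Γ
  let D := ZSpan.fundamentalDomain (b.ofZLatticeBasis ℝ)
  have hb := ZSpan.fundamentalDomain_isBounded (b.ofZLatticeBasis ℝ)
  obtain ⟨d, hd⟩ := hb.exists_norm_le
  refine ⟨D, max d 0, ZSpan.fundamentalDomain_measurableSet _, le_max_right _ _,
    fun x hx => (hd x hx).trans (le_max_left _ _), ZLattice.isAddFundamentalDomain b _, ?_, ?_⟩
  · intro x
    obtain ⟨γ, hγ, -⟩ := ZSpan.exist_unique_vadd_mem_fundamentalDomain (b.ofZLatticeBasis ℝ) x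
    have h : (γ : Space n) ∈ Γ := (b.ofZLatticeBasis_span ℝ).le γ.2
    refine ⟨⟨γ, h⟩, ?_⟩
    rw [add_comm]
    exact hγ
  · refine ENNReal.toReal_pos ?_ hb.measure_lt_top.ne
    exact ZSpan.measure_fundamentalDomain_ne_zero _

variable {D : Set (Space n)} {d : ℝ}

theorem IsDomain.measure_lt_top (hD : IsDomain Γ D d) : volume D < ⊤ := by
  refine (Metric.isBounded_closedBall (x := (0 : Space n)) (r := d)).measure_lt_top (μ := volume)
    |>.trans_le' ?_
  exact measure_mono fun x hx => by simpa using hD.norm_le x hx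

variable [IsZLattice ℝ Γ]

theorem IsDomain.integral_eq_sum (hD : IsDomain Γ D d) {f : Space n → ℝ} (hf : Integrable f)
    {R : ℝ} (hR : ∀ z, R < ‖z‖ → f z = 0) {S : Finset Γ}
    (hS : ∀ γ : Γ, ‖(γ : Space n)‖ ≤ R + d → γ ∈ S) :
    ∫ x, f x = ∑ γ ∈ S, ∫ w in D, f (w + (γ : Space n)) := by
  have : VAddInvariantMeasure Γ (Space n) volume := ⟨fun c s _ => measure_preimage_add _ _ _⟩
  have h := hD.isAddFundamentalDomain.integral_eq_tsum'' f hf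
  rw [h, tsum_eq_sum (s := S)]
  · refine Finset.sum_congr rfl fun γ _ => ?_
    congr 1; ext w
    rw [add_comm w]; rfl
  · intro γ hγ
    refine setIntegral_eq_zero_of_forall_eq_zero fun w hw => hR _ ?_
    have h1 : R + d < ‖(γ : Space n)‖ := not_le.1 fun h => hγ (hS γ h)
    have h2 := hD.norm_le w hw
    have h3 := norm_sub_le ((γ : Space n) + w) w
    rw [add_sub_cancel_right] at h3
    change R < ‖(γ : Space n) + w‖
    linarith

/-- Unfolding: the integral over space against a periodic function is an integral over one cell
against the periodized kernel. -/
theorem IsDomain.integral_mul_eq (hD : IsDomain Γ D d) {κ H : Space n → ℝ} (hκ : Continuous κ)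
    {R : ℝ} (hR : ∀ z, R < ‖z‖ → κ z = 0) (hH : Continuous H)
    (hper : ∀ z, ∀ γ ∈ Γ, H (z + γ) = H z) :
    ∫ x, κ x * H x = ∫ w in D, per Γ κ w * H w := by
  have hκc : HasCompactSupport κ :=
    HasCompactSupport.intro (isCompact_closedBall (0 : Space n) R) fun z hz => hR z (by simpa using hz)
  have hi : ∀ γ : Γ, IntegrableOn (fun w => κ (w + (γ : Space n)) * H w) D := fun γ => by
    have : Integrable fun w => κ (w + (γ : Space n)) * H w :=
      Continuous.integrable_of_hasCompactSupport (by fun_prop)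
        (HasCompactSupport.mul_right (hκc.comp_homeomorph (Homeomorph.addRight (γ : Space n))))
    exact this.integrableOn
  rw [hD.integral_eq_sum (f := fun x => κ x * H x) (S := latticeBall Γ (R + d)) (R := R)
    ((hκ.mul hH).integrable_of_hasCompactSupport hκc.mul_right) (fun z hz => by simp [hR z hz])
    fun γ h => mem_latticeBall.2 h]
  have hp : ∀ (w : Space n) (γ : Γ), H (w + (γ : Space n)) = H w := fun w γ => hper w γ γ.2
  simp only [hp]
  rw [← integral_finsetSum _ fun γ _ => hi γ]
  refine setIntegral_congr_fun hD.measurableSet fun w hw => ?_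
  rw [per_eq_sum_latticeBall hR (hD.norm_le w hw), Finset.sum_mul]

/-- Periodizations of spread out kernels are nearly constant. -/
theorem IsDomain.exists_abs_per_sub_le (hD : IsDomain Γ D d) : ∃ C, 0 ≤ C ∧
    ∀ (κ : Space n → ℝ) (Λ R : ℝ), 1 ≤ R → 0 ≤ Λ → (∀ x y, |κ x - κ y| ≤ Λ * ‖x - y‖) →
      (∀ z, R < ‖z‖ → κ z = 0) → ∀ x,
      |per Γ κ x - ((volume : Measure (Space n)).real D)⁻¹ * ∫ z, κ z| ≤ C * (Λ * R ^ n) := by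
  set V := (volume : Measure (Space n)).real D
  have hV : 0 < V := hD.pos
  have hd := hD.nonneg
  set B := (volume : Measure (Space n)).real (Metric.ball 0 1)
  refine ⟨V⁻¹ * (2 * d * ((1 + 2 * d) ^ n * B)), by positivity,
    fun κ Λ R hR hΛ hlip hsupp x => ?_⟩
  have hκ : Continuous κ := by
    refine continuous_iff_continuousAt.2 fun y => ?_
    rw [ContinuousAt, tendsto_iff_norm_sub_tendsto_zero]
    refine squeeze_zero (fun _ => norm_nonneg _) (fun z => hlip z y) ?_
    have : Continuous fun z : Space n => Λ * ‖z - y‖ := by fun_prop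
    simpa using this.tendsto y
  have hκc : HasCompactSupport κ :=
    HasCompactSupport.intro (isCompact_closedBall (0 : Space n) R) fun z hz =>
      hsupp z (by simpa using hz)
  -- By periodicity x may be taken in the fundamental domain.
  obtain ⟨γ₀, hγ₀⟩ := hD.exists_add_mem x
  rw [← per_add κ x γ₀]
  generalize x + (γ₀ : Space n) = x at hγ₀ ⊢
  set S := latticeBall Γ (R + 2 * d + d)
  have hSR : ∀ γ : Γ, ‖(γ : Space n)‖ ≤ R + d → γ ∈ S := fun γ h => mem_latticeBall.2 (by linarith)
  have e1 : per Γ κ x = ∑ γ ∈ S, κ (x + (γ : Space n)) :=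
    per_eq_sum hsupp fun γ h => hSR γ (by linarith [hD.norm_le x hγ₀])
  -- The integral of κ splits into cells, just as the periodization is a sum over lattice points.
  -- Cell by cell, κ(x+γ) and κ(w+γ) differ by at most 2dΛ, and they can be nonzero only if |w+γ| ≤
  -- R+2d. The indicator f below measures the set of such points, giving a volume of order R^n.
  have e2 := hD.integral_eq_sum (hκ.integrable_of_hasCompactSupport hκc) hsupp hSR
  set f : Space n → ℝ := (Metric.closedBall (0 : Space n) (R + 2 * d)).indicator fun _ => 1
  have hf : Integrable f := (integrable_indicator_iff Metric.isClosed_closedBall.measurableSet).2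
    (integrableOn_const (isCompact_closedBall (0 : Space n) _).measure_lt_top.ne)
  have e3 := hD.integral_eq_sum (S := S) (R := R + 2 * d) hf
    (fun z hz => Set.indicator_of_notMem (by simpa using hz) _) fun γ h => mem_latticeBall.2 h
  have e4 : ∫ z, f z = (R + 2 * d) ^ n * B := by
    rw [integral_indicator Metric.isClosed_closedBall.measurableSet, setIntegral_const, smul_eq_mul,
      mul_one, Measure.real, Measure.addHaar_closedBall _ _ (by positivity), ENNReal.toReal_mul,
      ENNReal.toReal_ofReal (by positivity), finrank_euclideanSpace_fin]
    rfl
  have hfin := hD.measure_lt_top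
  have i1 : ∀ γ : Γ, IntegrableOn (fun w => κ (w + (γ : Space n))) D := fun γ =>
    ((hκ.integrable_of_hasCompactSupport hκc).comp_add_right (γ : Space n)).integrableOn
  have i2 : ∀ γ : Γ, IntegrableOn (fun w => f (w + (γ : Space n))) D := fun γ =>
    (hf.comp_add_right (γ : Space n)).integrableOn
  have main : |∑ γ ∈ S, ∫ w in D, (κ (x + (γ : Space n)) - κ (w + (γ : Space n)))|
      ≤ Λ * (2 * d) * ((R + 2 * d) ^ n * B) := by
    rw [← e4, e3, Finset.mul_sum]
    refine (Finset.abs_sum_le_sum_abs _ _).trans (Finset.sum_le_sum fun γ _ => ?_)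
    rw [← integral_const_mul, ← Real.norm_eq_abs]
    refine norm_integral_le_of_norm_le ((i2 γ).const_mul _)
      ((ae_restrict_iff' hD.measurableSet).2 (ae_of_all _ fun w hw => ?_))
    rw [Real.norm_eq_abs]
    have hxw : ‖(x + (γ : Space n)) - (w + (γ : Space n))‖ ≤ 2 * d := by
      rw [add_sub_add_right_eq_sub]
      linarith [norm_sub_le x w, hD.norm_le x hγ₀, hD.norm_le w hw]
    by_cases h : ‖w + (γ : Space n)‖ ≤ R + 2 * d
    · have : f (w + (γ : Space n)) = 1 := Set.indicator_of_mem (by simpa using h) _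
      rw [this, mul_one]
      exact (hlip _ _).trans (mul_le_mul_of_nonneg_left hxw hΛ)
    · have : f (w + (γ : Space n)) = 0 := Set.indicator_of_notMem (by simpa using h) _
      rw [this, hsupp (w + γ) (by linarith), hsupp (x + γ)]
      · simp
      · have := norm_sub_norm_le (w + (γ : Space n)) (x + γ)
        rw [norm_sub_rev] at this
        linarith
  have e5 : ∑ γ ∈ S, ∫ w in D, (κ (x + (γ : Space n)) - κ (w + (γ : Space n)))
      = V * per Γ κ x - ∫ z, κ z := by
    rw [e1, e2, Finset.mul_sum, ← Finset.sum_sub_distrib]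
    refine Finset.sum_congr rfl fun γ _ => ?_
    rw [integral_sub (integrable_const_iff.2 (Or.inr ⟨by simpa using hfin⟩)) (i1 γ), setIntegral_const, smul_eq_mul]
  rw [e5] at main
  have e6 : per Γ κ x - V⁻¹ * ∫ z, κ z = V⁻¹ * (V * per Γ κ x - ∫ z, κ z) := by
    field_simp
  rw [e6, abs_mul, abs_of_pos (inv_pos.2 hV), mul_assoc]
  refine mul_le_mul_of_nonneg_left (main.trans ?_) (inv_pos.2 hV).le
  -- This is where R ≥ 1 enters: R + 2d ≤ (1 + 2d)R.
  have h7 : (R + 2 * d) ^ n ≤ (1 + 2 * d) ^ n * R ^ n := by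
    rw [← mul_pow]
    exact pow_le_pow_left₀ (by positivity) (by nlinarith) n
  calc _ = 2 * d * Λ * B * (R + 2 * d) ^ n := by ring
    _ ≤ 2 * d * Λ * B * ((1 + 2 * d) ^ n * R ^ n) := by gcongr
    _ = _ := by ring

/-- A smooth partition of unity by lattice translates of one function. -/
theorem exists_partition (Γ : Submodule ℤ (Space n)) [DiscreteTopology Γ] [IsZLattice ℝ Γ] :
    ∃ χ : Space n → ℝ, IsTest Set.univ χ ∧ ∀ x, per Γ χ x = 1 := by
  obtain ⟨D, d, hD⟩ := exists_isDomain Γ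
  let b : ContDiffBump (0 : Space n) := ⟨1, 2, by norm_num, by norm_num⟩
  set k : Space n → ℝ := b.normed volume
  have hk : ContDiff ℝ ∞ k := b.contDiff_normed
  have hkc : HasCompactSupport k := b.hasCompactSupport_normed
  have hks : ∀ z, 2 < ‖z‖ → k z = 0 := fun z hz => by
    have := b.tsupport_normed_eq (μ := (volume : Measure (Space n)))
    refine image_eq_zero_of_notMem_tsupport ?_
    rw [this]
    simpa [b] using hz
  let f : Space n → ℝ := D.indicator fun _ => 1
  have hf : Integrable f := (integrable_indicator_iff hD.measurableSet).2
    (integrableOn_const hD.measure_lt_top.ne)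
  -- The mollified indicator of the cell D. The translates of D tile space, so the translates of χ
  -- add up to the integral of the mollifier, which is 1.
  let χ : Space n → ℝ := fun x => ∫ w in D, k (x - w)
  have hχ : χ = convolution f k (ContinuousLinearMap.lsmul ℝ ℝ) volume := by
    ext x
    simp only [χ, convolution, ← integral_indicator hD.measurableSet]
    congr 1; ext w
    by_cases hw : w ∈ D <;> simp [f, hw]
  have hsupp : ∀ z, 2 + d < ‖z‖ → χ z = 0 := fun z hz => by
    refine setIntegral_eq_zero_of_forall_eq_zero fun w hw => hks _ ?_
    have := norm_sub_norm_le z w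
    linarith [hD.norm_le w hw]
  refine ⟨χ, ⟨?_, ?_, Set.subset_univ _⟩, fun x => ?_⟩
  · rw [hχ]
    exact hkc.contDiff_convolution_right _ hf.locallyIntegrable hk
  · exact HasCompactSupport.intro (isCompact_closedBall (0 : Space n) (2 + d)) fun z hz =>
      hsupp z (by simpa using hz)
  · have h1 : ∫ y, k (x - y) = 1 := by
      rw [integral_sub_left_eq_self (fun y => k y) volume x]
      exact b.integral_normed
    have hi : Integrable fun y => k (x - y) :=
      (hk.continuous.integrable_of_hasCompactSupport hkc).comp_sub_left x
    set S := latticeBall Γ (2 + d + ‖x‖)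
    have h2 := hD.integral_eq_sum (R := 2 + ‖x‖) hi (fun z hz => hks _ (by
      have := norm_sub_norm_le z x
      rw [norm_sub_rev] at this
      linarith)) (S := S) fun γ h => mem_latticeBall.2 (by linarith)
    have h3 : per Γ χ x = ∑ γ ∈ S, χ (x - (γ : Space n)) := by
      rw [per_eq_sum (S := S) hsupp fun γ h => mem_latticeBall.2 (by linarith)]
      refine Finset.sum_bij' (fun γ _ => -γ) (fun γ _ => -γ) ?_ ?_ ?_ ?_ ?_
      · intro γ h; simpa [S, mem_latticeBall] using h
      · intro γ h; simpa [S, mem_latticeBall] using h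
      · intro γ _; simp
      · intro γ _; simp
      · intro γ _; simp
    rw [h3, ← h1, h2]
    refine Finset.sum_congr rfl fun γ _ => ?_
    simp only [χ]
    congr 1; ext w; congr 1; abel

end

/-! ### Coarse averages of periodic functions and of mean-zero distributions -/

section

variable {n : ℕ} {Γ : Submodule ℤ (Space n)} [DiscreteTopology Γ] {D : Set (Space n)} {d : ℝ}

theorem integral_scaled (q : ℤ) (L : Space n → ℝ) : ∫ z, scaled 0 q L z = ∫ z, L z := by
  have := kint_eq 0 q L fun _ => 1
  simpa [kint] using this

theorem exists_forall_norm_lt {X : Type*} [NormedAddCommGroup X] {L : X → ℝ}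
    (hL : HasCompactSupport L) : ∃ R, 1 ≤ R ∧ ∀ z, R < ‖z‖ → L z = 0 := by
  obtain ⟨R, hR⟩ := hL.isCompact.isBounded.exists_norm_le
  refine ⟨max R 1, le_max_right _ _, fun z hz => image_eq_zero_of_notMem_tsupport fun h => ?_⟩
  linarith [hR z h, le_max_left R 1]

theorem scaled_eq_zero {L : Space n → ℝ} {R : ℝ} (hR : ∀ z, R < ‖z‖ → L z = 0) (s q : ℤ)
    {z : Space n} (hz : (2 : ℝ) ^ (-q) * R < ‖z‖) : scaled s q L z = 0 := by
  rw [scaled, hR, mul_zero]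
  rw [norm_smul, Real.norm_eq_abs, abs_of_pos (by positivity)]
  have h2 : (0 : ℝ) < 2 ^ q := by positivity
  rw [zpow_neg, inv_mul_lt_iff₀ h2] at hz
  exact hz

variable [IsZLattice ℝ Γ]

/-- The kernel at scale q has Lipschitz constant of order 2^((n+1)q) and support radius of order
2^(-q), so the error ΛR^n is of order 2^q. The restriction q ≤ 0 keeps the radius at least 1. -/
theorem IsDomain.exists_abs_per_scaled_sub_le (hD : IsDomain Γ D d) {L : Space n → ℝ}
    (hL : IsTest Set.univ L) : ∃ C, 0 ≤ C ∧ ∀ q : ℤ, q ≤ 0 → ∀ x,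
      |per Γ (scaled 0 q L) x - ((volume : Measure (Space n)).real D)⁻¹ * ∫ z, L z|
        ≤ C * (2 : ℝ) ^ q := by
  obtain ⟨C, hC, h⟩ := hD.exists_abs_per_sub_le
  obtain ⟨Λ, hΛ⟩ := hL.contDiff.lipschitzWith_of_hasCompactSupport hL.hasCompactSupport (by simp)
  obtain ⟨R, hR1, hR⟩ := exists_forall_norm_lt hL.hasCompactSupport
  refine ⟨C * (Λ * R ^ n), by positivity, fun q hq x => ?_⟩
  have h1 : (1 : ℝ) ≤ 2 ^ (-q) := one_le_zpow₀ one_le_two (by omega)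
  have key := h (scaled 0 q L) ((2 : ℝ) ^ ((n + 0) * q) * (Λ * 2 ^ q)) (2 ^ (-q) * R)
    (by nlinarith) (by positivity) (fun x y => ?_) (fun z hz => scaled_eq_zero hR 0 q hz) x
  · rw [integral_scaled] at key
    refine key.trans (le_of_eq ?_)
    have e : (2 : ℝ) ^ (((n : ℤ) + 0) * q) * ((2 : ℝ) ^ (-q)) ^ n = 1 := by
      rw [← zpow_natCast, ← zpow_mul, ← zpow_add₀ two_ne_zero]
      ring_nf; simp
    rw [mul_pow]
    calc _ = C * (Λ * R ^ n) * 2 ^ q * ((2 : ℝ) ^ (((n : ℤ) + 0) * q) * ((2 : ℝ) ^ (-q)) ^ n) := by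
          ring
      _ = _ := by rw [e, mul_one]
  · have := hΛ.norm_sub_le ((2 : ℝ) ^ q • x) ((2 : ℝ) ^ q • y)
    rw [← smul_sub, norm_smul, Real.norm_eq_abs, Real.norm_eq_abs,
      abs_of_pos (by positivity : (0 : ℝ) < 2 ^ q)] at this
    rw [scaled, scaled, ← mul_sub, abs_mul, abs_of_pos (by positivity)]
    calc _ ≤ (2 : ℝ) ^ (((n : ℤ) + 0) * q) * (Λ * (2 ^ q * ‖x - y‖)) := by gcongr
      _ = _ := by ring

/-- Decay of averages of periodic functions against spread out kernels of mean zero. -/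
theorem exists_abs_kint_periodic_le (Γ : Submodule ℤ (Space n)) [DiscreteTopology Γ]
    [IsZLattice ℝ Γ] {L : Space n → ℝ} (hL : IsTest Set.univ L)
    (h0 : ∫ z, L z = 0) : ∃ C, 0 ≤ C ∧ ∀ q : ℤ, q ≤ 0 → ∀ (H : Space n → ℝ) (A : ℝ),
      Continuous H → (∀ z, ∀ γ ∈ Γ, H (z + γ) = H z) → (∀ z, |H z| ≤ A) →
      |kint 0 q L H| ≤ C * A * (2 : ℝ) ^ q := by
  obtain ⟨D, d, hD⟩ := exists_isDomain Γ
  obtain ⟨C, hC, h⟩ := hD.exists_abs_per_scaled_sub_le hL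
  obtain ⟨R, hR1, hR⟩ := exists_forall_norm_lt hL.hasCompactSupport
  have hV := hD.pos
  refine ⟨C * (volume : Measure (Space n)).real D, by positivity,
    fun q hq H A hH hper hA => ?_⟩
  have hA0 : 0 ≤ A := (abs_nonneg _).trans (hA 0)
  rw [kint, hD.integral_mul_eq (hL.scaled 0 q).continuous (fun z hz => scaled_eq_zero hR 0 q hz)
    hH hper, ← Real.norm_eq_abs]
  refine (norm_setIntegral_le_of_norm_le_const (C := C * 2 ^ q * A) hD.measure_lt_top
    fun z _ => ?_).trans (le_of_eq (by ring))
  have := h q hq z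
  rw [h0, mul_zero, sub_zero] at this
  rw [Real.norm_eq_abs, abs_mul]
  exact mul_le_mul this (hA z) (abs_nonneg _) (by positivity)

variable {I : Opens ℝ}

/-- A test function whose periodization is the mean of `Φ` up to a small periodic error. -/
theorem act_conv_eq {p : 𝓓'(slab n I, ℝ)} (hp0 : HasZeroMean Γ p)
    {Φ : ℝ × Space n → ℝ} (hΦ : IsTest (slab n I : Set (ℝ × Space n)) Φ) {χ : Space n → ℝ}
    (hχ : IsTest Set.univ χ) (hχ1 : ∀ x, per Γ χ x = 1) {κ : Space n → ℝ}
    (hκ : IsTest Set.univ κ) (c : ℝ) :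
    IsTest (slab n I : Set (ℝ × Space n))
      (fun P => χ P.2 * conv (fun z => per Γ κ z - c) Φ P) ∧
    act p (conv κ Φ) = act p fun P => χ P.2 * conv (fun z => per Γ κ z - c) Φ P := by
  obtain ⟨Rκ, -, hRκ⟩ := exists_forall_norm_lt hκ.hasCompactSupport
  obtain ⟨Rχ, -, hRχ⟩ := exists_forall_norm_lt hχ.hasCompactSupport
  obtain ⟨RΦ, -, hRΦ'⟩ := exists_forall_norm_lt hΦ.hasCompactSupport
  have hRΦ : ∀ t x, RΦ < ‖x‖ → Φ (t, x) = 0 := fun t x hx =>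
    hRΦ' _ (hx.trans_le (le_max_right _ _))
  have hpc : Continuous (per Γ κ) := continuous_per hRκ hκ.continuous
  have hcc : Continuous fun z => per Γ κ z - c := hpc.sub continuous_const
  have h1 := (hΦ.conv hκ.continuous hκ.hasCompactSupport).1
  have h2 : IsTest (slab n I : Set (ℝ × Space n))
      (fun P => χ P.2 * conv (fun z => per Γ κ z - c) Φ P) := by
    have hK : IsCompact ((Prod.fst '' tsupport Φ) ×ˢ tsupport χ) :=
      (hΦ.hasCompactSupport.isCompact.image continuous_fst).prod hχ.hasCompactSupport
    have hs : tsupport (fun P : ℝ × Space n => χ P.2 * conv (fun z => per Γ κ z - c) Φ P)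
        ⊆ (Prod.fst '' tsupport Φ) ×ˢ tsupport χ := by
      refine closure_minimal (fun P hP => ⟨?_, ?_⟩) hK.isClosed
      · by_contra h
        refine hP ?_
        have : conv (fun z => per Γ κ z - c) Φ P = 0 :=
          integral_eq_zero_of_ae (ae_of_all _ fun z => by
            simp [image_eq_zero_of_notMem_tsupport fun h' : (P.1, P.2 - z) ∈ tsupport Φ =>
              h ⟨_, h', rfl⟩])
        simp [this]
      · by_contra h
        exact hP (by simp [image_eq_zero_of_notMem_tsupport h])
    refine ⟨(hχ.contDiff.comp contDiff_snd).mul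
      (contDiff_conv hcc hΦ.contDiff hΦ.hasCompactSupport), hK.of_isClosed_subset
        (isClosed_tsupport _) hs, hs.trans ?_⟩
    rintro P ⟨⟨Q, hQ, hQP⟩, -⟩
    exact ⟨hQP ▸ (hΦ.tsupport_subset hQ).1, trivial⟩
  refine ⟨h2, ?_⟩
  have hi : ∀ (κ : Space n → ℝ), Continuous κ → ∀ t x, Integrable fun z => κ z * Φ (t, x - z) :=
    fun κ hκ t x => by simpa using integrable_conv hκ hΦ.continuous hΦ.hasCompactSupport (t, x)
  -- The two functions have lattice sums ∫ (per κ) Φ and ∫ (per κ - c) Φ, because the translates of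
  -- χ sum to one. They differ by c ∫ Φ(t,·), which does not depend on x, so p vanishes on the
  -- difference of the two functions.
  have key : ∀ (t : ℝ) (x : Space n), ∑ᶠ γ : Γ, (conv κ Φ (t, x + (γ : Space n))
      - χ (x + (γ : Space n)) * conv (fun z => per Γ κ z - c) Φ (t, x + (γ : Space n)))
      = c * ∫ y, Φ (t, y) := by
    intro t x
    set S := latticeBall Γ (max (Rκ + RΦ) Rχ + ‖x‖)
    have hS1 : ∀ γ : Γ, ‖(γ : Space n)‖ ≤ Rκ + RΦ + ‖x‖ → γ ∈ S := fun γ h =>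
      mem_latticeBall.2 (h.trans (by gcongr; exact le_max_left _ _))
    have hS2 : ∀ γ : Γ, ‖(γ : Space n)‖ ≤ Rχ + ‖x‖ → γ ∈ S := fun γ h =>
      mem_latticeBall.2 (h.trans (by gcongr; exact le_max_right _ _))
    have s1 : ∀ (g : Space n → ℝ) (γ : Γ), conv g Φ (t, x + (γ : Space n))
        = ∫ z, g (z + (γ : Space n)) * Φ (t, x - z) := fun g γ => by
      rw [conv, ← integral_add_right_eq_self _ (γ : Space n)]
      simp
    have n1 : ∀ γ : Γ, γ ∉ S → conv κ Φ (t, x + (γ : Space n)) = 0 := by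
      intro γ hγ
      rw [s1]
      refine integral_eq_zero_of_ae (ae_of_all _ fun z => ?_)
      by_cases h : RΦ < ‖x - z‖
      · simp [hRΦ _ _ h]
      · have h3 : Rκ < ‖z + (γ : Space n)‖ := by
          have h4 : Rκ + RΦ + ‖x‖ < ‖(γ : Space n)‖ := not_le.1 fun h => hγ (hS1 γ h)
          have h5 := norm_sub_le (z + (γ : Space n)) z
          have h6 := norm_sub_norm_le z x
          rw [add_sub_cancel_left] at h5
          rw [norm_sub_rev] at h6
          linarith
        simp [hRκ _ h3]
    have n2 : ∀ γ : Γ, γ ∉ S → χ (x + (γ : Space n)) = 0 := by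
      intro γ hγ
      refine hRχ _ ?_
      have h4 : Rχ + ‖x‖ < ‖(γ : Space n)‖ := not_le.1 fun h => hγ (hS2 γ h)
      have h5 := norm_sub_le (x + (γ : Space n)) x
      rw [add_sub_cancel_left] at h5
      linarith
    rw [finsum_eq_sum_of_support_subset (s := S) _ (fun γ hγ => by
      by_contra h
      exact hγ (by simp [n1 γ h, n2 γ h])), Finset.sum_sub_distrib]
    have e1 : ∑ γ ∈ S, conv κ Φ (t, x + (γ : Space n)) = ∫ z, per Γ κ z * Φ (t, x - z) := by
      simp only [s1]
      rw [← integral_finsetSum _ fun γ _ => ?_]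
      · congr 1; ext z
        rw [← Finset.sum_mul]
        by_cases h : RΦ < ‖x - z‖
        · simp [hRΦ _ _ h]
        · rw [per_eq_sum hRκ fun γ hγ => hS1 γ ?_]
          have h6 := norm_sub_norm_le z x
          rw [norm_sub_rev] at h6
          linarith
      · exact hi (fun z => κ (z + (γ : Space n))) (hκ.continuous.comp (by fun_prop)) t x
    have e2 : ∀ γ : Γ, conv (fun z => per Γ κ z - c) Φ (t, x + (γ : Space n))
        = ∫ z, (per Γ κ z - c) * Φ (t, x - z) := fun γ => by
      simp only [s1, per_add]
    simp only [e2]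
    rw [← Finset.sum_mul, ← per_eq_sum hRχ fun γ hγ => hS2 γ hγ, hχ1, one_mul, e1]
    simp only [sub_mul]
    rw [integral_sub (hi _ hpc t x) (hi (fun _ => c) continuous_const t x), sub_sub_cancel,
      integral_const_mul, integral_sub_left_eq_self (fun y => Φ (t, y)) volume x]
  have h3 := hp0 (h1.sub h2).toTestFunction fun t x y => (key t x).trans (key t y).symm
  rw [← act_of_isTest p (h1.sub h2), act_sub p h1 h2, sub_eq_zero] at h3
  exact h3

/-- Averages of distributions of mean zero over large regions are small. -/
theorem tendsto_act_conv_zero {p : 𝓓'(slab n I, ℝ)} (hp0 : HasZeroMean Γ p)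
    {Φ : ℝ × Space n → ℝ} (hΦ : IsTest (slab n I : Set (ℝ × Space n)) Φ) {η : Space n → ℝ}
    (hη : IsTest Set.univ η) :
    Tendsto (fun M : ℕ => act p (conv (scaled 0 (-(M : ℤ)) η) Φ)) atTop (𝓝 0) := by
  obtain ⟨D, d, hD⟩ := exists_isDomain Γ
  obtain ⟨χ, hχ, hχ1⟩ := exists_partition Γ
  obtain ⟨C, hC, hC'⟩ := hD.exists_abs_per_scaled_sub_le hη
  -- The limit of the periodized kernels at coarse scales. With this choice per - c is O(2^(-M)),
  -- while the supports of the modified test functions stay in a fixed compact set.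
  set c := ((volume : Measure (Space n)).real D)⁻¹ * ∫ z, η z
  have key := fun M : ℕ => act_conv_eq hp0 hΦ hχ hχ1 (hη.scaled 0 (-(M : ℤ))) c
  simp only [fun M => (key M).2]
  have hK : IsCompact ((Prod.fst '' tsupport Φ) ×ˢ tsupport χ) :=
    (hΦ.hasCompactSupport.isCompact.image continuous_fst).prod hχ.hasCompactSupport
  obtain ⟨Rη, hRη1, hRη⟩ := exists_forall_norm_lt hη.hasCompactSupport
  have hcont : ∀ M : ℕ, Continuous fun z => per Γ (scaled 0 (-(M : ℤ)) η) z - c := fun M =>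
    (continuous_per (fun z hz => scaled_eq_zero hRη 0 _ hz) (hη.scaled 0 _).continuous).sub
      continuous_const
  refine tendsto_act_of_iteratedFDeriv p hK ?_ (fun M => (key M).1.contDiff) (fun M P hP => ?_)
    fun k => ?_
  · rintro P ⟨⟨Q, hQ, hQP⟩, -⟩
    exact ⟨hQP ▸ (hΦ.tsupport_subset hQ).1, trivial⟩
  · refine ⟨?_, ?_⟩
    · by_contra h
      refine hP ?_
      have : conv (fun z => per Γ (scaled 0 (-(M : ℤ)) η) z - c) Φ P = 0 :=
        integral_eq_zero_of_ae (ae_of_all _ fun z => by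
          simp [image_eq_zero_of_notMem_tsupport fun h' : (P.1, P.2 - z) ∈ tsupport Φ =>
            h ⟨_, h', rfl⟩])
      simp [this]
    · by_contra h
      exact hP (by simp [image_eq_zero_of_notMem_tsupport h])
  -- Leibniz bound: the derivatives of χ do not depend on M, and every derivative of the convolution
  -- with per - c is O(2^(-M)).
  · choose B hB0 hB using fun i => exists_norm_iteratedFDeriv_conv_le i hΦ.contDiff
      hΦ.hasCompactSupport
    have hχ' : ∀ i, ∃ A, ∀ P : ℝ × Space n, ‖iteratedFDeriv ℝ i (fun P => χ P.2) P‖ ≤ A := by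
      intro i
      have hχi := (hχ.contDiff.continuous_iteratedFDeriv (m := i)
        (by exact_mod_cast le_top)).bounded_above_of_compact_support
          (hχ.hasCompactSupport.iteratedFDeriv i)
      obtain ⟨A, hA⟩ := hχi
      have hA0 : 0 ≤ A := (norm_nonneg _).trans (hA 0)
      refine ⟨A * ∏ _j : Fin i, ‖ContinuousLinearMap.snd ℝ ℝ (Space n)‖, fun P => ?_⟩
      have := (ContinuousLinearMap.snd ℝ ℝ (Space n)).iteratedFDeriv_comp_right
        (f := χ) hχ.contDiff P (i := i) (by exact_mod_cast le_top)
      rw [show (fun P : ℝ × Space n => χ P.2) = χ ∘ (ContinuousLinearMap.snd ℝ ℝ (Space n)) from rfl,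
        this]
      refine (ContinuousMultilinearMap.norm_compContinuousLinearMap_le _ _).trans ?_
      exact mul_le_mul_of_nonneg_right (hA _) (Finset.prod_nonneg fun _ _ => norm_nonneg _)
    choose A hA using hχ'
    refine ⟨fun M => (∑ i ∈ Finset.range (k + 1), (k.choose i : ℝ) * A i * B (k - i)) * C
      * (2 : ℝ) ^ (-(M : ℤ)), ?_, fun M P => ?_⟩
    · have h2 : Tendsto (fun M : ℕ => ((2 : ℝ)⁻¹) ^ M) atTop (𝓝 0) :=
        tendsto_pow_atTop_nhds_zero_of_lt_one (by norm_num) (by norm_num)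
      simpa [zpow_neg] using h2.const_mul
        ((∑ i ∈ Finset.range (k + 1), (k.choose i : ℝ) * A i * B (k - i)) * C)
    · have hA0 : ∀ i, 0 ≤ A i := fun i => (norm_nonneg _).trans (hA i 0)
      refine (norm_iteratedFDeriv_mul_le (hχ.contDiff.comp contDiff_snd)
        (contDiff_conv (hcont M) hΦ.contDiff hΦ.hasCompactSupport) P (n := k)
        (by exact_mod_cast le_top)).trans ?_
      beta_reduce
      rw [Finset.sum_mul, Finset.sum_mul]
      refine Finset.sum_le_sum fun i _ => ?_
      have b1 := hA i P
      have b2 := hB (k - i) _ _ (hcont M) (hC' (-(M : ℤ)) (by simp)) P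
      calc _ ≤ (k.choose i : ℝ) * A i * (B (k - i) * (C * 2 ^ (-(M : ℤ)))) := by
            refine mul_le_mul (mul_le_mul_of_nonneg_left b1 (by positivity)) b2 (norm_nonneg _) ?_
            exact mul_nonneg (by positivity) (hA0 i)
        _ = _ := by ring

end

/-! ### The weak Euler equations and the dyadic representation of the pressure -/

section

variable {n : ℕ} {I : Opens ℝ}

theorem locallyIntegrableOn_of_bounded {f : ℝ × Space n → ℝ}
    (hf : AEStronglyMeasurable f (volume.restrict (slab n I : Set (ℝ × Space n)))) {C : ℝ}
    (hC : ∀ P ∈ (slab n I : Set (ℝ × Space n)), |f P| ≤ C) :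
    LocallyIntegrableOn f (slab n I : Set (ℝ × Space n)) := by
  intro P hP
  refine ⟨(slab n I : Set (ℝ × Space n)) ∩ Metric.ball P 1,
    inter_mem_nhdsWithin _ (Metric.ball_mem_nhds P one_pos), ?_⟩
  have hm : MeasurableSet ((slab n I : Set (ℝ × Space n)) ∩ Metric.ball P 1) :=
    ((slab n I).isOpen.inter Metric.isOpen_ball).measurableSet
  have hfin : IsFiniteMeasure
      (volume.restrict ((slab n I : Set (ℝ × Space n)) ∩ Metric.ball P 1)) :=
    ⟨by rw [Measure.restrict_apply_univ]
        exact (measure_mono Set.inter_subset_right).trans_lt Metric.isBounded_ball.measure_lt_top⟩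
  refine Integrable.of_bound (hf.mono_measure (Measure.restrict_mono Set.inter_subset_left le_rfl))
    C ?_
  rw [ae_restrict_iff' hm]
  exact ae_of_all _ fun Q hQ => hC Q hQ.1

theorem IsTest.integrable_mul_of_locallyIntegrableOn {φ f : ℝ × Space n → ℝ}
    (hφ : IsTest (slab n I : Set (ℝ × Space n)) φ)
    (hf : LocallyIntegrableOn f (slab n I : Set (ℝ × Space n))) :
    Integrable fun P => φ P * f P := by
  have h1 : IntegrableOn (fun P => φ P * f P) (tsupport φ) := by
    have := hf.integrableOn_compact_subset hφ.tsupport_subset hφ.hasCompactSupport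
    exact this.continuousOn_mul hφ.continuous.continuousOn hφ.hasCompactSupport
  refine (integrableOn_iff_integrable_of_support_subset fun P hP => ?_).1 h1
  refine subset_tsupport _ fun h => hP ?_
  simp [h]

theorem act_add_left (S T : 𝓓'(slab n I, ℝ)) {φ : ℝ × Space n → ℝ}
    (h : IsTest (slab n I : Set (ℝ × Space n)) φ) : act (S + T) φ = act S φ + act T φ := by
  simp only [act_of_isTest _ h]; rfl

theorem act_zero_left (φ : ℝ × Space n → ℝ) : act (0 : 𝓓'(slab n I, ℝ)) φ = 0 := by
  unfold act
  split_ifs <;> rfl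

theorem act_sum_left {ι : Type*} (s : Finset ι) (T : ι → 𝓓'(slab n I, ℝ)) {φ : ℝ × Space n → ℝ}
    (h : IsTest (slab n I : Set (ℝ × Space n)) φ) :
    act (∑ i ∈ s, T i) φ = ∑ i ∈ s, act (T i) φ := by
  classical
  induction s using Finset.induction_on with
  | empty => simp [act_zero_left]
  | insert i s hi ih => rw [Finset.sum_insert hi, Finset.sum_insert hi, act_add_left _ _ h, ih]

theorem fderiv_fderiv_comm {X : Type*} [NormedAddCommGroup X] [NormedSpace ℝ X] {φ : X → ℝ}
    (hφ : ContDiff ℝ ∞ φ) (P a b : X) :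
    fderiv ℝ (fun P => fderiv ℝ φ P a) P b = fderiv ℝ (fun P => fderiv ℝ φ P b) P a := by
  have hd : Differentiable ℝ (fderiv ℝ φ) :=
    (hφ.fderiv_right (m := ∞) (by simp)).differentiable (by simp)
  have h : ∀ a b, fderiv ℝ (fun P => fderiv ℝ φ P a) P b = fderiv ℝ (fderiv ℝ φ) P b a :=
    fun a b => by
      rw [fderiv_clm_apply (hd P) (differentiableAt_const a)]
      simp
  rw [h, h]
  have := (hφ.contDiffAt (x := P)).isSymmSndFDerivAt (by
    rw [minSmoothness_of_isRCLikeNormedField]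
    exact WithTop.coe_le_coe.2 (le_top : (2 : ℕ∞) ≤ ⊤))
  exact this.eq b a

/-- The weak form of the Euler equations. -/
structure WeakEuler (I : Opens ℝ) (v : ℝ × Space n → Space n) (p : 𝓓'(slab n I, ℝ)) : Prop where
  momentum : ∀ l, ∀ φ, IsTest (slab n I : Set (ℝ × Space n)) φ →
    (∫ P, fderiv ℝ φ P (timeDir n) * v P l) + (∑ j, ∫ P, fderiv ℝ φ P (spaceDir j) * (v P j * v P l))
      + act p (fun P => fderiv ℝ φ P (spaceDir l)) = 0
  incompressible : ∀ φ, IsTest (slab n I : Set (ℝ × Space n)) φ →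
    ∑ j, ∫ P, fderiv ℝ φ P (spaceDir j) * v P j = 0

theorem IsWeakEulerSolution.weakEuler {v : ℝ × Space n → Space n} {p : 𝓓'(slab n I, ℝ)}
    (hE : IsWeakEulerSolution I v p)
    (h1 : ∀ j, LocallyIntegrableOn (fun P => v P j) (slab n I : Set (ℝ × Space n)))
    (h2 : ∀ j l, LocallyIntegrableOn (fun P => v P j * v P l) (slab n I : Set (ℝ × Space n))) :
    WeakEuler I v p where
  momentum l φ hφ := by
    have := congrArg (fun T => act T φ) (hE.momentum l)
    simp only [act_zero_left, act_add_left _ _ hφ, act_sum_left _ _ hφ, act_lineDerivOp _ hφ,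
      act_distOf (h1 _) (hφ.fderiv_apply _), act_distOf (h2 _ _) (hφ.fderiv_apply _),
      Finset.sum_neg_distrib] at this
    linarith
  incompressible φ hφ := by
    have := congrArg (fun T => act T φ) hE.incompressible
    simp only [act_zero_left, act_sum_left _ _ hφ, act_lineDerivOp _ hφ,
      act_distOf (h1 _) (hφ.fderiv_apply _), Finset.sum_neg_distrib] at this
    linarith

/-- The divergence of the momentum equation, obtained by testing its l-th component with ∂_l φ and
summing. The time derivative drops out because, after exchanging derivatives, it tests
incompressibility with ∂_t φ. -/
theorem WeakEuler.sum_act_laplacian {v : ℝ × Space n → Space n} {p : 𝓓'(slab n I, ℝ)}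
    (hE : WeakEuler I v p) {φ : ℝ × Space n → ℝ} (hφ : IsTest (slab n I : Set (ℝ × Space n)) φ) :
    ∑ l, act p (fun P => fderiv ℝ (fun P => fderiv ℝ φ P (spaceDir l)) P (spaceDir l))
      = - ∑ l, ∑ j, ∫ P, fderiv ℝ (fun P => fderiv ℝ φ P (spaceDir l)) P (spaceDir j)
          * (v P j * v P l) := by
  have h1 := fun l => hE.momentum l _ (hφ.fderiv_apply (spaceDir l))
  have h2 := hE.incompressible _ (hφ.fderiv_apply (timeDir n))
  simp only [fun P l => fderiv_fderiv_comm hφ.contDiff P (spaceDir l) (timeDir n)] at h1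
  have h3 := Finset.sum_congr (rfl : (Finset.univ : Finset (Fin n)) = _) fun l _ => h1 l
  simp only [Finset.sum_add_distrib, h2, Finset.sum_const_zero, zero_add] at h3
  linarith

/-- The contribution of the frequencies `2^q` to the pressure. -/
noncomputable def block (G : Space n → ℝ) (v : ℝ × Space n → Space n) (q : ℤ)
    (Φ : ℝ × Space n → ℝ) : ℝ :=
  ∑ l, ∑ j, ∫ P, conv (scaled 0 q (partialDeriv j (partialDeriv l G))) Φ P * (v P j * v P l)

theorem fderiv_conv_spaceDir {κ : Space n → ℝ} (hκ : IsTest Set.univ κ) {Φ : ℝ × Space n → ℝ}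
    (hΦ : ContDiff ℝ ∞ Φ) (hc : HasCompactSupport Φ) (j : Fin n) :
    (fun P => fderiv ℝ (conv κ Φ) P (spaceDir j)) = conv (partialDeriv j κ) Φ := by
  ext P
  rw [fderiv_conv_apply hκ.continuous hΦ hc, conv_fderiv_apply_spaceDir hκ hΦ hc]

theorem sum_Ico_neg_telescope (a : ℤ → ℝ) (M : ℕ) :
    ∑ q ∈ Finset.Ico (-(M : ℤ)) M, (a (q + 1) - a q) = a M - a (-(M : ℤ)) := by
  induction M with
  | zero => simp
  | succ M ih =>
    have : Finset.Ico (-((M + 1 : ℕ) : ℤ)) ((M + 1 : ℕ) : ℤ)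
        = insert (-(M : ℤ) - 1) (insert (M : ℤ) (Finset.Ico (-(M : ℤ)) M)) := by
      ext q
      simp only [Finset.mem_Ico, Finset.mem_insert, Nat.cast_add, Nat.cast_one]
      omega
    rw [this, Finset.sum_insert, Finset.sum_insert, ih]
    · push_cast
      rw [show -(M : ℤ) - 1 + 1 = -M by ring, show -((M : ℤ) + 1) = -M - 1 by ring]
      ring
    · simp
    · simp only [Finset.mem_Ico, Finset.mem_insert]
      omega

/-- Representation of the pressure by the velocity. -/
theorem WeakEuler.tendsto_sum_block {Γ : Submodule ℤ (Space n)} [DiscreteTopology Γ]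
    [IsZLattice ℝ Γ] {v : ℝ × Space n → Space n} {p : 𝓓'(slab n I, ℝ)}
    (hE : WeakEuler I v p) (hp0 : HasZeroMean Γ p) {G η : Space n → ℝ} (hG : IsTest Set.univ G)
    (hη : IsTest Set.univ η) (hη1 : ∫ z, η z = 1)
    (hGη : ∀ z, ∑ j, partialDeriv j (partialDeriv j G) z = 2 ^ n * η ((2 : ℝ) • z) - η z)
    {Φ : ℝ × Space n → ℝ} (hΦ : IsTest (slab n I : Set (ℝ × Space n)) Φ) :
    Tendsto (fun M : ℕ => ∑ q ∈ Finset.Ico (-(M : ℤ)) M, block G v q Φ) atTop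
      (𝓝 (- act p Φ)) := by
  have hcΦ := hΦ.hasCompactSupport
  have htest : ∀ q, IsTest (slab n I : Set (ℝ × Space n)) (conv (scaled 0 q η) Φ) := fun q =>
    (hΦ.conv (hη.scaled 0 q).continuous (hη.scaled 0 q).hasCompactSupport).1
  -- The Poisson identity is tested with the convolution of Φ and G at scale q. Order -2 compensates
  -- the two derivatives, so that its Laplacian is the difference of two consecutive mollifications
  -- of Φ.
  have key : ∀ q, act p (conv (scaled 0 (q + 1) η) Φ) - act p (conv (scaled 0 q η) Φ)
      = - block G v q Φ := by
    intro q
    have hGq := hG.scaled (-2) q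
    have h := hE.sum_act_laplacian (hΦ.conv hGq.continuous hGq.hasCompactSupport).1
    have e : ∀ l j, (fun P => fderiv ℝ (fun P => fderiv ℝ (conv (scaled (-2) q G) Φ) P (spaceDir l))
        P (spaceDir j)) = conv (scaled 0 q (partialDeriv j (partialDeriv l G))) Φ := fun l j => by
      rw [fderiv_conv_spaceDir hGq hΦ.contDiff hcΦ,
        fderiv_conv_spaceDir (hGq.partialDeriv l) hΦ.contDiff hcΦ,
        partialDeriv_scaled hG.differentiable, partialDeriv_scaled (hG.partialDeriv l).differentiable]
      rfl
    have e' : ∀ l j P, fderiv ℝ (fun P => fderiv ℝ (conv (scaled (-2) q G) Φ) P (spaceDir l))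
        P (spaceDir j) = conv (scaled 0 q (partialDeriv j (partialDeriv l G))) Φ P := fun l j P =>
      congrFun (e l j) P
    simp only [e'] at h
    change _ = - block G v q Φ at h
    rw [← h, ← act_sub p (htest _) (htest _), ← act_sum p Finset.univ fun l _ => ?_]
    · congr 1; ext P
      have hi : ∀ κ : Space n → ℝ, Continuous κ → Integrable fun z => κ z * Φ (P.1, P.2 - z) :=
        fun κ hκ => integrable_conv hκ hΦ.continuous hcΦ P
      simp only [conv, smul_eq_mul]
      rw [← integral_sub (hi _ (hη.scaled 0 _).continuous) (hi _ (hη.scaled 0 _).continuous),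
        ← integral_finsetSum _ fun l _ =>
          hi _ (((hG.partialDeriv l).partialDeriv l).scaled 0 q).continuous]
      congr 1; ext z
      rw [← Finset.sum_mul, ← sub_mul]
      congr 1
      simp only [scaled, ← Finset.mul_sum, hGη]
      rw [smul_smul, mul_add, zpow_add₀ two_ne_zero, mul_sub, zpow_add_one₀ two_ne_zero]
      simp only [add_zero, mul_one, zpow_natCast, mul_comm (2 : ℝ) ((2 : ℝ) ^ q)]
      ring
    · exact (hΦ.conv (((hG.partialDeriv l).partialDeriv l).scaled 0 q).continuous
        (((hG.partialDeriv l).partialDeriv l).scaled 0 q).hasCompactSupport).1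
  -- Fine end of the telescope: an approximate identity, with first moment 2^(-M).
  have t1 : Tendsto (fun M : ℕ => act p (conv (scaled 0 (M : ℤ) η) Φ)) atTop (𝓝 (act p Φ)) := by
    obtain ⟨R, hR1, hR⟩ := exists_forall_norm_lt hη.hasCompactSupport
    refine tendsto_act_conv p hΦ (κ := fun M : ℕ => scaled 0 (M : ℤ) η) (r := R)
      (fun M => (hη.scaled 0 _).continuous) (fun M z hz => scaled_eq_zero hR 0 _ ?_)
      (fun M => by rw [integral_scaled, hη1]) ?_
    · refine lt_of_le_of_lt ?_ hz
      have : (2 : ℝ) ^ (-(M : ℤ)) ≤ 1 := zpow_le_one_of_nonpos₀ one_le_two (by simp)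
      nlinarith
    · have e : ∀ M : ℕ, ∫ z, |scaled 0 (M : ℤ) η z| * ‖z‖
          = ((2 : ℝ)⁻¹) ^ M * ∫ u, |η u| * ‖u‖ := fun M => by
        have := kint_eq 0 (M : ℤ) (fun u => |η u|) fun z => ‖z‖
        simp only [zero_mul, zpow_zero, one_mul, norm_smul, norm_inv, zpow_natCast, norm_pow,
          Real.norm_two] at this
        rw [← integral_const_mul]
        calc _ = kint 0 (M : ℤ) (fun u => |η u|) fun z => ‖z‖ := by
              simp only [kint, scaled, abs_mul]
              congr 1; ext z
              rw [abs_of_pos (by positivity : (0 : ℝ) < 2 ^ ((n + 0) * (M : ℤ)))]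
          _ = _ := by
              rw [this]
              congr 1; ext u; rw [inv_pow]; ring
      simp only [e]
      have h2 : Tendsto (fun M : ℕ => ((2 : ℝ)⁻¹) ^ M) atTop (𝓝 0) :=
        tendsto_pow_atTop_nhds_zero_of_lt_one (by norm_num) (by norm_num)
      simpa using h2.mul_const (∫ u, |η u| * ‖u‖)
  -- Coarse end of the telescope: it vanishes by the mean-zero normalization of p.
  have t2 := tendsto_act_conv_zero hp0 hΦ hη
  have t3 := (t1.sub t2).neg
  rw [sub_zero] at t3
  refine t3.congr fun M => ?_
  rw [← sum_Ico_neg_telescope (fun q => act p (conv (scaled 0 q η) Φ))]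
  simp only [key, Finset.sum_neg_distrib, neg_neg]

/-- Fubini, applied time by time: w is assumed continuous only on time slices, since the velocity is
not yet known to be regular in t. -/
theorem integral_mul_conv_slab {κ : Space n → ℝ} (hκ : Continuous κ) (hκc : HasCompactSupport κ)
    {Φ w : ℝ × Space n → ℝ} (hΦ : IsTest (slab n I : Set (ℝ × Space n)) Φ)
    (hw : LocallyIntegrableOn w (slab n I : Set (ℝ × Space n)))
    (hwc : ∀ t ∈ I, Continuous fun x => w (t, x)) :
    ∫ P, conv κ Φ P * w P = ∫ t, ∫ x, Φ (t, x) * ∫ z, κ z * w (t, x + z) := by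
  have hi := ((hΦ.conv hκ hκc).1).integrable_mul_of_locallyIntegrableOn hw
  rw [Measure.volume_eq_prod, integral_prod _ hi]
  congr 1; ext t
  by_cases ht : t ∈ I
  · have hs : HasCompactSupport fun x => Φ (t, x) :=
      HasCompactSupport.intro (hΦ.hasCompactSupport.isCompact.image continuous_snd) fun x hx =>
        eq_zero_of_notMem_image_snd hx
    have hΦc := hΦ.continuous
    rw [← integral_mul_conv hκ hκc (hwc t ht) (ψ := fun x => Φ (t, x)) (by fun_prop) hs]
    simp only [conv, smul_eq_mul, mul_comm]
  · have : ∀ x, Φ (t, x) = 0 := fun x => image_eq_zero_of_notMem_tsupport fun h =>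
      ht (hΦ.tsupport_subset h).1
    simp [conv, this]

end

/-! ### Size of the pressure gradient at a given scale -/

section

variable {n : ℕ} {I : Opens ℝ}

theorem integral_partialDeriv_eq_zero {L : Space n → ℝ} (hL : IsTest Set.univ L) (j : Fin n) :
    ∫ z, partialDeriv j L z = 0 :=
  integral_fderiv_apply_eq_zero hL.contDiff hL.hasCompactSupport _

theorem kint_eq_of_integral_eq_zero {L H : Space n → ℝ} (hL : IsTest Set.univ L)
    (h0 : ∫ z, L z = 0) (hH : Continuous H) (s q : ℤ) (c : ℝ) :
    kint s q L H = kint s q L fun z => H z - c := by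
  rw [← kint_sub hL s q hH continuous_const]
  have : kint s q L (fun _ => c) = 0 := by
    rw [kint_eq, integral_mul_const, h0, zero_mul, mul_zero]
  rw [this, sub_zero]

/-- The size of averages of Hölder functions against kernels of mean zero. -/
theorem exists_abs_kint_holder_le {L : Space n → ℝ} (hL : IsTest Set.univ L)
    (h0 : ∫ z, L z = 0) {α : ℝ} (hα : 0 < α) {A : ℝ} (hA : 0 ≤ A) : ∃ C, 0 ≤ C ∧
    ∀ (s q : ℤ) (H : Space n → ℝ), Continuous H → (∀ z, |H z - H 0| ≤ A * ‖z‖ ^ α) →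
      |kint s q L H| ≤ C * (2 : ℝ) ^ ((s - α) * q) := by
  refine ⟨A * ∫ u, |L u| * (1 + ‖u‖ ^ α), mul_nonneg hA (integral_nonneg fun u => by positivity),
    fun s q H hH h => ?_⟩
  rw [kint_eq_of_integral_eq_zero hL h0 hH s q (H 0)]
  exact abs_kint_le hL s q hα.le hA h

theorem IsTest.tensor {θ : ℝ → ℝ} (hθ : IsTest (I : Set ℝ) θ) {ψ : Space n → ℝ}
    (hψ : IsTest Set.univ ψ) :
    IsTest (slab n I : Set (ℝ × Space n)) fun P => θ P.1 * ψ P.2 :=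
  (isTest_mul_prod hθ hψ).mono fun _ h => ⟨h.1, trivial⟩

theorem fderiv_tensor {θ : ℝ → ℝ} (hθ : Differentiable ℝ θ) {ψ : Space n → ℝ}
    (hψ : Differentiable ℝ ψ) (P : ℝ × Space n) :
    fderiv ℝ (fun P : ℝ × Space n => θ P.1 * ψ P.2) P (timeDir n) = deriv θ P.1 * ψ P.2 ∧
    ∀ j, fderiv ℝ (fun P : ℝ × Space n => θ P.1 * ψ P.2) P (spaceDir j)
      = θ P.1 * partialDeriv j ψ P.2 := by
  refine ⟨?_, fun j => ?_⟩ <;> rw [fderiv_mul_prod hθ hψ] <;>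
    simp [timeDir, spaceDir, partialDeriv]

/-- The bound is by the L¹ norm of θ. This is what later allows weak time derivatives to be read as
bounded functions. -/
theorem abs_integral_conv_tensor_le {κ : Space n → ℝ} (hκ : Continuous κ) (hκc : HasCompactSupport κ)
    {θ : ℝ → ℝ} (hθ : IsTest (I : Set ℝ) θ) {ψ : Space n → ℝ} (hψ : IsTest Set.univ ψ)
    {w : ℝ × Space n → ℝ} (hw : LocallyIntegrableOn w (slab n I : Set (ℝ × Space n)))
    (hwc : ∀ t ∈ I, Continuous fun x => w (t, x)) {B : ℝ}
    (hB : ∀ t ∈ I, ∀ x, |∫ z, κ z * w (t, x + z)| ≤ B) :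
    |∫ P, conv κ (fun P => θ P.1 * ψ P.2) P * w P| ≤ B * (∫ x, |ψ x|) * ∫ t, |θ t| := by
  rw [integral_mul_conv_slab hκ hκc (hθ.tensor hψ) hw hwc, ← Real.norm_eq_abs, ← integral_const_mul]
  refine norm_integral_le_of_norm_le ((hθ.continuous.integrable_of_hasCompactSupport
    hθ.hasCompactSupport).abs.const_mul _) (ae_of_all _ fun t => ?_)
  by_cases ht : t ∈ I
  · rw [show B * (∫ x, |ψ x|) * |θ t| = ∫ x, |θ t| * B * |ψ x| by
      rw [integral_const_mul]; ring]
    refine norm_integral_le_of_norm_le ((hψ.continuous.integrable_of_hasCompactSupport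
      hψ.hasCompactSupport).abs.const_mul _) (ae_of_all _ fun x => ?_)
    rw [Real.norm_eq_abs, abs_mul, abs_mul]
    calc _ ≤ |θ t| * |ψ x| * B := mul_le_mul_of_nonneg_left (hB t ht x) (by positivity)
      _ = _ := by ring
  · have : θ t = 0 := image_eq_zero_of_notMem_tsupport fun h => ht (hθ.tsupport_subset h)
    simp [this]

/-- Velocity fields that are uniformly Hölder continuous in space. -/
structure SpaceHolder (I : Opens ℝ) (α : ℝ) (v : ℝ × Space n → Space n) : Prop where
  aestronglyMeasurable : AEStronglyMeasurable v (volume.restrict (slab n I : Set (ℝ × Space n)))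
  bound : ∃ C, 0 ≤ C ∧ ∀ t ∈ I, ∀ l, (∀ x, |v (t, x) l| ≤ C) ∧
    ∀ x y, |v (t, x) l - v (t, y) l| ≤ C * ‖x - y‖ ^ α

theorem MemCtCx.spaceHolder {Γ : Submodule ℤ (Space n)} {α : ℝ} {v : ℝ × Space n → Space n}
    (h : MemCtCx I Γ α v) : SpaceHolder I α v where
  aestronglyMeasurable := h.aestronglyMeasurable
  bound := by
    obtain ⟨C, hC⟩ := h.bound
    refine ⟨max C 0, le_max_right _ _, fun t ht l => ⟨fun x => ?_, fun x y => ?_⟩⟩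
    · exact (PiLp.norm_apply_le (v (t, x)) l).trans (((hC t ht).1 x).trans (le_max_left _ _))
    · refine (PiLp.norm_apply_le (v (t, x) - v (t, y)) l).trans (((hC t ht).2 x y).trans ?_)
      gcongr
      exact le_max_left _ _

variable {α : ℝ} {v : ℝ × Space n → Space n}

theorem continuous_of_holder {f : Space n → ℝ} {C : ℝ} (hα : 0 < α)
    (h : ∀ x y, |f x - f y| ≤ C * ‖x - y‖ ^ α) : Continuous f := by
  refine continuous_iff_continuousAt.2 fun y => ?_
  rw [ContinuousAt, tendsto_iff_norm_sub_tendsto_zero]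
  refine squeeze_zero (fun _ => norm_nonneg _) (fun z => h z y) ?_
  have : Continuous fun z : Space n => C * ‖z - y‖ ^ α :=
    continuous_const.mul ((continuous_id.sub continuous_const).norm.rpow_const
      fun _ => Or.inr hα.le)
  simpa [Real.zero_rpow hα.ne'] using this.tendsto y

theorem SpaceHolder.aestronglyMeasurable_apply (h : SpaceHolder I α v) (l : Fin n) :
    AEStronglyMeasurable (fun P => v P l) (volume.restrict (slab n I : Set (ℝ × Space n))) :=
  (by fun_prop : Continuous fun x : Space n => x l).comp_aestronglyMeasurable
    h.aestronglyMeasurable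

theorem SpaceHolder.locallyIntegrableOn (h : SpaceHolder I α v) (l : Fin n) :
    LocallyIntegrableOn (fun P => v P l) (slab n I : Set (ℝ × Space n)) := by
  obtain ⟨C, -, hC⟩ := h.bound
  exact locallyIntegrableOn_of_bounded (h.aestronglyMeasurable_apply l)
    fun P hP => ((hC P.1 hP.1 l).1 P.2)

theorem SpaceHolder.locallyIntegrableOn_mul (h : SpaceHolder I α v) (j l : Fin n) :
    LocallyIntegrableOn (fun P => v P j * v P l) (slab n I : Set (ℝ × Space n)) := by
  obtain ⟨C, hC0, hC⟩ := h.bound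
  refine locallyIntegrableOn_of_bounded (C := C * C)
    ((h.aestronglyMeasurable_apply j).mul (h.aestronglyMeasurable_apply l)) fun P hP => ?_
  rw [abs_mul]
  exact mul_le_mul ((hC P.1 hP.1 j).1 P.2) ((hC P.1 hP.1 l).1 P.2) (abs_nonneg _) hC0

theorem SpaceHolder.exists_mul_bound (h : SpaceHolder I α v) : ∃ A, 0 ≤ A ∧
    ∀ t ∈ I, ∀ j l x y, |v (t, x) j * v (t, x) l - v (t, y) j * v (t, y) l| ≤ A * ‖x - y‖ ^ α := by
  obtain ⟨C, hC0, hC⟩ := h.bound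
  refine ⟨2 * (C * C), by positivity, fun t ht j l x y => ?_⟩
  have e : v (t, x) j * v (t, x) l - v (t, y) j * v (t, y) l
      = v (t, x) j * (v (t, x) l - v (t, y) l) + (v (t, x) j - v (t, y) j) * v (t, y) l := by ring
  rw [e]
  refine (abs_add_le _ _).trans ?_
  rw [abs_mul, abs_mul]
  have h1 := mul_le_mul ((hC t ht j).1 x) ((hC t ht l).2 x y) (abs_nonneg _) hC0
  have h2 := mul_le_mul ((hC t ht j).2 x y) ((hC t ht l).1 y) (abs_nonneg _) (by positivity)
  linarith

/-- The first entry decays above q = k and the second below it. Both equal 2^((1-α)k) at q = k, so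
the sum is comparable to its peak. -/
theorem sum_min_rpow_le {α : ℝ} (hα : 0 < α) (hα1 : α < 1) : ∃ C, 0 ≤ C ∧ ∀ (k : ℤ) (S : Finset ℤ),
    ∑ q ∈ S, min ((2 : ℝ) ^ (-α * q) * 2 ^ k) ((2 : ℝ) ^ ((1 - α) * q))
      ≤ C * (2 : ℝ) ^ ((1 - α) * k) := by
  set δ := min α (1 - α)
  have hδ : 0 < δ := lt_min hα (by linarith)
  refine ⟨∑' q, geo δ q, tsum_nonneg fun q => geo_nonneg _ _, fun k S => ?_⟩
  have hs : Summable fun q : ℤ => geo δ (q - k) :=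
    (summable_geo hδ).comp_injective (sub_left_injective (b := k))
  have hle : ∀ q : ℤ, min ((2 : ℝ) ^ (-α * q) * 2 ^ k) ((2 : ℝ) ^ ((1 - α) * q))
      ≤ geo δ (q - k) * (2 : ℝ) ^ ((1 - α) * k) := by
    intro q
    rw [geo, ← Real.rpow_add zero_lt_two]
    push_cast
    rcases le_total k q with h | h
    · have h' : (k : ℝ) ≤ q := by exact_mod_cast h
      refine (min_le_left _ _).trans ?_
      rw [← Real.rpow_intCast, ← Real.rpow_add zero_lt_two]
      refine rpow_two_le ?_
      rw [abs_of_nonneg (by linarith)]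
      nlinarith [min_le_left α (1 - α)]
    · have h' : (q : ℝ) ≤ k := by exact_mod_cast h
      refine (min_le_right _ _).trans (rpow_two_le ?_)
      rw [abs_of_nonpos (by linarith)]
      nlinarith [min_le_right α (1 - α)]
  calc _ ≤ ∑ q ∈ S, geo δ (q - k) * (2 : ℝ) ^ ((1 - α) * k) := Finset.sum_le_sum fun q _ => hle q
    _ = (∑ q ∈ S, geo δ (q - k)) * (2 : ℝ) ^ ((1 - α) * k) := (Finset.sum_mul _ _ _).symm
    _ ≤ _ := by
      refine mul_le_mul_of_nonneg_right ?_ (by positivity)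
      refine (hs.sum_le_tsum S fun q _ => geo_nonneg _ _).trans (le_of_eq ?_)
      exact (Equiv.subRight k).tsum_eq (geo δ)

theorem isTest_scaled_sub {L : Space n → ℝ} (hL : IsTest Set.univ L) (s q : ℤ) (x₀ : Space n) :
    IsTest Set.univ fun x => scaled s q L (x - x₀) where
  contDiff := (hL.scaled s q).contDiff.comp (contDiff_id.sub contDiff_const)
  hasCompactSupport :=
    (hL.scaled s q).hasCompactSupport.comp_homeomorph (Homeomorph.subRight x₀)
  tsupport_subset := Set.subset_univ _

theorem partialDeriv_scaled_sub {L : Space n → ℝ} (hL : Differentiable ℝ L) (s q : ℤ)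
    (x₀ : Space n) (j : Fin n) : partialDeriv j (fun x => scaled s q L (x - x₀))
      = fun x => scaled (s + 1) q (partialDeriv j L) (x - x₀) := by
  ext x
  rw [← partialDeriv_scaled hL]
  simp only [partialDeriv]
  rw [fderiv_comp_sub]

theorem integral_abs_scaled (s q : ℤ) (L : Space n → ℝ) (x₀ : Space n) :
    ∫ x, |scaled s q L (x - x₀)| = 2 ^ (s * q) * ∫ x, |L x| := by
  rw [integral_sub_right_eq_self (fun x => |scaled s q L x|) x₀]
  have h := kint_eq s q (fun x => |L x|) fun _ => 1
  simp only [mul_one] at h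
  rw [← h]
  simp only [kint, scaled, abs_mul, mul_one]
  congr 1; ext z
  rw [abs_of_pos (by positivity : (0 : ℝ) < 2 ^ ((n + s) * q))]

/-- The pressure gradient at scale `2^(-k)`. -/
theorem WeakEuler.exists_abs_act_le {Γ : Submodule ℤ (Space n)} [DiscreteTopology Γ]
    [IsZLattice ℝ Γ] {p : 𝓓'(slab n I, ℝ)} (hn : 0 < n)
    (hE : WeakEuler I v p) (hp0 : HasZeroMean Γ p) (hv : SpaceHolder I α v) (hα : 0 < α)
    (hα1 : α < 1) {ρ : Space n → ℝ} (hρ : IsTest Set.univ ρ) (i : Fin n) :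
    ∃ C, 0 ≤ C ∧ ∀ (k : ℤ) (x₀ : Space n) (θ : ℝ → ℝ), IsTest (I : Set ℝ) θ →
      |act p fun P => θ P.1 * partialDeriv i (fun x => scaled 0 k ρ (x - x₀)) P.2|
        ≤ C * (2 : ℝ) ^ ((1 - α) * k) * ∫ t, |θ t| := by
  obtain ⟨G, η, hG, hη, hη1, hGη⟩ := exists_kernel hn
  obtain ⟨A, hA, hAb⟩ := hv.exists_mul_bound
  set K : Fin n → Fin n → Space n → ℝ := fun j l => partialDeriv j (partialDeriv l G) with hKdef
  have hK : ∀ j l, IsTest Set.univ (K j l) := fun j l => (hG.partialDeriv l).partialDeriv j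
  choose C₁ hC₁ h₁ using fun j l => exists_abs_kint_holder_le (hK j l)
    (integral_partialDeriv_eq_zero (hG.partialDeriv l) j) hα hA
  choose C₂ hC₂ h₂ using fun j l => exists_abs_kint_holder_le ((hK j l).partialDeriv i)
    (integral_partialDeriv_eq_zero (hK j l) i) hα hA
  obtain ⟨C₀, hC₀, h₀⟩ := sum_min_rpow_le hα hα1
  set b₁ := ∫ x, |partialDeriv i ρ x|
  set b₂ := ∫ x, |ρ x|
  have hb₁ : 0 ≤ b₁ := integral_nonneg fun _ => abs_nonneg _
  have hb₂ : 0 ≤ b₂ := integral_nonneg fun _ => abs_nonneg _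
  set E := ∑ l, ∑ j, (C₁ j l * b₁ + C₂ j l * b₂) with hEdef
  have hE0 : 0 ≤ E := Finset.sum_nonneg fun l _ => Finset.sum_nonneg fun j _ =>
    add_nonneg (mul_nonneg (hC₁ j l) hb₁) (mul_nonneg (hC₂ j l) hb₂)
  refine ⟨E * C₀, by positivity, fun k x₀ θ hθ => ?_⟩
  set ψ : Space n → ℝ := fun x => scaled 0 k ρ (x - x₀) with hψdef
  have hψ : IsTest Set.univ ψ := isTest_scaled_sub hρ 0 k x₀
  have hΦ := hθ.tensor (hψ.partialDeriv i)
  have hlim := hE.tendsto_sum_block hp0 hG hη hη1 hGη hΦ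
  set T := ∫ t, |θ t|
  have hT : 0 ≤ T := integral_nonneg fun _ => abs_nonneg _
  have hcont : ∀ j l, ∀ t ∈ I, Continuous fun x => v (t, x) j * v (t, x) l := fun j l t ht =>
    continuous_of_holder hα fun x y => hAb t ht j l x y
  have hinner : ∀ j l, ∀ t ∈ I, ∀ x z, |v (t, x + z) j * v (t, x + z) l
      - v (t, x + 0) j * v (t, x + 0) l| ≤ A * ‖z‖ ^ α := fun j l t ht x z => by
    simpa using hAb t ht j l (x + z) (x + 0)
  -- The derivative ∂_i may stay on ψ, at the cost of 2^k, or be moved to the kernel, at the cost of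
  -- 2^q. In both cases the mean-zero kernel against a product in C^α gains 2^(-αq), and the better
  -- choice is kept for each q.
  have hblock : ∀ q, |block G v q fun P => θ P.1 * partialDeriv i ψ P.2|
      ≤ E * T * min ((2 : ℝ) ^ (-α * q) * 2 ^ k) ((2 : ℝ) ^ ((1 - α) * q)) := by
    intro q
    have hterm : ∀ l j, |∫ P, conv (scaled 0 q (K j l)) (fun P => θ P.1 * partialDeriv i ψ P.2) P
        * (v P j * v P l)| ≤ (C₁ j l * b₁ + C₂ j l * b₂) * T
          * min ((2 : ℝ) ^ (-α * q) * 2 ^ k) ((2 : ℝ) ^ ((1 - α) * q)) := by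
      intro l j
      have t1 : 0 ≤ C₁ j l * b₁ := mul_nonneg (hC₁ j l) hb₁
      have t2 : 0 ≤ C₂ j l * b₂ := mul_nonneg (hC₂ j l) hb₂
      have a1 := abs_integral_conv_tensor_le ((hK j l).scaled 0 q).continuous
        ((hK j l).scaled 0 q).hasCompactSupport hθ (hψ.partialDeriv i)
        (hv.locallyIntegrableOn_mul j l) (hcont j l) (B := C₁ j l * (2 : ℝ) ^ (-α * q))
        (fun t ht x => by
          have := h₁ j l 0 q (fun z => v (t, x + z) j * v (t, x + z) l)
            ((hcont j l t ht).comp (by fun_prop)) (hinner j l t ht x)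
          simpa [kint] using this)
      have a2 := abs_integral_conv_tensor_le (((hK j l).partialDeriv i).scaled 1 q).continuous
        (((hK j l).partialDeriv i).scaled 1 q).hasCompactSupport hθ hψ
        (hv.locallyIntegrableOn_mul j l) (hcont j l) (B := C₂ j l * (2 : ℝ) ^ ((1 - α) * q))
        (fun t ht x => by
          have := h₂ j l 1 q (fun z => v (t, x + z) j * v (t, x + z) l)
            ((hcont j l t ht).comp (by fun_prop)) (hinner j l t ht x)
          simpa [kint] using this)
      have e : conv (scaled 1 q (partialDeriv i (K j l))) (fun P : ℝ × Space n => θ P.1 * ψ P.2)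
          = conv (scaled 0 q (K j l)) fun P => θ P.1 * partialDeriv i ψ P.2 := by
        ext P
        have h3 := partialDeriv_scaled (hK j l).differentiable 0 q i
        rw [zero_add] at h3
        rw [← h3, ← conv_fderiv_apply_spaceDir ((hK j l).scaled 0 q) (hθ.tensor hψ).contDiff
          (hθ.tensor hψ).hasCompactSupport]
        simp only [fun P => (fderiv_tensor hθ.differentiable hψ.differentiable P).2 i]
      rw [e] at a2
      have n1 : ∫ x, |partialDeriv i ψ x| = 2 ^ k * b₁ := by
        rw [hψdef, partialDeriv_scaled_sub hρ.differentiable, integral_abs_scaled]; simp [b₁]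
      have n2 : ∫ x, |ψ x| = b₂ := by
        rw [hψdef, integral_abs_scaled]; simp [b₂]
      rw [n1] at a1
      rw [n2] at a2
      rcases le_total ((2 : ℝ) ^ (-α * q) * 2 ^ k) ((2 : ℝ) ^ ((1 - α) * q)) with h | h
      · rw [min_eq_left h]
        refine a1.trans ?_
        calc _ = (C₁ j l * b₁ + 0) * T * ((2 : ℝ) ^ (-α * q) * 2 ^ k) := by ring
          _ ≤ _ := by gcongr
      · rw [min_eq_right h]
        refine a2.trans ?_
        calc _ = (0 + C₂ j l * b₂) * T * (2 : ℝ) ^ ((1 - α) * q) := by ring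
          _ ≤ _ := by gcongr
    simp only [block, hEdef, Finset.sum_mul]
    refine (Finset.abs_sum_le_sum_abs _ _).trans (Finset.sum_le_sum fun l _ => ?_)
    exact (Finset.abs_sum_le_sum_abs _ _).trans (Finset.sum_le_sum fun j _ => hterm l j)
  rw [← abs_neg]
  refine le_of_tendsto hlim.abs (Eventually.of_forall fun M => ?_)
  calc _ ≤ ∑ q ∈ Finset.Ico (-(M : ℤ)) M, |block G v q fun P => θ P.1 * partialDeriv i ψ P.2| :=
        Finset.abs_sum_le_sum_abs _ _
    _ ≤ ∑ q ∈ Finset.Ico (-(M : ℤ)) M,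
        E * T * min ((2 : ℝ) ^ (-α * q) * 2 ^ k) ((2 : ℝ) ^ ((1 - α) * q)) :=
        Finset.sum_le_sum fun q _ => hblock q
    _ = E * T * ∑ q ∈ Finset.Ico (-(M : ℤ)) M,
        min ((2 : ℝ) ^ (-α * q) * 2 ^ k) ((2 : ℝ) ^ ((1 - α) * q)) := (Finset.mul_sum _ _ _).symm
    _ ≤ E * T * (C₀ * (2 : ℝ) ^ ((1 - α) * k)) :=
        mul_le_mul_of_nonneg_left (h₀ k _) (by positivity)
    _ = _ := by ring

end

/-! ### Time regularity of local averages of the velocity -/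

section
open scoped Convolution

variable {n : ℕ} {I : Opens ℝ}

/-- Local averages of the velocity. -/
noncomputable def avg (v : ℝ × Space n → Space n) (l : Fin n) (ρ : Space n → ℝ) (k : ℤ)
    (x₀ : Space n) (t : ℝ) : ℝ :=
  ∫ x, scaled 0 k ρ (x - x₀) * v (t, x) l

variable {α : ℝ} {v : ℝ × Space n → Space n}

theorem kint_translate (s q : ℤ) (L H : Space n → ℝ) (x₀ : Space n) :
    ∫ x, scaled s q L (x - x₀) * H x = kint s q L fun z => H (z + x₀) := by
  rw [← integral_add_right_eq_self _ x₀]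
  simp [kint]

theorem SpaceHolder.continuous (hv : SpaceHolder I α v) (hα : 0 < α) {t : ℝ} (ht : t ∈ I)
    (l : Fin n) : Continuous fun x => v (t, x) l := by
  obtain ⟨C, hC, h⟩ := hv.bound
  exact continuous_of_holder hα (h t ht l).2

/-- Mollification error of a C^α function. The constant is uniform in time and in the centre. -/
theorem SpaceHolder.exists_abs_avg_sub_le (hv : SpaceHolder I α v) (hα : 0 < α) {ρ : Space n → ℝ}
    (hρ : IsTest Set.univ ρ) (hρ1 : ∫ z, ρ z = 1) : ∃ C, 0 ≤ C ∧ ∀ (l : Fin n) (k : ℤ) (x₀ : Space n),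
      ∀ t ∈ I, |avg v l ρ k x₀ t - v (t, x₀) l| ≤ C * (2 : ℝ) ^ (-α * k) := by
  obtain ⟨C, hC, h⟩ := hv.bound
  refine ⟨C * ∫ u, |ρ u| * (1 + ‖u‖ ^ α), mul_nonneg hC (integral_nonneg fun u => by positivity),
    fun l k x₀ t ht => ?_⟩
  have hc := hv.continuous hα ht l
  have e : v (t, x₀) l = kint 0 k ρ fun _ => v (t, x₀) l := by
    rw [kint_eq, integral_mul_const, hρ1]; simp
  have hc' : Continuous fun z => v (t, z + x₀) l := hc.comp (continuous_add_const x₀)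
  rw [avg, kint_translate 0 k ρ (fun x => v (t, x) l), e, kint_sub hρ 0 k hc' continuous_const]
  have := abs_kint_le hρ 0 k hα.le hC (H := fun z => v (t, z + x₀) l - v (t, x₀) l) fun z => by
    simpa using (h t ht l).2 (z + x₀) x₀
  simpa using this

theorem SpaceHolder.exists_abs_avg_le (hv : SpaceHolder I α v) (ρ : Space n → ℝ) : ∃ B,
    ∀ (l : Fin n) (k : ℤ) (x₀ : Space n), Integrable (fun x => scaled 0 k ρ (x - x₀)) →
      ∀ t ∈ I, |avg v l ρ k x₀ t| ≤ B := by
  obtain ⟨C, hC, h⟩ := hv.bound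
  refine ⟨C * ∫ x, |ρ x|, fun l k x₀ hi t ht => ?_⟩
  have e := integral_abs_scaled 0 k ρ x₀
  rw [zero_mul, zpow_zero, one_mul] at e
  rw [← e, ← integral_const_mul, ← Real.norm_eq_abs]
  refine norm_integral_le_of_norm_le (hi.abs.const_mul _) (ae_of_all _ fun x => ?_)
  rw [Real.norm_eq_abs, abs_mul, mul_comm]
  exact mul_le_mul_of_nonneg_right ((h t ht l).1 x) (abs_nonneg _)

theorem SpaceHolder.aestronglyMeasurable_avg (hv : SpaceHolder I α v) {ρ : Space n → ℝ}
    (hρ : Continuous ρ) (l : Fin n) (k : ℤ) (x₀ : Space n) :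
    AEStronglyMeasurable (avg v l ρ k x₀) (volume.restrict (I : Set ℝ)) := by
  have h1 := hv.aestronglyMeasurable_apply l
  have e : (volume.restrict (slab n I : Set (ℝ × Space n)))
      = (volume.restrict (I : Set ℝ)).prod (volume : Measure (Space n)) := by
    rw [← Measure.restrict_univ (μ := (volume : Measure (Space n))), Measure.prod_restrict]
    rfl
  rw [e] at h1
  have h2 : Continuous fun P : ℝ × Space n => scaled 0 k ρ (P.2 - x₀) := by
    simp only [scaled]; fun_prop
  exact (h2.aestronglyMeasurable.mul h1).integral_prod_right'

/-- Weak time derivative of local averages of the velocity. -/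
theorem WeakEuler.exists_abs_integral_deriv_mul_avg_le {Γ : Submodule ℤ (Space n)}
    [DiscreteTopology Γ] [IsZLattice ℝ Γ] {p : 𝓓'(slab n I, ℝ)} (hn : 0 < n)
    (hE : WeakEuler I v p) (hp0 : HasZeroMean Γ p) (hv : SpaceHolder I α v) (hα : 0 < α)
    (hα1 : α < 1) {ρ : Space n → ℝ} (hρ : IsTest Set.univ ρ) (l : Fin n) :
    ∃ C, 0 ≤ C ∧ ∀ (k : ℤ) (x₀ : Space n) (θ : ℝ → ℝ), IsTest (I : Set ℝ) θ →
      |∫ t, deriv θ t * avg v l ρ k x₀ t| ≤ C * (2 : ℝ) ^ ((1 - α) * k) * ∫ t, |θ t| := by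
  obtain ⟨C, hC, hp⟩ := hE.exists_abs_act_le hn hp0 hv hα hα1 hρ l
  obtain ⟨A, hA, hAb⟩ := hv.exists_mul_bound
  choose C' hC' h' using fun j => exists_abs_kint_holder_le (hρ.partialDeriv j)
    (integral_partialDeriv_eq_zero hρ j) hα hA
  refine ⟨C + ∑ j, C' j, add_nonneg hC (Finset.sum_nonneg fun j _ => hC' j), fun k x₀ θ hθ => ?_⟩
  set ψ : Space n → ℝ := fun x => scaled 0 k ρ (x - x₀) with hψdef
  have hψ : IsTest Set.univ ψ := isTest_scaled_sub hρ 0 k x₀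
  have hφ := hθ.tensor hψ
  have hm := hE.momentum l _ hφ
  have hd := fderiv_tensor hθ.differentiable hψ.differentiable
  simp only [(hd _).1, (hd _).2] at hm
  have hT : 0 ≤ ∫ t, |θ t| := integral_nonneg fun _ => abs_nonneg _
  have i0 := (hφ.fderiv_apply (timeDir n)).integrable_mul_of_locallyIntegrableOn
    (hv.locallyIntegrableOn l)
  simp only [(hd _).1] at i0
  have e0 : ∫ P : ℝ × Space n, deriv θ P.1 * ψ P.2 * v P l = ∫ t, deriv θ t * avg v l ρ k x₀ t := by
    rw [Measure.volume_eq_prod, integral_prod _ i0]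
    simp only [mul_assoc, integral_const_mul]
    rfl
  -- The flux v^j v^l is averaged against a mean-zero kernel of order 1, hence has size 2^((1-α)k),
  -- the same as the pressure contribution.
  have hj : ∀ j, |∫ P : ℝ × Space n, θ P.1 * partialDeriv j ψ P.2 * (v P j * v P l)|
      ≤ C' j * (2 : ℝ) ^ ((1 - α) * k) * ∫ t, |θ t| := by
    intro j
    have ij := (hφ.fderiv_apply (spaceDir j)).integrable_mul_of_locallyIntegrableOn
      (hv.locallyIntegrableOn_mul j l)
    simp only [(hd _).2] at ij
    rw [Measure.volume_eq_prod, integral_prod _ ij, ← Real.norm_eq_abs, ← integral_const_mul]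
    refine norm_integral_le_of_norm_le ((hθ.continuous.integrable_of_hasCompactSupport
      hθ.hasCompactSupport).abs.const_mul _) (ae_of_all _ fun t => ?_)
    simp only [mul_assoc, integral_const_mul]
    rw [Real.norm_eq_abs, abs_mul, mul_comm |θ t|, ← mul_assoc]
    by_cases ht : t ∈ I
    · refine mul_le_mul_of_nonneg_right ?_ (abs_nonneg _)
      have hc : Continuous fun x => v (t, x) j * v (t, x) l :=
        (hv.continuous hα ht j).mul (hv.continuous hα ht l)
      have := h' j 1 k (fun z => v (t, z + x₀) j * v (t, z + x₀) l) (hc.comp (by fun_prop))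
        fun z => by simpa using hAb t ht j l (z + x₀) (0 + x₀)
      rw [hψdef, partialDeriv_scaled_sub hρ.differentiable,
        kint_translate (0 + 1) k (partialDeriv j ρ) fun x => v (t, x) j * v (t, x) l]
      simpa using this
    · have : θ t = 0 := image_eq_zero_of_notMem_tsupport fun h => ht (hθ.tsupport_subset h)
      simp [this]
  have hs : |∑ j, ∫ P : ℝ × Space n, θ P.1 * partialDeriv j ψ P.2 * (v P j * v P l)|
      ≤ (∑ j, C' j) * (2 : ℝ) ^ ((1 - α) * k) * ∫ t, |θ t| := by
    rw [Finset.sum_mul, Finset.sum_mul]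
    exact (Finset.abs_sum_le_sum_abs _ _).trans (Finset.sum_le_sum fun j _ => hj j)
  have hpk := hp k x₀ θ hθ
  rw [e0] at hm
  have : ∫ t, deriv θ t * avg v l ρ k x₀ t
      = - (∑ j, ∫ P : ℝ × Space n, θ P.1 * partialDeriv j ψ P.2 * (v P j * v P l))
        - act p fun P => θ P.1 * partialDeriv l ψ P.2 := by linarith
  rw [this, add_mul, add_mul]
  refine (abs_sub _ _).trans ?_
  rw [abs_neg]
  linarith

/-- Smooth approximations of the indicator function of `[s, t]`. -/
theorem exists_step (b : ContDiffBump (0 : ℝ)) {s t : ℝ} (hst : s ≤ t) : ∃ θ : ℝ → ℝ,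
    ContDiff ℝ ∞ θ ∧ (∀ τ, τ ∉ Set.Icc (s - b.rOut) (t + b.rOut) → θ τ = 0) ∧
    (∀ τ, deriv θ τ = b.normed volume (τ - s) - b.normed volume (τ - t)) ∧ ∀ τ, |θ τ| ≤ 1 := by
  set k : ℝ → ℝ := b.normed volume with hk
  have hkc : Continuous k := b.continuous_normed
  have hk0 : ∀ x, 0 ≤ k x := b.nonneg_normed
  have hki : Integrable k := b.integrable_normed
  have hk1 : ∫ x, k x = 1 := b.integral_normed
  set R : ℝ → ℝ := fun x => ∫ y in (0 : ℝ)..x, k y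
  have hRd : ∀ x, HasDerivAt R (k x) x := fun x => hkc.integral_hasStrictDerivAt 0 x |>.hasDerivAt
  have hR : ContDiff ℝ ∞ R := by
    rw [contDiff_infty_iff_deriv]
    exact ⟨fun x => (hRd x).differentiableAt, by
      rw [show deriv R = k from funext fun x => (hRd x).deriv]
      exact b.contDiff_normed⟩
  have hθ : ∀ τ, R (τ - s) - R (τ - t) = ∫ y in (τ - t)..(τ - s), k y := fun τ =>
    intervalIntegral.integral_interval_sub_left (hki.intervalIntegrable) (hki.intervalIntegrable)
  refine ⟨fun τ => R (τ - s) - R (τ - t),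
    (hR.comp (contDiff_id.sub contDiff_const)).sub (hR.comp (contDiff_id.sub contDiff_const)),
    fun τ hτ => ?_, fun τ => ?_, fun τ => ?_⟩
  · simp only [hθ]
    rw [intervalIntegral.integral_of_le (by linarith)]
    refine setIntegral_eq_zero_of_forall_eq_zero fun y hy => ?_
    refine notMem_support.1 fun h => hτ ?_
    rw [b.support_normed_eq, Metric.mem_ball, dist_zero_right, Real.norm_eq_abs, abs_lt] at h
    exact ⟨by linarith [hy.2, h.1], by linarith [hy.1, h.2]⟩
  · have h1 : HasDerivAt (fun τ => R (τ - s)) (k (τ - s)) τ := (hRd _).comp_sub_const τ s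
    have h2 : HasDerivAt (fun τ => R (τ - t)) (k (τ - t)) τ := (hRd _).comp_sub_const τ t
    exact (h1.sub h2).deriv
  · simp only [hθ]
    rw [intervalIntegral.integral_of_le (by linarith), abs_of_nonneg
      (setIntegral_nonneg measurableSet_Ioc fun y _ => hk0 y), ← hk1]
    exact setIntegral_le_integral hki (ae_of_all _ hk0)

/-- A bounded function with bounded weak derivative is Lipschitz off a null set. -/
theorem exists_null_lipschitz (hI : (I : Set ℝ).OrdConnected) {f : ℝ → ℝ}
    (hf : AEStronglyMeasurable f (volume.restrict (I : Set ℝ))) {B M : ℝ} (hM0 : 0 ≤ M)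
    (hB : ∀ t ∈ I, |f t| ≤ B)
    (hM : ∀ θ : ℝ → ℝ, IsTest (I : Set ℝ) θ → |∫ t, deriv θ t * f t| ≤ M * ∫ t, |θ t|) :
    ∃ N : Set ℝ, volume N = 0 ∧ ∀ s ∈ I, s ∉ N → ∀ t ∈ I, t ∉ N → |f t - f s| ≤ M * |t - s| := by
  set g : ℝ → ℝ := (I : Set ℝ).indicator f with hgdef
  have hIm : MeasurableSet (I : Set ℝ) := I.isOpen.measurableSet
  have hg : LocallyIntegrable g := by
    intro x
    refine ⟨Metric.ball x 1, Metric.ball_mem_nhds x one_pos, ?_⟩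
    have : IsFiniteMeasure (volume.restrict (Metric.ball x 1)) :=
      ⟨by rw [Measure.restrict_apply_univ]; exact Metric.isBounded_ball.measure_lt_top⟩
    refine Integrable.of_bound ((aestronglyMeasurable_indicator_iff hIm).2 hf).restrict (max B 0)
      (ae_of_all _ fun t => ?_)
    by_cases ht : t ∈ (I : Set ℝ)
    · rw [hgdef, Set.indicator_of_mem ht]
      exact (hB t ht).trans (le_max_left _ _)
    · rw [hgdef, Set.indicator_of_notMem ht]
      simp
  let b : ℕ → ContDiffBump (0 : ℝ) := fun i =>
    ⟨((i : ℝ) + 1)⁻¹, 2 * ((i : ℝ) + 1)⁻¹, by positivity, by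
      have : (0 : ℝ) < ((i : ℝ) + 1)⁻¹ := by positivity
      linarith⟩
  have hr : Tendsto (fun i => (b i).rOut) atTop (𝓝 0) := by
    have : Tendsto (fun i : ℕ => ((i : ℝ) + 1)⁻¹) atTop (𝓝 0) := by
      simpa using tendsto_one_div_add_atTop_nhds_zero_nat (𝕜 := ℝ)
    simpa [b] using this.const_mul 2
  -- Mollifications of f extended by zero. They converge at almost every point, and the exceptional
  -- null set is where they do not.
  set c : ℕ → ℝ → ℝ := fun i s =>
    ((b i).normed volume ⋆[ContinuousLinearMap.lsmul ℝ ℝ, volume] g) s with hcdef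
  have hae : ∀ᵐ s, Tendsto (fun i => c i s) atTop (𝓝 (g s)) :=
    ContDiffBump.ae_convolution_tendsto_right_of_locallyIntegrable (φ := b) (l := atTop)
      (K := 2) hr (Eventually.of_forall fun i => le_rfl) hg (μ := volume)
  have hc : ∀ i s, c i s = ∫ τ, (b i).normed volume (τ - s) * g τ := fun i s => by
    simp only [hcdef, convolution_eq_swap, ContinuousLinearMap.lsmul_apply, smul_eq_mul]
    congr 1; ext τ
    rw [← (b i).normed_neg, neg_sub]
  have hint : ∀ i s, Integrable fun τ => (b i).normed volume (τ - s) * g τ := fun i s => by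
    have h1 : Continuous fun τ => (b i).normed volume (τ - s) :=
      (b i).continuous_normed.comp (continuous_id.sub continuous_const)
    have h2 : HasCompactSupport fun τ => (b i).normed volume (τ - s) :=
      (b i).hasCompactSupport_normed.comp_homeomorph (Homeomorph.subRight s)
    exact hg.integrable_smul_left_of_hasCompactSupport h1 h2
  refine ⟨{s | ¬ Tendsto (fun i => c i s) atTop (𝓝 (g s))}, hae, ?_⟩
  have main : ∀ s ∈ I, ∀ t ∈ I, s ≤ t → Tendsto (fun i => c i s) atTop (𝓝 (g s)) →
      Tendsto (fun i => c i t) atTop (𝓝 (g t)) → |f t - f s| ≤ M * |t - s| := by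
    intro s hs t ht hst h1 h2
    have hgs : g s = f s := Set.indicator_of_mem hs _
    have hgt : g t = f t := Set.indicator_of_mem ht _
    obtain ⟨ε₁, hε₁, hb₁⟩ := Metric.isOpen_iff.1 I.isOpen s hs
    obtain ⟨ε₂, hε₂, hb₂⟩ := Metric.isOpen_iff.1 I.isOpen t ht
    -- The difference of the two mollified values is the pairing of f with θ', where θ smooths the
    -- indicator of [s,t]; the hypothesis bounds it by M times the L¹ norm of θ.
    have hev : ∀ᶠ i in atTop, |c i s - c i t| ≤ M * (t - s + 2 * (b i).rOut) := by
      filter_upwards [hr.eventually (gt_mem_nhds hε₁), hr.eventually (gt_mem_nhds hε₂)] with i i1 i2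
      have hr0 := (b i).rOut_pos
      obtain ⟨θ, hθ, hθs, hθd, hθ1⟩ := exists_step (b i) hst
      set J := Set.Icc (s - (b i).rOut) (t + (b i).rOut) with hJ
      have hts : tsupport θ ⊆ J := closure_minimal (fun τ hτ => by
        by_contra h
        exact hτ (hθs τ h)) isClosed_Icc
      -- Both enlarged endpoints lie in I for small radius, and I is an interval.
      have hJI : J ⊆ (I : Set ℝ) := hI.out (hb₁ (by
        rw [Metric.mem_ball, Real.dist_eq, abs_lt]; constructor <;> linarith)) (hb₂ (by
        rw [Metric.mem_ball, Real.dist_eq, abs_lt]; constructor <;> linarith))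
      have hT : IsTest (I : Set ℝ) θ := ⟨hθ, HasCompactSupport.intro isCompact_Icc hθs,
        hts.trans hJI⟩
      have hnorm : ∫ τ, |θ τ| ≤ t - s + 2 * (b i).rOut := by
        calc ∫ τ, |θ τ| ≤ ∫ τ, J.indicator (fun _ => (1 : ℝ)) τ := by
              refine integral_mono_of_nonneg (ae_of_all _ fun _ => abs_nonneg _)
                ((integrable_indicator_iff measurableSet_Icc).2
                  (integrableOn_const isCompact_Icc.measure_lt_top.ne)) (ae_of_all _ fun τ => ?_)
              by_cases hτ : τ ∈ J
              · simpa [hτ] using hθ1 τ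
              · simp [hτ, hθs τ hτ]
          _ = _ := by
              rw [integral_indicator measurableSet_Icc, setIntegral_const, Measure.real,
                Real.volume_Icc, ENNReal.toReal_ofReal (by linarith)]
              simp; ring
      have e : c i s - c i t = ∫ τ, deriv θ τ * f τ := by
        rw [hc, hc, ← integral_sub (hint i s) (hint i t)]
        congr 1; ext τ
        rw [hθd]
        by_cases hτ : τ ∈ (I : Set ℝ)
        · rw [hgdef, Set.indicator_of_mem hτ]; ring
        · have h0 : deriv θ τ = 0 := by
            have : fderiv ℝ θ τ = 0 := fderiv_eq_zero_of_notMem_tsupport fun h => hτ (hJI (hts h))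
            rw [← fderiv_apply_one_eq_deriv, this]; simp
          rw [← hθd, h0, hgdef, Set.indicator_of_notMem hτ]; simp
      rw [e]
      exact (hM θ hT).trans (mul_le_mul_of_nonneg_left hnorm hM0)
    have l1 := (h1.sub h2).abs
    have l2 : Tendsto (fun i => M * (t - s + 2 * (b i).rOut)) atTop (𝓝 (M * (t - s + 2 * 0))) :=
      (((hr.const_mul 2).const_add (t - s))).const_mul M
    have := le_of_tendsto_of_tendsto l1 l2 hev
    rw [hgs, hgt, mul_zero, add_zero] at this
    rw [abs_sub_comm, abs_of_nonneg (by linarith : 0 ≤ t - s)]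
    exact this
  intro s hs hsN t ht htN
  simp only [Set.mem_ofPred_eq, not_not] at hsN htN
  rcases le_total s t with h | h
  · exact main s hs t ht h hsN htN
  · rw [abs_sub_comm, abs_sub_comm t s]
    exact main t ht s hs h htN hsN

end

/-! ### A representative of the velocity that is Hölder in space and time -/

section

variable {n : ℕ} {I : Opens ℝ} {α : ℝ} {v : ℝ × Space n → Space n}

/-- The velocity is Hölder continuous in time off a null set of times. -/
theorem WeakEuler.exists_null_holder {Γ : Submodule ℤ (Space n)}
    [DiscreteTopology Γ] [IsZLattice ℝ Γ] {p : 𝓓'(slab n I, ℝ)} (hn : 0 < n)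
    (hI : (I : Set ℝ).OrdConnected)
    (hE : WeakEuler I v p) (hp0 : HasZeroMean Γ p) (hv : SpaceHolder I α v) (hα : 0 < α)
    (hα1 : α < 1) : ∃ (N : Set ℝ) (C : ℝ), volume N = 0 ∧ 0 ≤ C ∧
      ∀ s ∈ I, s ∉ N → ∀ t ∈ I, t ∉ N → ∀ x l, |v (t, x) l - v (s, x) l| ≤ C * |t - s| ^ α := by
  obtain ⟨-, ρ, -, hρ, hρ1, -⟩ := exists_kernel hn
  choose C₁ hC₁ h₁ using fun l => hE.exists_abs_integral_deriv_mul_avg_le hn hp0 hv hα hα1 hρ l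
  obtain ⟨C₂, hC₂, h₂⟩ := hv.exists_abs_avg_sub_le hα hρ hρ1
  obtain ⟨B, hB⟩ := hv.exists_abs_avg_le ρ
  obtain ⟨A, hA, hvA⟩ := hv.bound
  -- One null set for each component, each scale and each point of a countable dense set, so that
  -- their union is null. All other points x follow by continuity in space.
  have hN : ∀ (l : Fin n) (k i : ℕ), ∃ N : Set ℝ, volume N = 0 ∧ ∀ s ∈ I, s ∉ N → ∀ t ∈ I, t ∉ N →
      |avg v l ρ k (denseSeq (Space n) i) t - avg v l ρ k (denseSeq (Space n) i) s|
        ≤ C₁ l * (2 : ℝ) ^ ((1 - α) * ((k : ℤ) : ℝ)) * |t - s| := fun l k i =>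
    exists_null_lipschitz hI (hv.aestronglyMeasurable_avg hρ.continuous l k _)
      (mul_nonneg (hC₁ l) (by positivity)) (hB l k _ ((isTest_scaled_sub hρ 0 k _).continuous.integrable_of_hasCompactSupport
        (isTest_scaled_sub hρ 0 k _).hasCompactSupport)) (h₁ l k _)
  choose N hN0 hN using hN
  refine ⟨⋃ l, ⋃ k, ⋃ i, N l k i, 2 * (∑ l, C₁ l) + 4 * C₂ + 2 * A, ?_, ?_, ?_⟩
  · simp only [measure_iUnion_null_iff]
    exact fun l k i => hN0 l k i
  · have : 0 ≤ ∑ l, C₁ l := Finset.sum_nonneg fun l _ => hC₁ l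
    positivity
  intro s hs hsN t ht htN x l
  simp only [Set.mem_iUnion, not_exists] at hsN htN
  have hclosed : IsClosed {x : Space n | |v (t, x) l - v (s, x) l|
      ≤ (2 * (∑ l, C₁ l) + 4 * C₂ + 2 * A) * |t - s| ^ α} :=
    isClosed_le ((hv.continuous hα ht l).sub (hv.continuous hα hs l)).abs continuous_const
  have hdense : ∀ i, denseSeq (Space n) i ∈ {x : Space n | |v (t, x) l - v (s, x) l|
      ≤ (2 * (∑ l, C₁ l) + 4 * C₂ + 2 * A) * |t - s| ^ α} := by
    intro i
    set x₀ := denseSeq (Space n) i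
    have hsum : C₁ l ≤ ∑ l, C₁ l :=
      Finset.single_le_sum (fun l _ => hC₁ l) (Finset.mem_univ l)
    have hsum0 := (hC₁ l).trans hsum
    change |v (t, x₀) l - v (s, x₀) l| ≤ _
    -- For |t-s| ≥ 1 boundedness of v suffices; this accounts for the term 2A in the constant.
    rcases le_total 1 |t - s| with h | h
    · have h3 : 1 ≤ |t - s| ^ α := Real.one_le_rpow h hα.le
      have h4 := (hvA t ht l).1 x₀
      have h5 := (hvA s hs l).1 x₀
      refine (abs_sub _ _).trans ?_
      nlinarith
    rcases eq_or_ne t s with rfl | hts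
    · simp; positivity
    have hd : 0 < |t - s| := abs_pos.2 (sub_ne_zero.2 hts)
    -- The scale 2^(-k-1) < |t-s| ≤ 2^(-k) balances the two errors: 2^((1-α)k)|t-s| for the motion
    -- of the average and 2^(-αk) for each mollification. Both are O(|t-s|^α).
    obtain ⟨k, hk1, hk2⟩ := exists_nat_pow_near_of_lt_one hd h
      (by norm_num : (0 : ℝ) < 2⁻¹) (by norm_num : (2 : ℝ)⁻¹ < 1)
    have e2 : ((2 : ℝ)⁻¹ ^ k) = (2 : ℝ) ^ (-(k : ℝ)) := by
      rw [inv_pow, Real.rpow_neg zero_le_two, Real.rpow_natCast]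
    have hk1'' : (2 : ℝ) ^ (-(k : ℝ)) ≤ 2 * |t - s| := by
      rw [pow_succ] at hk1
      rw [← e2]; linarith
    have a1 := hN l k i s hs (hsN l k i) t ht (htN l k i)
    have a2 := h₂ l k x₀ t ht
    have a3 := h₂ l k x₀ s hs
    simp only [Int.cast_natCast] at a1 a2 a3
    have b1 : (2 : ℝ) ^ (-α * (k : ℝ)) ≤ 2 * |t - s| ^ α := by
      have : (2 : ℝ) ^ (-α * (k : ℝ)) = ((2 : ℝ) ^ (-(k : ℝ))) ^ α := by
        rw [← Real.rpow_mul zero_le_two]; ring_nf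
      rw [this]
      calc _ ≤ (2 * |t - s|) ^ α := Real.rpow_le_rpow (by positivity) hk1'' hα.le
        _ = 2 ^ α * |t - s| ^ α := Real.mul_rpow zero_le_two hd.le
        _ ≤ 2 * |t - s| ^ α := by
          gcongr
          simpa using rpow_two_le hα1.le
    have b2 : (2 : ℝ) ^ ((1 - α) * (k : ℝ)) * |t - s| ≤ |t - s| ^ α := by
      have h6 : (2 : ℝ) ^ ((1 - α) * (k : ℝ)) ≤ |t - s| ^ (-(1 - α)) := by
        have : (2 : ℝ) ^ ((1 - α) * (k : ℝ)) = ((2 : ℝ) ^ (-(k : ℝ))) ^ (-(1 - α)) := by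
          rw [← Real.rpow_mul zero_le_two]; ring_nf
        rw [this]
        exact Real.rpow_le_rpow_of_nonpos hd (by rw [← e2]; exact hk2) (by linarith)
      calc _ ≤ |t - s| ^ (-(1 - α)) * |t - s| := by gcongr
        _ = |t - s| ^ α := by
          rw [← Real.rpow_add_one hd.ne']; ring_nf
    have a1' : |avg v l ρ k x₀ t - avg v l ρ k x₀ s| ≤ (∑ l, C₁ l) * |t - s| ^ α := by
      refine a1.trans ?_
      rw [mul_assoc]
      exact mul_le_mul hsum b2 (by positivity) hsum0
    have a2' : |avg v l ρ k x₀ t - v (t, x₀) l| ≤ C₂ * (2 * |t - s| ^ α) :=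
      a2.trans (mul_le_mul_of_nonneg_left b1 hC₂)
    have a3' : |avg v l ρ k x₀ s - v (s, x₀) l| ≤ C₂ * (2 * |t - s| ^ α) :=
      a3.trans (mul_le_mul_of_nonneg_left b1 hC₂)
    have h7 : 0 ≤ |t - s| ^ α := by positivity
    have h8 : 0 ≤ A * |t - s| ^ α := by positivity
    have h9 : 0 ≤ (∑ l, C₁ l) * |t - s| ^ α := by positivity
    rw [add_mul, add_mul]
    rw [abs_le] at a1' a2' a3' ⊢
    constructor <;> linarith
  have := hclosed.closure_subset_iff.2 (Set.range_subset_iff.2 hdense)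
  exact this ((denseRange_denseSeq (Space n)) x)

theorem holder_triangle {α : ℝ} (hα : 0 < α) (hα1 : α < 1) {X : Type*} [NormedAddCommGroup X]
    (P Q R : X) : ‖P - R‖ ^ α ≤ ‖P - Q‖ ^ α + ‖Q - R‖ ^ α := by
  refine (Real.rpow_le_rpow (norm_nonneg _) (norm_sub_le_norm_sub_add_norm_sub P Q R) hα.le).trans ?_
  exact Real.rpow_add_le_add_rpow (norm_nonneg _) (norm_nonneg _) hα.le hα1.le

/-- Extension of bounded Hölder functions. -/
theorem exists_holder_extension {X : Type*} [NormedAddCommGroup X] (hα : 0 < α) (hα1 : α < 1)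
    (S : Set X) (f : X → ℝ) {C : ℝ} (hC : 0 ≤ C) (hf : ∀ P ∈ S, |f P| ≤ C)
    (hfh : ∀ P ∈ S, ∀ Q ∈ S, |f P - f Q| ≤ C * ‖P - Q‖ ^ α) : ∃ F : X → ℝ, (∀ P ∈ S, F P = f P) ∧
      (∀ P, |F P| ≤ C) ∧ (∀ P Q, |F P - F Q| ≤ C * ‖P - Q‖ ^ α) ∧
      ∀ γ, (∀ P ∈ S, P + γ ∈ S ∧ f (P + γ) = f P) → (∀ P ∈ S, P - γ ∈ S ∧ f (P - γ) = f P) →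
        ∀ P, F (P + γ) = F P := by
  rcases S.eq_empty_or_nonempty with rfl | hS
  · exact ⟨fun _ => 0, by simp, by simpa using hC, fun P Q => by simp; positivity, by simp⟩
  have hne : Nonempty S := hS.to_subtype
  have hbdd : ∀ P : X, BddBelow (Set.range fun Q : S => f Q + C * ‖P - Q‖ ^ α) := fun P => by
    refine ⟨-C, ?_⟩
    rintro _ ⟨Q, rfl⟩
    have h1 := (abs_le.1 (hf Q Q.2)).1
    have h2 : 0 ≤ C * ‖P - Q‖ ^ α := by positivity
    simp only
    linarith
  -- McShane's extension formula. It preserves the Hölder constant because |·|^α is subadditive for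
  -- α < 1.
  set E : X → ℝ := fun P => ⨅ Q : S, (f Q + C * ‖P - Q‖ ^ α) with hE
  have hES : ∀ P ∈ S, E P = f P := fun P hP => by
    refine le_antisymm ?_ (le_ciInf fun Q => ?_)
    · refine (ciInf_le (hbdd P) ⟨P, hP⟩).trans (le_of_eq ?_)
      simp [Real.zero_rpow hα.ne']
    · have := (abs_le.1 (hfh P hP Q Q.2)).2
      linarith
  have hle : ∀ P Q, E P ≤ E Q + C * ‖P - Q‖ ^ α := fun P Q => by
    rw [← sub_le_iff_le_add]
    refine le_ciInf fun R => ?_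
    have h1 := ciInf_le (hbdd P) R
    have h2 := mul_le_mul_of_nonneg_left (holder_triangle hα hα1 P Q R) hC
    have h3 : E P ≤ f R + C * ‖P - R‖ ^ α := h1
    linarith
  have hEh : ∀ P Q, |E P - E Q| ≤ C * ‖P - Q‖ ^ α := fun P Q => by
    have h1 := hle P Q
    have h2 := hle Q P
    rw [norm_sub_rev] at h2
    rw [abs_le]; constructor <;> linarith
  -- Truncation at ±C restores the bound without increasing the Hölder constant.
  refine ⟨fun P => max (-C) (min C (E P)), fun P hP => ?_, fun P => ?_, fun P Q => ?_,
    fun γ h1 h2 P => ?_⟩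
  · have := abs_le.1 (hf P hP)
    simp only [hES P hP]
    rw [min_eq_right this.2, max_eq_right this.1]
  · exact abs_le.2 ⟨le_max_left _ _, max_le (by linarith) (min_le_left _ _)⟩
  · refine le_trans ?_ (hEh P Q)
    have h1 := abs_max_sub_max_le_max (-C) (min C (E P)) (-C) (min C (E Q))
    have h2 := abs_min_sub_min_le_max C (E P) C (E Q)
    rw [sub_self, abs_zero, max_eq_right (abs_nonneg (min C (E P) - min C (E Q)))] at h1
    rw [sub_self, abs_zero, max_eq_right (abs_nonneg (E P - E Q))] at h2
    exact h1.trans h2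
  · have : E (P + γ) = E P := by
      -- Translation by γ permutes S and preserves f, so it only reindexes the infimum.
      let e : S ≃ S := ⟨fun Q => ⟨Q + γ, (h1 Q Q.2).1⟩, fun Q => ⟨Q - γ, (h2 Q Q.2).1⟩,
        fun Q => by simp, fun Q => by simp⟩
      refine (e.iInf_congr fun Q => ?_).symm
      simp only [e, Equiv.coe_fn_mk, (h1 Q Q.2).2, add_sub_add_right_eq_sub]
    simp only [this]

/-- The velocity has a representative that is Hölder continuous in space and time. -/
theorem exists_holder_velocity {Γ : Submodule ℤ (Space n)}
    [DiscreteTopology Γ] [IsZLattice ℝ Γ] {p : 𝓓'(slab n I, ℝ)} (hn : 0 < n)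
    (hI : (I : Set ℝ).OrdConnected)
    (hE : WeakEuler I v p) (hp0 : HasZeroMean Γ p) (hv : MemCtCx I Γ α v) (hα : 0 < α)
    (hα1 : α < 1) : ∃ u : ℝ × Space n → Space n, (∀ l, BddHolder α fun P => u P l) ∧
      (∀ t x, ∀ γ ∈ Γ, u (t, x + γ) = u (t, x)) ∧
      ∀ᵐ P, P ∈ (slab n I : Set (ℝ × Space n)) → u P = v P := by
  obtain ⟨N, C₁, hN, hC₁, h⟩ := hE.exists_null_holder hn hI hp0 hv.spaceHolder hα hα1
  obtain ⟨C₂, hC₂, h₂⟩ := hv.spaceHolder.bound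
  -- The slab without the exceptional times. It is invariant under spatial translation, so the
  -- extension inherits the periodicity.
  set S : Set (ℝ × Space n) := {P | P.1 ∈ I ∧ P.1 ∉ N}
  have hS : ∀ l, ∀ P ∈ S, ∀ Q ∈ S, |v P l - v Q l| ≤ (C₁ + C₂) * ‖P - Q‖ ^ α := by
    rintro l ⟨t, x⟩ ⟨ht, htN⟩ ⟨s, y⟩ ⟨hs, hsN⟩
    have h1 := h s hs hsN t ht htN x l
    have h3 := (h₂ s hs l).2 x y
    have e1 : |t - s| ^ α ≤ ‖(t, x) - (s, y)‖ ^ α :=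
      Real.rpow_le_rpow (abs_nonneg _) (norm_fst_le ((t, x) - (s, y))) hα.le
    have e2 : ‖x - y‖ ^ α ≤ ‖(t, x) - (s, y)‖ ^ α :=
      Real.rpow_le_rpow (norm_nonneg _) (norm_snd_le ((t, x) - (s, y))) hα.le
    calc |v (t, x) l - v (s, y) l| ≤ |v (t, x) l - v (s, x) l| + |v (s, x) l - v (s, y) l| :=
          abs_sub_le _ _ _
      _ ≤ C₁ * ‖(t, x) - (s, y)‖ ^ α + C₂ * ‖(t, x) - (s, y)‖ ^ α :=
          add_le_add (h1.trans (mul_le_mul_of_nonneg_left e1 hC₁))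
            (h3.trans (mul_le_mul_of_nonneg_left e2 hC₂))
      _ = _ := by ring
  choose F hF1 hF2 hF3 hF4 using fun l : Fin n => exists_holder_extension hα hα1 S (fun P => v P l)
    (add_nonneg hC₁ hC₂) (fun P hP => ((h₂ P.1 hP.1 l).1 P.2).trans (by linarith)) (hS l)
  refine ⟨fun P => WithLp.toLp 2 fun l => F l P, fun l => ⟨C₁ + C₂, fun P => hF2 l P,
    fun P Q => hF3 l P Q⟩, fun t x γ hγ => ?_, ?_⟩
  · ext l
    have := hF4 l (0, γ) (fun P hP => ⟨by simpa [S] using hP, ?_⟩)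
      (fun P hP => ⟨by simpa [S] using hP, ?_⟩) (t, x)
    · simpa using this
    · have := hv.periodic P.1 hP.1 P.2 γ hγ
      change v (P.1 + 0, P.2 + γ) l = v P l
      rw [add_zero, this]
    · have := hv.periodic P.1 hP.1 (P.2 - γ) γ hγ
      rw [sub_add_cancel] at this
      change v (P.1 - 0, P.2 - γ) l = v P l
      rw [sub_zero, ← this]
  · have hnull : volume (N ×ˢ (Set.univ : Set (Space n))) = 0 := by
      rw [Measure.volume_eq_prod, Measure.prod_prod, hN, zero_mul]
    filter_upwards [measure_eq_zero_iff_ae_notMem.1 hnull] with P hP hPI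
    ext l
    exact hF1 l P ⟨hPI.1, fun h => hP ⟨h, trivial⟩⟩

end

/-! ### Two-point functions and transport of singular integrals -/

section

/-- In Hölder terms, the product of the three increments in the commutator is of order c₁ + c₂ + r,
and the product rule asks that this exceed 1. -/
theorem HasDiv.mul_of_holder {X : Type*} [NormedAddCommGroup X] [NormedSpace ℝ X]
    [MeasurableSpace X] [BorelSpace X] [FiniteDimensional ℝ X] {μ : Measure X} [μ.IsAddHaarMeasure]
    {U : Set X} {W : X → X} {a A b B : X → ℝ} (hU : IsOpen U)
    (hW : HasDiv μ U W (fun _ => 1) fun _ => 0)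
    (ha : HasDiv μ U W a A) (hb : HasDiv μ U W b B) (hAc : Continuous A) (hBc : Continuous B)
    {r c₁ c₂ : ℝ} (hr : 0 < r) (hWr : ∃ C, ∀ x y, ‖W x - W y‖ ≤ C * ‖x - y‖ ^ r)
    (hc₁ : 0 < c₁) (hc₂ : 0 < c₂) (har : BddHolder c₁ a) (hbr : BddHolder c₂ b)
    (hsum : 1 < c₁ + c₂ + r) :
    HasDiv μ U W (fun x => a x * b x) fun x => A x * b x + a x * B x := by
  have hac := har.continuous hc₁
  have hbc := hbr.continuous hc₂
  obtain ⟨C, hC⟩ := hWr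
  obtain ⟨C₁, h1, h1'⟩ := har
  obtain ⟨C₂, h2, h2'⟩ := hbr
  have hC₁ : 0 ≤ C₁ := (abs_nonneg _).trans (h1 0)
  have hC₂ : 0 ≤ C₂ := (abs_nonneg _).trans (h2 0)
  have hWc : Continuous W := by
    rw [continuous_iff_continuousAt]
    intro P
    rw [ContinuousAt, tendsto_iff_norm_sub_tendsto_zero]
    refine squeeze_zero (fun _ => norm_nonneg _) (fun Q => hC Q P) ?_
    have : Continuous fun Q : X => C * ‖Q - P‖ ^ r :=
      continuous_const.mul ((continuous_id.sub continuous_const).norm.rpow_const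
        fun _ => Or.inr hr.le)
    simpa [Real.zero_rpow hr.ne'] using this.tendsto P
  refine HasDiv.mul hU hW ha hb hWc hac hbc hAc hBc hsum (C := C₁ * C₂ * C) fun x y => ?_
  have p := norm_nonneg (x - y)
  rw [Real.rpow_add_of_nonneg p (by positivity) hr.le, Real.rpow_add_of_nonneg p hc₁.le hc₂.le]
  have k1 := mul_le_mul (h1' x y) (h2' x y) (abs_nonneg _) (by positivity)
  have k2 := mul_le_mul k1 (hC x y) (norm_nonneg _) (by positivity)
  linarith

variable {n : ℕ} {I : Opens ℝ} {v : ℝ × Space n → Space n} {Γ : Submodule ℤ (Space n)}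

theorem norm_le_sum_abs (x : Space n) : ‖x‖ ≤ ∑ i, |x i| := by
  conv_lhs => rw [← (EuclideanSpace.basisFun (Fin n) ℝ).sum_repr x]
  refine (norm_sum_le _ _).trans (Finset.sum_le_sum fun i _ => ?_)
  rw [norm_smul, OrthonormalBasis.norm_eq_one, mul_one]
  simp

/-- Functions on `ℝ × ℝⁿ` that are periodic in the space variable. -/
def IsPer {F : Type*} (Γ : Submodule ℤ (Space n)) (f : ℝ × Space n → F) : Prop :=
  ∀ t x, ∀ γ ∈ Γ, f (t, x + γ) = f (t, x)

/-- Divergence free periodic Hölder continuous velocity fields. -/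
structure HolderField (I : Opens ℝ) (Γ : Submodule ℤ (Space n)) (α : ℝ)
    (v : ℝ × Space n → Space n) : Prop where
  pos : 0 < α
  holder : ∀ l, BddHolder α fun P => v P l
  periodic : IsPer Γ v
  hasDiv_one : HasDiv volume (slab n I : Set (ℝ × Space n)) (spaceTimeField v)
    (fun _ => 1) fun _ => 0

namespace HolderField

variable {α : ℝ}

theorem continuous_apply (hv : HolderField I Γ α v) (l : Fin n) : Continuous fun P => v P l :=
  (hv.holder l).continuous hv.pos

theorem continuous (hv : HolderField I Γ α v) : Continuous v := by
  have : Continuous fun P => (WithLp.toLp 2 fun l => v P l : Space n) :=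
    (PiLp.continuous_toLp 2 _).comp (continuous_pi hv.continuous_apply)
  exact this

theorem isPer_apply (hv : HolderField I Γ α v) (l : Fin n) : IsPer Γ fun P => v P l :=
  fun t x γ hγ => by simp only [hv.periodic t x γ hγ]

theorem exists_norm_sub_le (hv : HolderField I Γ α v) :
    ∃ C, 0 ≤ C ∧ ∀ P Q, ‖v P - v Q‖ ≤ C * ‖P - Q‖ ^ α ∧ ‖v P - v Q‖ ≤ C := by
  choose C h1 h2 using hv.holder
  have hC : ∀ l, 0 ≤ C l := fun l => (abs_nonneg _).trans (h1 l 0)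
  have hS : 0 ≤ ∑ l, C l := Finset.sum_nonneg fun l _ => hC l
  refine ⟨2 * ∑ l, C l, by positivity, fun P Q => ⟨?_, ?_⟩⟩
  · refine (norm_le_sum_abs _).trans ((Finset.sum_le_sum fun l _ => h2 l P Q).trans ?_)
    rw [← Finset.sum_mul]
    gcongr
    linarith
  · refine (norm_le_sum_abs _).trans ?_
    rw [Finset.mul_sum]
    refine Finset.sum_le_sum fun l _ => (abs_sub (v P l) (v Q l)).trans ?_
    linarith [h1 l P, h1 l Q]

theorem spaceTimeField_holder (hv : HolderField I Γ α v) :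
    ∃ C, ∀ P Q, ‖spaceTimeField v P - spaceTimeField v Q‖ ≤ C * ‖P - Q‖ ^ α := by
  obtain ⟨C, -, hC⟩ := hv.exists_norm_sub_le
  refine ⟨C, fun P Q => ?_⟩
  have : spaceTimeField v P - spaceTimeField v Q = (0, v P - v Q) := by simp [spaceTimeField]
  rw [this, Prod.norm_def]
  simpa using (hC P Q).1

theorem pairField_holder (hv : HolderField I Γ α v) :
    ∃ C, ∀ P Q, ‖pairField v P - pairField v Q‖ ≤ C * ‖P - Q‖ ^ α := by
  obtain ⟨C, hC0, hC⟩ := hv.exists_norm_sub_le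
  refine ⟨C, fun P Q => ?_⟩
  have : pairField v P - pairField v Q
      = (0, (v (P.1, P.2.1) - v (Q.1, Q.2.1), v (P.1, P.2.2) - v (Q.1, Q.2.2))) := by
    simp [pairField]
  rw [this, Prod.norm_def, Prod.norm_def]
  have h0 : 0 ≤ C * ‖P - Q‖ ^ α := by positivity
  have k1 : ‖(P.1, P.2.1) - (Q.1, Q.2.1)‖ ≤ ‖P - Q‖ := by
    simp only [Prod.norm_def, Prod.fst_sub, Prod.snd_sub]
    exact max_le_max le_rfl (le_max_left _ _)
  have k2 : ‖(P.1, P.2.2) - (Q.1, Q.2.2)‖ ≤ ‖P - Q‖ := by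
    simp only [Prod.norm_def, Prod.fst_sub, Prod.snd_sub]
    exact max_le_max le_rfl (le_max_right _ _)
  have p := hv.pos.le
  refine max_le (by simpa using h0) (max_le ((hC _ _).1.trans ?_) ((hC _ _).1.trans ?_)) <;>
    gcongr

end HolderField

/-- The domain of functions of a time in `I` and two points. -/
abbrev pairSlab (n : ℕ) (I : Opens ℝ) : Set (ℝ × (Space n × Space n)) :=
  (I : Set ℝ) ×ˢ (Set.univ : Set (Space n × Space n))

/-- The difference `f(t, y) - f(t, x)`. -/
def dif (f : ℝ × Space n → ℝ) (Q : ℝ × (Space n × Space n)) : ℝ :=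
  f (Q.1, Q.2.2) - f (Q.1, Q.2.1)

/-- The singular integral with kernel `∑ 2^{(n+s)q} L(2^q z)`. -/
noncomputable def sing (s : ℤ) (L : Space n → ℝ) (F : ℝ × (Space n × Space n) → ℝ)
    (P : ℝ × Space n) : ℝ := ∑' q, kint s q L (atIncr F P)

theorem BddHolder.dif {a : ℝ} (ha : 0 ≤ a) {f : ℝ × Space n → ℝ} (hf : BddHolder a f) :
    BddHolder a (dif f) := by
  obtain ⟨C, h1, h2⟩ := hf
  have hC : 0 ≤ C := (abs_nonneg _).trans (h1 0)
  refine ⟨2 * C, fun Q => ?_, fun P Q => ?_⟩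
  · refine (abs_sub _ _).trans ?_
    linarith [h1 (Q.1, Q.2.1), h1 (Q.1, Q.2.2)]
  · have k1 : ‖(P.1, P.2.1) - (Q.1, Q.2.1)‖ ^ a ≤ ‖P - Q‖ ^ a := by
      gcongr
      simp only [Prod.norm_def, Prod.fst_sub, Prod.snd_sub]
      exact max_le_max le_rfl (le_max_left _ _)
    have k2 : ‖(P.1, P.2.2) - (Q.1, Q.2.2)‖ ^ a ≤ ‖P - Q‖ ^ a := by
      gcongr
      simp only [Prod.norm_def, Prod.fst_sub, Prod.snd_sub]
      exact max_le_max le_rfl (le_max_right _ _)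
    have := (h2 (P.1, P.2.1) (Q.1, Q.2.1)).trans (mul_le_mul_of_nonneg_left k1 hC)
    have := (h2 (P.1, P.2.2) (Q.1, Q.2.2)).trans (mul_le_mul_of_nonneg_left k2 hC)
    have e : EulerPressure.dif f P - EulerPressure.dif f Q
      = (f (P.1, P.2.2) - f (Q.1, Q.2.2)) - (f (P.1, P.2.1) - f (Q.1, Q.2.1)) := by
      simp only [EulerPressure.dif]; ring
    rw [e]
    refine (abs_sub _ _).trans ?_
    linarith

/-- Periodic functions of two points that vanish to order `a` on the diagonal, with
regularity `β`. -/
structure PairFun (Γ : Submodule ℤ (Space n)) (β a : ℝ) (F : ℝ × (Space n × Space n) → ℝ) :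
    Prop where
  continuous : Continuous F
  inc : Inc β a (atIncr F)
  periodic : ∀ t x y, ∀ γ ∈ Γ, F (t, (x + γ, y + γ)) = F (t, (x, y))

namespace PairFun

variable {β a b : ℝ} {F E : ℝ × (Space n × Space n) → ℝ}

theorem dif (hβ : 0 ≤ β) (hβa : β ≤ a) (ha : 0 < a) {f : ℝ × Space n → ℝ} (hf : BddHolder a f)
    (hp : IsPer Γ f) : PairFun Γ β a (dif f) where
  continuous := (hf.dif ha.le).continuous ha
  inc := Inc.incr hβ hβa hf
  periodic := fun t x y γ hγ => by simp only [EulerPressure.dif, hp t _ γ hγ]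

theorem mul (hF : PairFun Γ β a F) (hE : PairFun Γ β b E) (ha : 0 < a) (hb : 0 < b)
    (hβa : β ≤ a) (hβb : β ≤ b) : PairFun Γ β (a + b) fun Q => F Q * E Q where
  continuous := hF.continuous.mul hE.continuous
  inc := hF.inc.mul hβa ha hb hβb hE.inc
  periodic := fun t x y γ hγ => by rw [hF.periodic t x y γ hγ, hE.periodic t x y γ hγ]

theorem add (hF : PairFun Γ β a F) (hE : PairFun Γ β a E) :
    PairFun Γ β a fun Q => F Q + E Q where
  continuous := hF.continuous.add hE.continuous
  inc := hF.inc.add hE.inc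
  periodic := fun t x y γ hγ => by rw [hF.periodic t x y γ hγ, hE.periodic t x y γ hγ]

theorem sumHolder (hF : PairFun Γ β a F) {L : Space n → ℝ} (hL : IsTest Set.univ L)
    (hβ : 0 ≤ β) {s : ℤ} (hs : 0 < s) (ha : s < a - β) :
    SumHolder β fun q P => kint s q L (atIncr F P) :=
  hF.inc.sumHolder (fun P => (continuous_atIncr hF.continuous).comp (.prodMk_right P)) hL hβ hs ha

theorem bddHolder_sing (hF : PairFun Γ β a F) {L : Space n → ℝ} (hL : IsTest Set.univ L)
    (hβ : 0 ≤ β) {s : ℤ} (hs : 0 < s) (ha : s < a - β) : BddHolder β (sing s L F) :=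
  (hF.sumHolder hL hβ hs ha).bddHolder_tsum

theorem isPer_sing (hF : PairFun Γ β a F) (s : ℤ) (L : Space n → ℝ) : IsPer Γ (sing s L F) := by
  intro t x γ hγ
  simp only [sing]
  congr 1; ext q
  congr 1; ext z
  simp only [atIncr]
  rw [show x + γ + z = x + z + γ by abel, hF.periodic t x _ γ hγ]

end PairFun

namespace HolderField

variable {α : ℝ}

theorem pair_one (hv : HolderField I Γ α v) :
    HasDiv volume (pairSlab n I) (pairField v) (fun _ => 1) fun _ => 0 :=
  HasDiv.pair_fst hv.continuous hv.hasDiv_one (f := fun _ => 1) (A := fun _ => 0)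
    continuous_const continuous_const hv.hasDiv_one

instance : (volume : Measure (Space n × Space n)).IsAddHaarMeasure :=
  Measure.prod.instIsAddHaarMeasure (volume : Measure (Space n)) (volume : Measure (Space n))

instance : (volume : Measure (ℝ × Space n)).IsAddHaarMeasure :=
  Measure.prod.instIsAddHaarMeasure (volume : Measure ℝ) (volume : Measure (Space n))

instance : (volume : Measure (ℝ × (Space n × Space n))).IsAddHaarMeasure :=
  Measure.prod.instIsAddHaarMeasure (volume : Measure ℝ) (volume : Measure (Space n × Space n))

theorem isOpen_pairSlab : IsOpen (pairSlab n I) := I.isOpen.prod isOpen_univ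

theorem pair_dif (hv : HolderField I Γ α v) {f A : ℝ × Space n → ℝ} (hf : Continuous f)
    (hA : Continuous A)
    (h : HasDiv volume (slab n I : Set (ℝ × Space n)) (spaceTimeField v) f A) :
    HasDiv volume (pairSlab n I) (pairField v) (dif f) (dif A) :=
  (HasDiv.pair_snd hv.continuous hv.hasDiv_one hf hA h).sub
    (HasDiv.pair_fst hv.continuous hv.hasDiv_one hf hA h) (continuous_pairField hv.continuous)
    (by fun_prop) (by fun_prop) (by fun_prop) (by fun_prop)

theorem pair_mul (hv : HolderField I Γ α v) {F F' E E' : ℝ × (Space n × Space n) → ℝ}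
    (hF : HasDiv volume (pairSlab n I) (pairField v) F F')
    (hE : HasDiv volume (pairSlab n I) (pairField v) E E')
    (hF' : Continuous F') (hE' : Continuous E') {c₁ c₂ : ℝ} (hc₁ : 0 < c₁) (hc₂ : 0 < c₂)
    (hFr : BddHolder c₁ F) (hEr : BddHolder c₂ E) (hc : 1 < c₁ + c₂ + α) :
    HasDiv volume (pairSlab n I) (pairField v) (fun Q => F Q * E Q)
      fun Q => F' Q * E Q + F Q * E' Q :=
  HasDiv.mul_of_holder isOpen_pairSlab hv.pair_one hF hE hF' hE' hv.pos hv.pairField_holder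
    hc₁ hc₂ hFr hEr hc

theorem pairFun_dif (hv : HolderField I Γ α v) {β : ℝ} (hβ : 0 ≤ β) (hβα : β ≤ α) (k : Fin n) :
    PairFun Γ β α (dif fun P => v P k) :=
  .dif hβ hβα hv.pos (hv.holder k) (hv.isPer_apply k)

/-- The two kinds of terms: a kernel of order s against F', and a kernel of order s + 1 against δv
F, which vanishes to order α + a. -/
theorem bddHolder_sing_deriv (hv : HolderField I Γ α v) {β a a' : ℝ}
    {F F' : ℝ × (Space n × Space n) → ℝ} (hF : PairFun Γ β a F) (hF' : PairFun Γ β a' F')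
    {L : Space n → ℝ} (hL : IsTest Set.univ L) {s : ℤ} (hβ : 0 ≤ β) (hβα : β ≤ α) (hs : 0 < s)
    (ha : s < a - β) (ha' : s < a' - β) (hs1 : s + 1 < α + a - β) :
    BddHolder β fun P => sing s L F' P + ∑ k, sing (s + 1) (partialDeriv k L)
        (fun Q => dif (fun P => v P k) Q * F Q) P := by
  have hs' : (0 : ℝ) < s := by exact_mod_cast hs
  exact (hF'.bddHolder_sing hL hβ hs ha').add (BddHolder.sum _ fun k _ =>
    ((hv.pairFun_dif hβ hβα k).mul hF hv.pos (by linarith) hβα (by linarith)).bddHolder_sing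
      (hL.partialDeriv k) hβ (by omega) (by push_cast; linarith))

/-- Transport of a singular integral. -/
theorem hasDiv_sing (hv : HolderField I Γ α v) {β a a' : ℝ}
    {F F' : ℝ × (Space n × Space n) → ℝ} (hF : PairFun Γ β a F) (hF' : PairFun Γ β a' F')
    (h : HasDiv volume (pairSlab n I) (pairField v) F F') {L : Space n → ℝ}
    (hL : IsTest Set.univ L) {s : ℤ} (hβ : 0 ≤ β) (hβα : β ≤ α) (hs : 0 < s)
    (ha : s < a - β) (ha' : s < a' - β) (hs1 : s + 1 < α + a - β) :
    HasDiv volume (slab n I : Set (ℝ × Space n)) (spaceTimeField v) (sing s L F)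
      fun P => sing s L F' P + ∑ k, sing (s + 1) (partialDeriv k L)
        (fun Q => dif (fun P => v P k) Q * F Q) P := by
  have hs' : (0 : ℝ) < s := by exact_mod_cast hs
  have k1 := hF.sumHolder hL hβ hs ha
  have k2 := hF'.sumHolder hL hβ hs ha'
  have k3 : ∀ k, SumHolder β fun q P => kint (s + 1) q (partialDeriv k L)
      (atIncr (fun Q => dif (fun P => v P k) Q * F Q) P) := fun k =>
    ((hv.pairFun_dif hβ hβα k).mul hF hv.pos (by linarith) hβα (by linarith)).sumHolder
      (hL.partialDeriv k) hβ (by omega) (by push_cast; linarith)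
  have k4 := SumHolder.sum Finset.univ fun k _ => k3 k
  have key := HasDiv.tsum_kint hv.continuous hF.continuous hF'.continuous h hL k1 (k2.add k4)
  refine Eq.mp (congrArg _ (funext fun P => ?_)) key
  have e := (k2.summable P).tsum_add (k4.summable P)
  refine e.trans ?_
  rw [Summable.tsum_finsetSum fun k _ => (k3 k).summable P]
  rfl

end HolderField

end

/-! ### First and second material derivatives of the quadratic singular integral -/

section

variable {n : ℕ} {I : Opens ℝ} {v : ℝ × Space n → Space n} {Γ : Submodule ℤ (Space n)}
  {α β b : ℝ} {v' v'' : Fin n → ℝ × Space n → ℝ} {K : Fin n → Fin n → Space n → ℝ}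

theorem PairFun.congr {a a' : ℝ} {F : ℝ × (Space n × Space n) → ℝ} (h : PairFun Γ β a F)
    (e : a = a') : PairFun Γ β a' F := e ▸ h

theorem IsPer.sum {ι : Type*} (s : Finset ι) {f : ι → ℝ × Space n → ℝ}
    (h : ∀ i ∈ s, IsPer Γ (f i)) : IsPer Γ fun P => ∑ i ∈ s, f i P :=
  fun t x γ hγ => Finset.sum_congr rfl fun i hi => h i hi t x γ hγ

theorem IsPer.add {f g : ℝ × Space n → ℝ} (hf : IsPer Γ f) (hg : IsPer Γ g) :
    IsPer Γ fun P => f P + g P := fun t x γ hγ => by simp only [hf t x γ hγ, hg t x γ hγ]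

theorem IsPer.mul {f g : ℝ × Space n → ℝ} (hf : IsPer Γ f) (hg : IsPer Γ g) :
    IsPer Γ fun P => f P * g P := fun t x γ hγ => by simp only [hf t x γ hγ, hg t x γ hγ]

theorem IsPer.neg {f : ℝ × Space n → ℝ} (hf : IsPer Γ f) :
    IsPer Γ fun P => - f P := fun t x γ hγ => by simp only [hf t x γ hγ]

/-- The difference of the `k`-th component of the velocity. -/
abbrev difv (v : ℝ × Space n → Space n) (k : Fin n) : ℝ × (Space n × Space n) → ℝ :=
  dif fun P => v P k

/-- The derivative of a product of two differences. -/
def quadPair (v : ℝ × Space n → Space n) (v' : Fin n → ℝ × Space n → ℝ) (j i : Fin n)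
    (Q : ℝ × (Space n × Space n)) : ℝ := dif (v' j) Q * difv v i Q + difv v j Q * dif (v' i) Q

/-- The quadratic singular integral. -/
noncomputable def quadSing (v : ℝ × Space n → Space n) (K : Fin n → Fin n → Space n → ℝ)
    (P : ℝ × Space n) : ℝ :=
  ∑ j, ∑ i, sing 1 (K j i) (fun Q => difv v j Q * difv v i Q) P

/-- The material derivative of `quadSing`. -/
noncomputable def quadDeriv (v : ℝ × Space n → Space n) (v' : Fin n → ℝ × Space n → ℝ)
    (K : Fin n → Fin n → Space n → ℝ) (P : ℝ × Space n) : ℝ :=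
  ∑ j, ∑ i, (sing 1 (K j i) (quadPair v v' j i) P
    + ∑ k, sing (1 + 1) (partialDeriv k (K j i))
      (fun Q => difv v k Q * (difv v j Q * difv v i Q)) P)

/-- The second material derivative of `quadSing`. -/
noncomputable def quadDerivTwo (v : ℝ × Space n → Space n) (v' v'' : Fin n → ℝ × Space n → ℝ)
    (K : Fin n → Fin n → Space n → ℝ) (P : ℝ × Space n) : ℝ :=
  ∑ j, ∑ i, ((sing 1 (K j i) (fun Q =>
        (dif (v'' j) Q * difv v i Q + dif (v' j) Q * dif (v' i) Q)
          + (dif (v' j) Q * dif (v' i) Q + difv v j Q * dif (v'' i) Q)) P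
      + ∑ k, sing (1 + 1) (partialDeriv k (K j i)) (fun Q => difv v k Q * quadPair v v' j i Q) P)
    + ∑ k, (sing (1 + 1) (partialDeriv k (K j i)) (fun Q =>
          dif (v' k) Q * (difv v j Q * difv v i Q) + difv v k Q * quadPair v v' j i Q) P
      + ∑ k', sing (1 + 1 + 1) (partialDeriv k' (partialDeriv k (K j i)))
          (fun Q => difv v k' Q * (difv v k Q * (difv v j Q * difv v i Q))) P))

namespace HolderField

theorem pairFun_two (hv : HolderField I Γ α v) (hβ : 0 ≤ β) (hβα : β ≤ α) (j i : Fin n) :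
    PairFun Γ β (2 * α) fun Q => difv v j Q * difv v i Q :=
  ((hv.pairFun_dif hβ hβα j).mul (hv.pairFun_dif hβ hβα i) hv.pos hv.pos hβα hβα).congr (by ring)

theorem pairFun_dif_mul (hv : HolderField I Γ α v) (hβ : 0 ≤ β) (hβα : β ≤ α) (k : Fin n) {a a' : ℝ}
    (ha : 0 < a) (hβa : β ≤ a) {F : ℝ × (Space n × Space n) → ℝ} (hF : PairFun Γ β a F)
    (e : a + α = a') : PairFun Γ β a' fun Q => difv v k Q * F Q :=
  ((hv.pairFun_dif hβ hβα k).mul hF hv.pos ha hβα hβa).congr (by linarith)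

theorem bddHolder_quadSing (hv : HolderField I Γ α v) (hK : ∀ j i, IsTest Set.univ (K j i))
    (hβ : 0 ≤ β) (hβα : β ≤ α) (h : β < 2 * α - 1) : BddHolder β (quadSing v K) :=
  BddHolder.sum _ fun j _ => BddHolder.sum _ fun i _ =>
    (hv.pairFun_two hβ hβα j i).bddHolder_sing (hK j i) hβ one_pos (by push_cast; linarith)

theorem isPer_quadSing (hv : HolderField I Γ α v) (K : Fin n → Fin n → Space n → ℝ) :
    IsPer Γ (quadSing v K) :=
  IsPer.sum _ fun j _ => IsPer.sum _ fun i _ =>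
    (hv.pairFun_two le_rfl hv.pos.le j i).isPer_sing 1 _

section Deriv

variable (hv : HolderField I Γ α v) (hb : 0 < b) (hv'b : ∀ l, BddHolder b (v' l))
  (hv'p : ∀ l, IsPer Γ (v' l))
  (hv' : ∀ l, HasDiv volume (slab n I : Set (ℝ × Space n)) (spaceTimeField v) (fun P => v P l)
    (v' l))
include hv hb hv'b hv'p

theorem pairFun_quadPair (hβ : 0 ≤ β) (hβα : β ≤ α) (hβb : β ≤ b) (j i : Fin n) :
    PairFun Γ β (b + α) (quadPair v v' j i) :=
  ((PairFun.dif hβ hβb hb (hv'b j) (hv'p j)).mul (hv.pairFun_dif hβ hβα i) hb hv.pos hβb hβα).add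
    (((hv.pairFun_dif hβ hβα j).mul (PairFun.dif hβ hβb hb (hv'b i) (hv'p i)) hv.pos hb hβα
      hβb).congr (add_comm _ _))

/-- Order 1 meets a product vanishing to order b + α, order 2 meets three increments of total order
3α; each difference must exceed the kernel order by more than β. -/
theorem bddHolder_quadDeriv (hK : ∀ j i, IsTest Set.univ (K j i)) (hβ : 0 ≤ β) (hβα : β ≤ α)
    (hβb : β ≤ b) (h1 : β + 1 < b + α) (h2 : β + 2 < 3 * α) : BddHolder β (quadDeriv v v' K) :=
  BddHolder.sum _ fun j _ => BddHolder.sum _ fun i _ =>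
    hv.bddHolder_sing_deriv (hv.pairFun_two hβ hβα j i)
      (hv.pairFun_quadPair hb hv'b hv'p hβ hβα hβb j i) (hK j i) hβ hβα one_pos
      (by push_cast; linarith) (by push_cast; linarith) (by push_cast; linarith)

theorem isPer_quadDeriv (K : Fin n → Fin n → Space n → ℝ) : IsPer Γ (quadDeriv v v' K) :=
  have p := hv.pos
  IsPer.sum _ fun j _ => IsPer.sum _ fun i _ =>
    ((hv.pairFun_quadPair hb hv'b hv'p le_rfl p.le hb.le j i).isPer_sing _ _).add
    (IsPer.sum _ fun k _ =>
      (hv.pairFun_dif_mul le_rfl p.le k (by linarith) (by linarith)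
        (hv.pairFun_two le_rfl p.le j i) rfl).isPer_sing _ _)

include hv'

/-- Product rule for two α-Hölder increments along an α-Hölder field, whence the threshold 3α > 1.
-/
theorem pair_two (h : 1 < 3 * α) (j i : Fin n) :
    HasDiv volume (pairSlab n I) (pairField v) (fun Q => difv v j Q * difv v i Q)
      (quadPair v v' j i) := by
  have c : ∀ l, Continuous (v' l) := fun l => (hv'b l).continuous hb
  have d : ∀ l, HasDiv volume (pairSlab n I) (pairField v) (difv v l) (dif (v' l)) := fun l =>
    hv.pair_dif (hv.continuous_apply l) (c l) (hv' l)
  have d' : ∀ l, Continuous (dif (v' l)) := fun l => ((hv'b l).dif hb.le).continuous hb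
  exact hv.pair_mul (d j) (d i) (d' j) (d' i) hv.pos hv.pos ((hv.holder j).dif hv.pos.le)
    ((hv.holder i).dif hv.pos.le) (by linarith)

theorem hasDiv_quadSing (hK : ∀ j i, IsTest Set.univ (K j i)) (h1 : 1 < b + α) (h2 : 2 < 3 * α) :
    HasDiv volume (slab n I : Set (ℝ × Space n)) (spaceTimeField v) (quadSing v K)
      (quadDeriv v v' K) := by
  have p := hv.pos
  -- The identity itself involves no β. Any small positive exponent serves to sum the series and to
  -- obtain continuity.
  obtain ⟨β, hβ0, hβ⟩ : ∃ β, 0 < β ∧ β < min (min α b) (min (b + α - 1) (min (3 * α - 2) (2 * α - 1))) :=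
    exists_between (by simp only [lt_min_iff]; refine ⟨⟨p, hb⟩, ?_, ?_, ?_⟩ <;> by_contra! <;> nlinarith)
  simp only [lt_min_iff] at hβ
  obtain ⟨⟨b1, b2⟩, b3, b4, b5⟩ := hβ
  have t : ∀ j i, HasDiv volume (slab n I : Set (ℝ × Space n)) (spaceTimeField v)
      (sing 1 (K j i) (fun Q => difv v j Q * difv v i Q)) _ := fun j i =>
    hv.hasDiv_sing (hv.pairFun_two hβ0.le b1.le j i)
      (hv.pairFun_quadPair hb hv'b hv'p hβ0.le b1.le b2.le j i)
      (hv.pair_two hb hv'b hv'p hv' (by linarith) j i) (hK j i) hβ0.le b1.le one_pos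
      (by push_cast; linarith) (by push_cast; linarith) (by push_cast; linarith)
  have c1 : ∀ j i, Continuous (sing 1 (K j i) (fun Q => difv v j Q * difv v i Q)) := fun j i =>
    ((hv.pairFun_two hβ0.le b1.le j i).bddHolder_sing (hK j i) hβ0.le one_pos
      (by push_cast; linarith)).continuous hβ0
  have c2 := fun j i =>
    (hv.bddHolder_sing_deriv (hv.pairFun_two hβ0.le b1.le j i)
      (hv.pairFun_quadPair hb hv'b hv'p hβ0.le b1.le b2.le j i)
      (hK j i) hβ0.le b1.le one_pos (by push_cast; linarith) (by push_cast; linarith)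
      (by push_cast; linarith)).continuous hβ0
  have W := continuous_spaceTimeField hv.continuous
  exact HasDiv.sum _ (fun j _ => HasDiv.sum _ (fun i _ => t j i) W (fun i _ => c1 j i)
    fun i _ => c2 j i) W (fun j _ => continuous_finsetSum _ fun i _ => c1 j i)
    fun j _ => continuous_finsetSum _ fun i _ => c2 j i

/-- The formulas of the first derivative are transported once more, term by term. Order 1 meets
products of order 2b, order 2 meets order b + 2α, and order 3 meets four increments of order 4α;
these give the last three numerical hypotheses. The exponent 2b - α for v'' is chosen so that δv''
δv has the same order 2b as δv' δv'. -/
theorem hasDiv_quadDeriv (hK : ∀ j i, IsTest Set.univ (K j i))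
    (hv''b : ∀ l, BddHolder (2 * b - α) (v'' l)) (hv''p : ∀ l, IsPer Γ (v'' l))
    (hv'' : ∀ l, HasDiv volume (slab n I : Set (ℝ × Space n)) (spaceTimeField v) (v' l) (v'' l))
    (hα1 : α < 1) (h1 : 1 < 2 * b) (h2 : 2 < b + 2 * α) (h3 : 3 < 4 * α) :
    HasDiv volume (slab n I : Set (ℝ × Space n)) (spaceTimeField v) (quadDeriv v v' K)
        (quadDerivTwo v v' v'' K) ∧
      (∃ β > 0, BddHolder β (quadDerivTwo v v' v'' K)) ∧ IsPer Γ (quadDerivTwo v v' v'' K) := by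
  have p := hv.pos
  obtain ⟨β, hβ0, hβ⟩ : ∃ β, 0 < β ∧ β < min (min α (min b (2 * b - α)))
      (min (min (2 * b - 1) (b + 2 * α - 2)) (4 * α - 3)) :=
    exists_between (by
      simp only [lt_min_iff]; refine ⟨⟨p, hb, ?_⟩, ⟨?_, ?_⟩, ?_⟩ <;> linarith)
  simp only [lt_min_iff] at hβ
  obtain ⟨⟨b1, b2, b3⟩, ⟨b4, b5⟩, b6⟩ := hβ
  have c : ∀ l, Continuous (v' l) := fun l => (hv'b l).continuous hb
  have c' : ∀ l, Continuous (v'' l) := fun l => (hv''b l).continuous (by linarith)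
  have d : ∀ l, HasDiv volume (pairSlab n I) (pairField v) (difv v l) (dif (v' l)) := fun l =>
    hv.pair_dif (hv.continuous_apply l) (c l) (hv' l)
  have d' : ∀ l, HasDiv volume (pairSlab n I) (pairField v) (dif (v' l)) (dif (v'' l)) := fun l =>
    hv.pair_dif (c l) (c' l) (hv'' l)
  have p0 := fun l => hv.pairFun_dif hβ0.le b1.le l
  have p1 := fun l => PairFun.dif hβ0.le b2.le hb (hv'b l) (hv'p l)
  have p2 := fun l => PairFun.dif hβ0.le b3.le (by linarith) (hv''b l) (hv''p l)
  have q0 := fun l => (hv.holder l).dif p.le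
  have q1 := fun l => (hv'b l).dif hb.le
  have c0 := fun l => (p0 l).continuous
  have c1 := fun l => (p1 l).continuous
  have c2 := fun l => (p2 l).continuous
  have W := continuous_spaceTimeField hv.continuous
  have W' := continuous_pairField hv.continuous
  have q2 := hv.pairFun_two hβ0.le b1.le
  have q3 := hv.pairFun_quadPair hb hv'b hv'p hβ0.le b1.le b2.le
  -- The product rule is now applied to an increment of v' (exponent b) and one of v (exponent α),
  -- along a field of exponent α: the requirement b + 2α > 1 is weaker than the hypothesis.
  have e1 : ∀ j i, HasDiv volume (pairSlab n I) (pairField v) (quadPair v v' j i) fun Q =>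
      (dif (v'' j) Q * difv v i Q + dif (v' j) Q * dif (v' i) Q)
          + (dif (v' j) Q * dif (v' i) Q + difv v j Q * dif (v'' i) Q) := fun j i =>
    (hv.pair_mul (d' j) (d i) (c2 j) (c1 i) hb p (q1 j) (q0 i) (by linarith)).add
      (hv.pair_mul (d j) (d' i) (c1 j) (c2 i) p hb (q0 j) (q1 i) (by linarith)) W'
      ((c1 j).mul (c0 i)) (((c2 j).mul (c0 i)).add ((c1 j).mul (c1 i))) ((c0 j).mul (c1 i))
      (((c1 j).mul (c1 i)).add ((c0 j).mul (c2 i)))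
  have P1 : ∀ j i, PairFun Γ β (2 * b) fun Q =>
      (dif (v'' j) Q * difv v i Q + dif (v' j) Q * dif (v' i) Q)
          + (dif (v' j) Q * dif (v' i) Q + difv v j Q * dif (v'' i) Q) := fun j i => by
    have k1 := ((p1 j).mul (p1 i) hb hb b2.le b2.le).congr (two_mul b).symm
    have k2 := ((p2 j).mul (p0 i) (by linarith) p b3.le b1.le).congr
      (by ring : 2 * b - α + α = 2 * b)
    have k3 := ((p0 j).mul (p2 i) p (by linarith) b1.le b3.le).congr
      (by ring : α + (2 * b - α) = 2 * b)
    exact (k2.add k1).add (k1.add k3)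
  have e2 : ∀ k j i, HasDiv volume (pairSlab n I) (pairField v)
      (fun Q => difv v k Q * (difv v j Q * difv v i Q)) fun Q =>
        dif (v' k) Q * (difv v j Q * difv v i Q) + difv v k Q * quadPair v v' j i Q := fun k j i =>
    hv.pair_mul (d k) (hv.pair_two hb hv'b hv'p hv' (by linarith) j i) (c1 k) (q3 j i).continuous
      p p (q0 k) ((q0 j).mul (q0 i)) (by linarith)
  have P2 : ∀ k j i, PairFun Γ β (3 * α) fun Q => difv v k Q * (difv v j Q * difv v i Q) :=
    fun k j i => hv.pairFun_dif_mul hβ0.le b1.le k (by linarith) (by linarith) (q2 j i) (by ring)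
  have P3 : ∀ k j i, PairFun Γ β (b + 2 * α) fun Q =>
      dif (v' k) Q * (difv v j Q * difv v i Q) + difv v k Q * quadPair v v' j i Q := fun k j i =>
    ((p1 k).mul (q2 j i) hb (by linarith) b2.le (by linarith)).add
      (hv.pairFun_dif_mul hβ0.le b1.le k (by linarith) (by linarith) (q3 j i) (by ring))
  have t1 := fun j i => hv.hasDiv_sing (s := 1) (q3 j i) (P1 j i) (e1 j i) (hK j i) hβ0.le b1.le
    one_pos (by push_cast; linarith) (by push_cast; linarith) (by push_cast; linarith)
  have r1 := fun j i => hv.bddHolder_sing_deriv (s := 1) (q3 j i) (P1 j i) (hK j i) hβ0.le b1.le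
    one_pos (by push_cast; linarith) (by push_cast; linarith) (by push_cast; linarith)
  have t2 := fun k j i => hv.hasDiv_sing (s := 1 + 1) (P2 k j i) (P3 k j i) (e2 k j i)
    ((hK j i).partialDeriv k) hβ0.le b1.le
    (by norm_num) (by push_cast; linarith) (by push_cast; linarith) (by push_cast; linarith)
  have r2 := fun k j i => hv.bddHolder_sing_deriv (s := 1 + 1) (P2 k j i) (P3 k j i)
    ((hK j i).partialDeriv k) hβ0.le b1.le
    (by norm_num) (by push_cast; linarith) (by push_cast; linarith) (by push_cast; linarith)
  have s1 := fun j i => ((q3 j i).bddHolder_sing (s := 1) (hK j i) hβ0.le one_pos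
    (by push_cast; linarith)).continuous hβ0
  have s2 := fun k j i => ((P2 k j i).bddHolder_sing (s := 1 + 1) ((hK j i).partialDeriv k) hβ0.le
    (by norm_num) (by push_cast; linarith)).continuous hβ0
  have r := fun j i => (r1 j i).add (BddHolder.sum Finset.univ fun k _ => r2 k j i)
  have s2' := fun j i => continuous_finsetSum Finset.univ fun k _ => s2 k j i
  have r2' := fun j i => (BddHolder.sum Finset.univ fun k _ => r2 k j i).continuous hβ0
  have t := fun j i => (t1 j i).add
    (HasDiv.sum Finset.univ (fun k _ => t2 k j i) W (fun k _ => s2 k j i)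
      fun k _ => (r2 k j i).continuous hβ0) W (s1 j i) ((r1 j i).continuous hβ0) (s2' j i) (r2' j i)
  refine ⟨?_, ⟨β, hβ0, BddHolder.sum _ fun j _ => BddHolder.sum _ fun i _ => r j i⟩, ?_⟩
  · exact HasDiv.sum _ (fun j _ => HasDiv.sum _ (fun i _ => t j i) W
      (fun i _ => (s1 j i).add (s2' j i)) fun i _ => (r j i).continuous hβ0) W
      (fun j _ => continuous_finsetSum _ fun i _ => (s1 j i).add (s2' j i))
      fun j _ => continuous_finsetSum _ fun i _ => (r j i).continuous hβ0
  · exact IsPer.sum _ fun j _ => IsPer.sum _ fun i _ =>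
      (((P1 j i).isPer_sing _ _).add (IsPer.sum _ fun k _ =>
        (hv.pairFun_dif_mul hβ0.le b1.le k (by linarith) (by linarith) (q3 j i) rfl).isPer_sing
          _ _)).add
      (IsPer.sum _ fun k _ => ((P3 k j i).isPer_sing _ _).add (IsPer.sum _ fun k' _ =>
        (hv.pairFun_dif_mul hβ0.le b1.le k' (by linarith) (by linarith) (P2 k j i) rfl).isPer_sing
          _ _))

end Deriv

end HolderField

end

/-! ### Replacing velocities by increments -/

section

variable {n : ℕ} {I : Opens ℝ} {v : ℝ × Space n → Space n} {Γ : Submodule ℤ (Space n)}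
  {α β : ℝ}

theorem partialDeriv_comm {L : Space n → ℝ} (hL : IsTest Set.univ L) (j i : Fin n) :
    partialDeriv j (partialDeriv i L) = partialDeriv i (partialDeriv j L) :=
  funext fun z => fderiv_fderiv_comm hL.contDiff z _ _

theorem IsTest.comp_sub_const {κ : Space n → ℝ} (hκ : IsTest Set.univ κ) (x : Space n) :
    IsTest Set.univ fun y => κ (y - x) where
  contDiff := hκ.contDiff.comp (contDiff_id.sub contDiff_const)
  hasCompactSupport := hκ.hasCompactSupport.comp_homeomorph (Homeomorph.subRight x)
  tsupport_subset := Set.subset_univ _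

/-- The translate `z ↦ w(t, x + z)`. -/
def slide (w : ℝ × Space n → ℝ) (P : ℝ × Space n) (z : Space n) : ℝ := w (P.1, P.2 + z)

theorem continuous_slide {w : ℝ × Space n → ℝ} (hw : Continuous w) :
    Continuous (uncurry (slide w)) := by
  simp only [uncurry_def, slide]; fun_prop

theorem integral_conv_scaled_mul {L : Space n → ℝ} (hL : IsTest Set.univ L) (s q : ℤ)
    {φ w : ℝ × Space n → ℝ} (hφ : IsTest (slab n I : Set (ℝ × Space n)) φ) (hw : Continuous w) :
    ∫ P, conv (scaled s q L) φ P * w P = ∫ P, φ P * kint s q L (slide w P) := by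
  have hs := hL.scaled s q
  rw [integral_mul_conv_slab hs.continuous hs.hasCompactSupport hφ
    (hw.locallyIntegrable.locallyIntegrableOn _) fun t _ => by fun_prop]
  have hi := hφ.integrable_mul (continuous_kint hL s q (continuous_slide hw)) volume
  simp only [mul_comm _ (φ _)] at hi
  rw [Measure.volume_eq_prod, integral_prod _ hi]
  rfl

theorem SumHolder.tendsto_integral {k : ℤ → ℝ × Space n → ℝ} (h : SumHolder β k)
    (hk : ∀ q, Continuous (k q)) {U : Set (ℝ × Space n)} {φ : ℝ × Space n → ℝ} (hφ : IsTest U φ) :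
    Tendsto (fun M : ℕ => ∑ q ∈ Finset.Ico (-(M : ℤ)) M, ∫ P, φ P * k q P) atTop
      (𝓝 (∫ P, φ P * ∑' q, k q P)) := by
  obtain ⟨C, hC⟩ := h.exists_abs_sum_le
  have hi : ∀ q, Integrable fun P => φ P * k q P := fun q => by
    simpa only [mul_comm] using hφ.integrable_mul (hk q) volume
  simp only [← integral_finsetSum _ fun q _ => hi q, ← Finset.mul_sum]
  refine tendsto_integral_of_dominated_convergence (fun P => |φ P| * C) (fun M => ?_) ?_
    (fun M => ae_of_all _ fun P => ?_) (ae_of_all _ fun P => (h.tendsto P).const_mul _)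
  · have := hφ.continuous
    exact (this.mul (continuous_finsetSum _ fun q _ => hk q)).aestronglyMeasurable
  · exact (hφ.continuous.integrable_of_hasCompactSupport hφ.hasCompactSupport).abs.mul_const _
  · rw [Real.norm_eq_abs, abs_mul]
    exact mul_le_mul_of_nonneg_left (hC _ P) (abs_nonneg _)

namespace HolderField

theorem continuous_incr_apply (hv : HolderField I Γ α v) (P : ℝ × Space n) (k : Fin n) :
    Continuous (incr (fun P => v P k) P) :=
  (continuous_incr (hv.continuous_apply k)).comp (.prodMk_right P)

/-- Each ∂_j L has mean zero, so increments may be replaced by values. What remains is the pairing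
of ∇L with v(t,x+·), which vanishes because the slice is divergence-free. -/
theorem sum_kint_partialDeriv (hv : HolderField I Γ α v) {L : Space n → ℝ}
    (hL : IsTest Set.univ L) (s q : ℤ) {P : ℝ × Space n} (hP : P.1 ∈ I) :
    ∑ j, kint s q (partialDeriv j L) (incr (fun P => v P j) P) = 0 := by
  have hs := hL.scaled (s - 1) q
  have hχ := hs.comp_sub_const P.2
  have h1 := integral_fderiv_slice_eq_zero hv.continuous hv.hasDiv_one hP hχ.contDiff
    hχ.hasCompactSupport
  have h2 : ∀ y e, fderiv ℝ (fun y => scaled (s - 1) q L (y - P.2)) y e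
      = fderiv ℝ (scaled (s - 1) q L) (y - P.2) e := fun y e => by
    rw [fderiv_comp_sub]
  simp only [h2] at h1
  rw [← integral_add_left_eq_self _ P.2] at h1
  simp only [add_sub_cancel_left] at h1
  have hc : ∀ j, Continuous fun z => v (P.1, P.2 + z) j := fun j =>
    (continuous_slide (hv.continuous_apply j)).comp (.prodMk_right P)
  rw [← h1]
  have e1 : ∀ j, kint s q (partialDeriv j L) (incr (fun P => v P j) P)
      = ∫ z, scaled s q (partialDeriv j L) z * v (P.1, P.2 + z) j := fun j =>
    (kint_eq_of_integral_eq_zero (hL.partialDeriv j) (integral_partialDeriv_eq_zero hL j) (hc j)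
      s q (v P j)).symm
  simp only [e1]
  rw [← integral_finsetSum _ fun j _ => integrable_scaled_mul (hL.partialDeriv j) s q (hc j)]
  congr 1; ext z
  rw [fderiv_apply_eq_sum]
  simp only [partialDeriv_scaled hL.differentiable, sub_add_cancel]

/-- Products of velocities may be replaced by products of differences. -/
theorem sum_kint_two (hv : HolderField I Γ α v) {K : Fin n → Fin n → Space n → ℝ}
    {M : Fin n → Space n → ℝ} (hM : ∀ i, IsTest Set.univ (M i))
    (h1 : ∀ j i, K j i = partialDeriv j (M i)) (h2 : ∀ j i, K j i = partialDeriv i (M j))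
    (s q : ℤ) {P : ℝ × Space n} (hP : P.1 ∈ I) :
    ∑ j, ∑ i, kint s q (K j i) (slide (fun P => v P j * v P i) P)
      = ∑ j, ∑ i, kint s q (K j i) (atIncr (fun Q => difv v j Q * difv v i Q) P) := by
  have hK : ∀ j i, IsTest Set.univ (K j i) := fun j i => h1 j i ▸ (hM i).partialDeriv j
  have h0 : ∀ j i, ∫ z, K j i z = 0 := fun j i => by
    rw [h1]; exact integral_partialDeriv_eq_zero (hM i) j
  set d := fun k => incr (fun P => v P k) P
  have dc : ∀ k, Continuous (d k) := hv.continuous_incr_apply P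
  -- Expansion of v^j v^i around the base point. The constant drops by the mean-zero property, and
  -- the two terms linear in increments vanish after summation by incompressibility, using that the
  -- kernel is a derivative in either index.
  have e : ∀ j i, kint s q (K j i) (slide (fun P => v P j * v P i) P)
      = kint s q (K j i) (atIncr (fun Q => difv v j Q * difv v i Q) P)
        + v P j * kint s q (K j i) (d i) + v P i * kint s q (K j i) (d j) := by
    intro j i
    have hc : Continuous (slide (fun P => v P j * v P i) P) :=
      (continuous_slide ((hv.continuous_apply j).mul (hv.continuous_apply i))).comp
        (.prodMk_right P)
    rw [kint_eq_of_integral_eq_zero (hK j i) (h0 j i) hc s q (v P j * v P i)]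
    rw [← kint_const_mul, ← kint_const_mul, ← kint_add (hK j i), ← kint_add (hK j i)]
    · congr 1; ext z
      simp only [slide, atIncr, dif, d, incr]; ring
    · exact ((dc j).mul (dc i)).add (continuous_const.mul (dc i))
    · exact continuous_const.mul (dc j)
    · exact (dc j).mul (dc i)
    · exact continuous_const.mul (dc i)
  have z1 : ∑ j, ∑ i, v P j * kint s q (K j i) (d i) = 0 :=
    Finset.sum_eq_zero fun j _ => by
      simp only [h2]
      rw [← Finset.mul_sum, hv.sum_kint_partialDeriv (hM j) s q hP, mul_zero]
  have z2 : ∑ j, ∑ i, v P i * kint s q (K j i) (d j) = 0 := by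
    rw [Finset.sum_comm]
    refine Finset.sum_eq_zero fun i _ => ?_
    simp only [h1]
    rw [← Finset.mul_sum, hv.sum_kint_partialDeriv (hM i) s q hP, mul_zero]
  simp only [e, Finset.sum_add_distrib, z1, z2, add_zero]

/-- The triple product is expanded into increments. Terms with a single increment cancel by
incompressibility. The three families with two increments coincide by the symmetry of the kernel in
its indices, which is the origin of the factor 3. Hence no increment is lost except against a bare
factor v. -/
theorem sum_kint_three (hv : HolderField I Γ α v) {M : Fin n → Fin n → Space n → ℝ}
    (hM : ∀ j i, IsTest Set.univ (M j i)) (h1 : ∀ j i, M j i = M i j)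
    (h2 : ∀ k j i, partialDeriv k (M j i) = partialDeriv j (M k i))
    (s q : ℤ) {P : ℝ × Space n} (hP : P.1 ∈ I) :
    ∑ k, ∑ j, ∑ i, kint s q (partialDeriv k (M j i))
        (slide (fun P => v P k * (v P j * v P i)) P)
      = ∑ k, ∑ j, ∑ i, kint s q (partialDeriv k (M j i))
          (atIncr (fun Q => difv v k Q * (difv v j Q * difv v i Q)) P)
        + 3 * ∑ k, v P k * ∑ j, ∑ i, kint s q (partialDeriv k (M j i))
          (atIncr (fun Q => difv v j Q * difv v i Q) P) := by
  set d := fun k => incr (fun P => v P k) P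
  set T := fun k j i => kint s q (partialDeriv k (M j i)) with hT
  have dc : ∀ k, Continuous (d k) := hv.continuous_incr_apply P
  have T1 : ∀ k j i, T k j i = T k i j := fun k j i => by simp only [hT, h1 j i]
  have T2 : ∀ k j i, T k j i = T j k i := fun k j i => by simp only [hT, h2 k j i]
  have hK : ∀ k j i, IsTest Set.univ (partialDeriv k (M j i)) := fun k j i => (hM j i).partialDeriv k
  have e : ∀ k j i, T k j i (slide (fun P => v P k * (v P j * v P i)) P)
      = T k j i (fun z => d k z * (d j z * d i z)) + v P k * T k j i (fun z => d j z * d i z)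
        + v P j * T k j i (fun z => d k z * d i z) + v P i * T k j i (fun z => d k z * d j z)
        + v P j * v P i * T k j i (d k) + v P k * v P i * T k j i (d j)
        + v P k * v P j * T k j i (d i) := by
    intro k j i
    have hc : Continuous (slide (fun P => v P k * (v P j * v P i)) P) :=
      (continuous_slide ((hv.continuous_apply k).mul
        ((hv.continuous_apply j).mul (hv.continuous_apply i)))).comp (.prodMk_right P)
    have dk := dc k
    have dj := dc j
    have di := dc i
    simp only [hT]
    rw [kint_eq_of_integral_eq_zero (hK k j i) (integral_partialDeriv_eq_zero (hM j i) k) hc s q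
      (v P k * (v P j * v P i))]
    simp only [← kint_const_mul]
    repeat rw [← kint_add (hK k j i) s q (by fun_prop) (by fun_prop)]
    congr 1; ext z
    simp only [slide, d, incr]; ring
  have z : ∀ j i, ∑ k, T k j i (d k) = 0 := fun j i => hv.sum_kint_partialDeriv (hM j i) s q hP
  have s1 : ∑ k, ∑ j, ∑ i, v P j * v P i * T k j i (d k) = 0 := by
    rw [Finset.sum_comm]
    refine Finset.sum_eq_zero fun j _ => ?_
    rw [Finset.sum_comm]
    refine Finset.sum_eq_zero fun i _ => ?_
    rw [← Finset.mul_sum, z, mul_zero]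
  have s2 : ∑ k, ∑ j, ∑ i, v P k * v P i * T k j i (d j) = 0 := by
    refine Finset.sum_eq_zero fun k _ => ?_
    rw [Finset.sum_comm]
    refine Finset.sum_eq_zero fun i _ => ?_
    simp only [T2 k]
    rw [← Finset.mul_sum, z, mul_zero]
  have s3 : ∑ k, ∑ j, ∑ i, v P k * v P j * T k j i (d i) = 0 := by
    refine Finset.sum_eq_zero fun k _ => Finset.sum_eq_zero fun j _ => ?_
    simp only [T1 k j, T2 k _ j]
    rw [← Finset.mul_sum, z, mul_zero]
  -- Renaming indices by the symmetry of the third derivatives of the kernel.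
  have s4 : ∑ k, ∑ j, ∑ i, v P j * T k j i (fun z => d k z * d i z)
      = ∑ k, ∑ j, ∑ i, v P k * T k j i (fun z => d j z * d i z) := by
    rw [Finset.sum_comm]
    simp only [T2]
  have s5 : ∑ k, ∑ j, ∑ i, v P i * T k j i (fun z => d k z * d j z)
      = ∑ k, ∑ j, ∑ i, v P k * T k j i (fun z => d j z * d i z) := by
    have : ∀ k, ∑ j, ∑ i, v P i * T k j i (fun z => d k z * d j z)
        = ∑ i, ∑ j, v P i * T i k j (fun z => d k z * d j z) := fun k => by
      rw [Finset.sum_comm]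
      refine Finset.sum_congr rfl fun i _ => Finset.sum_congr rfl fun j _ => ?_
      rw [T1 k j i, T2 k i j]
    simp only [this]
    rw [Finset.sum_comm]
  have e' : ∀ k j i, kint s q (partialDeriv k (M j i))
      (slide (fun P => v P k * (v P j * v P i)) P) = _ := e
  simp only [e', Finset.sum_add_distrib, s1, s2, s3, s4, s5, add_zero, Finset.mul_sum]
  have f : ∀ k j i, kint s q (partialDeriv k (M j i)) (atIncr (fun Q => difv v j Q * difv v i Q) P)
    = T k j i (fun z => d j z * d i z) := fun _ _ _ => rfl
  have f' : ∀ k j i, kint s q (partialDeriv k (M j i))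
      (atIncr (fun Q => difv v k Q * (difv v j Q * difv v i Q)) P)
    = T k j i (fun z => d k z * (d j z * d i z)) := fun _ _ _ => rfl
  simp only [f, f', add_assoc, ← Finset.sum_add_distrib]
  refine Finset.sum_congr rfl fun k _ => Finset.sum_congr rfl fun j _ =>
    Finset.sum_congr rfl fun i _ => ?_
  ring

end HolderField

end

/-! ### The pressure gradient as a sum of quadratic terms in the increments -/

section

variable {n : ℕ} {I : Opens ℝ} {v : ℝ × Space n → Space n} {Γ : Submodule ℤ (Space n)}
  {α β : ℝ}

theorem spaceTimeField_eq (v : ℝ × Space n → Space n) (P : ℝ × Space n) :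
    spaceTimeField v P = timeDir n + ∑ k, v P k • spaceDir k := by
  have h : v P = ∑ k, v P k • EuclideanSpace.single k (1 : ℝ) := by
    conv_lhs => rw [← (EuclideanSpace.basisFun (Fin n) ℝ).sum_repr (v P)]
    simp
  have h2 : ∑ k, v P k • (spaceDir k : ℝ × Space n) = (0, v P) := by
    conv_rhs => rw [h]
    ext
    · simp [spaceDir, Prod.fst_sum]
    · simp [spaceDir, Prod.snd_sum]
  rw [h2]
  simp [spaceTimeField, timeDir]

theorem integral_mul_fderiv_spaceTimeField (hv : Continuous v) {w φ : ℝ × Space n → ℝ}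
    (hw : Continuous w) {U : Set (ℝ × Space n)} (hφ : IsTest U φ) :
    ∫ P, w P * fderiv ℝ φ P (spaceTimeField v P)
      = (∫ P, fderiv ℝ φ P (timeDir n) * w P)
        + ∑ k, ∫ P, fderiv ℝ φ P (spaceDir k) * (v P k * w P) := by
  have hi : ∀ (e : ℝ × Space n) {a : ℝ × Space n → ℝ}, Continuous a →
      Integrable fun P => fderiv ℝ φ P e * a P := fun e a ha => by
    simpa only [mul_comm] using hφ.integrable_mul_fderiv ha (continuous_const (y := e)) volume
  have hvk : ∀ k, Continuous fun P => v P k * w P := fun k => by fun_prop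
  rw [← integral_finsetSum _ fun k _ => hi _ (hvk k),
    ← integral_add (hi _ hw) (integrable_finsetSum _ fun k _ => hi _ (hvk k))]
  congr 1; ext P
  rw [spaceTimeField_eq, map_add, map_sum, mul_add, Finset.mul_sum]
  congr 1
  · ring
  · refine Finset.sum_congr rfl fun k _ => ?_
    rw [map_smul, smul_eq_mul]; ring

theorem IsTest.sum_integral_mul {ι : Type*} (S : Finset ι) {U : Set (ℝ × Space n)}
    {φ : ℝ × Space n → ℝ} (hφ : IsTest U φ) {f : ι → ℝ × Space n → ℝ}
    (hf : ∀ i ∈ S, Continuous (f i)) :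
    ∑ i ∈ S, ∫ P, φ P * f i P = ∫ P, φ P * ∑ i ∈ S, f i P := by
  rw [← integral_finsetSum]
  · simp only [Finset.mul_sum]
  · intro i hi
    simpa only [mul_comm] using hφ.integrable_mul (hf i hi) volume

theorem conv_scaled_fderiv {L : Space n → ℝ} (hL : IsTest Set.univ L) (s q : ℤ)
    {φ : ℝ × Space n → ℝ} {U : Set (ℝ × Space n)} (hφ : IsTest U φ) (l : Fin n) :
    conv (scaled s q L) (fun P => fderiv ℝ φ P (spaceDir l))
      = conv (scaled (s + 1) q (partialDeriv l L)) φ := by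
  ext P
  rw [conv_fderiv_apply_spaceDir (hL.scaled s q) hφ.contDiff hφ.hasCompactSupport,
    partialDeriv_scaled hL.differentiable]

theorem IsTest.integral_congr_slab {φ f g : ℝ × Space n → ℝ}
    (hφ : IsTest (slab n I : Set (ℝ × Space n)) φ) (h : ∀ P : ℝ × Space n, P.1 ∈ I → f P = g P) :
    ∫ P, φ P * f P = ∫ P, φ P * g P := by
  congr 1; ext P
  by_cases hP : P.1 ∈ I
  · rw [h P hP]
  · have : φ P = 0 := image_eq_zero_of_notMem_tsupport fun h' => hP (hφ.tsupport_subset h').1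
    rw [this, zero_mul, zero_mul]

theorem SumHolder.bddHolder_mul {f : ℝ × Space n → ℝ} {k : ℤ → ℝ × Space n → ℝ}
    (hf : BddHolder β f) (hk : SumHolder β k) : SumHolder β fun q P => f P * k q P := by
  obtain ⟨C, f1, f2⟩ := hf
  obtain ⟨c, hc, k1, k2⟩ := hk
  have hC : 0 ≤ C := (abs_nonneg _).trans (f1 0)
  have c0 : ∀ q, 0 ≤ c q := fun q => (abs_nonneg _).trans (k1 q 0)
  refine ⟨fun q => 2 * C * c q, hc.mul_left _, fun q P => ?_, fun q P Q => ?_⟩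
  · rw [abs_mul]
    have := mul_le_mul (f1 P) (k1 q P) (abs_nonneg _) hC
    nlinarith [mul_nonneg hC (c0 q)]
  · have e : f P * k q P - f Q * k q Q = f P * (k q P - k q Q) + (f P - f Q) * k q Q := by ring
    rw [e]
    refine (abs_add_le _ _).trans ?_
    rw [abs_mul, abs_mul]
    have a1 := mul_le_mul (f1 P) (k2 q P Q) (abs_nonneg _) hC
    have a2 := mul_le_mul (f2 P Q) (k1 q Q) (abs_nonneg _) (by positivity)
    linarith

/-- At order 0, boundedness gives no decay at coarse scales. There the periodicity of H is used
instead: the periodization of a wide mean-zero kernel is O(2^q). -/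
theorem exists_abs_kint_zero_le_geo (Γ : Submodule ℤ (Space n)) [DiscreteTopology Γ]
    [IsZLattice ℝ Γ] {L : Space n → ℝ} (hL : IsTest Set.univ L) (h0 : ∫ z, L z = 0) {a : ℝ}
    (ha : 0 < a) : ∃ C, 0 ≤ C ∧ ∀ (q : ℤ) (H : Space n → ℝ) (A : ℝ), 0 ≤ A → Continuous H →
      (∀ z, ∀ γ ∈ Γ, H (z + γ) = H z) → (∀ z, |H z| ≤ A) → (∀ z, |H z| ≤ A * ‖z‖ ^ a) →
      |kint 0 q L H| ≤ A * (C * geo (min a 1) q) := by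
  obtain ⟨C, hC, h⟩ := exists_abs_kint_periodic_le Γ hL h0
  set D := ∫ u, |L u| * (1 + ‖u‖ ^ a)
  have hD : 0 ≤ D := integral_nonneg fun u => by positivity
  refine ⟨C + D, by positivity, fun q H A hA hc hp h1 h2 => ?_⟩
  have g0 := geo_nonneg (min a 1) q
  rcases le_total 0 q with hq | hq
  · have hq' : (0 : ℝ) ≤ q := by exact_mod_cast hq
    have g : (2 : ℝ) ^ (((0 : ℤ) - a) * q) ≤ geo (min a 1) q := by
      refine rpow_two_le ?_
      rw [abs_of_nonneg hq']
      push_cast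
      nlinarith [min_le_left a 1]
    refine (abs_kint_le hL 0 q ha.le hA h2).trans ?_
    calc _ ≤ A * D * geo (min a 1) q := mul_le_mul_of_nonneg_left g (by positivity)
      _ ≤ _ := by nlinarith [mul_nonneg (mul_nonneg hA hC) g0]
  · have hq' : (q : ℝ) ≤ 0 := by exact_mod_cast hq
    have g : (2 : ℝ) ^ q ≤ geo (min a 1) q := by
      rw [← Real.rpow_intCast]
      refine rpow_two_le ?_
      rw [abs_of_nonpos hq']
      nlinarith [min_le_right a 1]
    refine (h q hq H A hc hp h1).trans ?_
    calc _ ≤ C * A * geo (min a 1) q := mul_le_mul_of_nonneg_left g (by positivity)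
      _ ≤ _ := by nlinarith [mul_nonneg (mul_nonneg hA hD) g0]

/-- An operator of order 0 maps C^b to C^β for every β < b: differences in P vanish to the positive
order b - β, and periodicity in z controls the coarse scales. -/
theorem sumHolder_kint_zero [DiscreteTopology Γ] [IsZLattice ℝ Γ] {L : Space n → ℝ}
    (hL : IsTest Set.univ L) (h0 : ∫ z, L z = 0) {b : ℝ} (hβ : 0 ≤ β) (hβb : β < b)
    {f : ℝ × Space n → ℝ} (hf : BddHolder b f) (hp : IsPer Γ f) :
    SumHolder β fun q P => kint 0 q L (incr f P) := by
  have hb : 0 < b := by linarith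
  have hfc := continuous_incr (hf.continuous hb)
  have hc : ∀ P, Continuous (incr f P) := fun P => hfc.comp (.prodMk_right P)
  have hp' : ∀ P z, ∀ γ ∈ Γ, incr f P (z + γ) = incr f P z := fun P z γ hγ => by
    simp only [incr, ← add_assoc, hp _ _ γ hγ]
  obtain ⟨A, hA, f1, f2, f3, f4⟩ := Inc.incr hβ hβb.le hf
  obtain ⟨C₁, hC₁, k1⟩ := exists_abs_kint_zero_le_geo Γ hL h0 hb
  obtain ⟨C₂, hC₂, k2⟩ := exists_abs_kint_zero_le_geo Γ hL h0 (sub_pos.2 hβb)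
  refine ⟨fun q => A * (C₁ * geo (min b 1) q) + A * (C₂ * geo (min (b - β) 1) q),
    (((summable_geo (lt_min hb one_pos)).mul_left _).mul_left _).add
      (((summable_geo (lt_min (sub_pos.2 hβb) one_pos)).mul_left _).mul_left _),
    fun q P => ?_, fun q P Q => ?_⟩
  · have g := geo_nonneg (min (b - β) 1) q
    refine (k1 q _ A hA (hc P) (hp' P) (f1 P) (f2 P)).trans ?_
    have : 0 ≤ A * (C₂ * geo (min (b - β) 1) q) := by positivity
    linarith
  · have g := geo_nonneg (min b 1) q
    rw [kint_sub hL 0 q (hc P) (hc Q)]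
    refine (k2 q _ (A * ‖P - Q‖ ^ β) (by positivity) ((hc P).sub (hc Q))
      (fun z γ hγ => congrArg₂ (fun a b : ℝ => a - b) (hp' P z γ hγ) (hp' Q z γ hγ)) (f3 P Q) (f4 P Q)).trans ?_
    have : 0 ≤ A * (C₁ * geo (min b 1) q) * ‖P - Q‖ ^ β := by positivity
    linarith

section Pressure

variable {G : Space n → ℝ}

/-- The third derivatives of the kernel. -/
noncomputable def kerThree (G : Space n → ℝ) (l j i : Fin n) : Space n → ℝ :=
  partialDeriv l (partialDeriv j (partialDeriv i G))

theorem isTest_kerThree (hG : IsTest Set.univ G) (l j i : Fin n) :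
    IsTest Set.univ (kerThree G l j i) := ((hG.partialDeriv i).partialDeriv j).partialDeriv l

theorem kerThree_swap (hG : IsTest Set.univ G) (l j i : Fin n) :
    kerThree G l j i = partialDeriv j (partialDeriv l (partialDeriv i G)) :=
  partialDeriv_comm (hG.partialDeriv i) l j

/-- The contribution of the frequencies `2^q` to the pressure gradient. -/
noncomputable def gradTerm (G : Space n → ℝ) (v : ℝ × Space n → Space n) (l : Fin n) (q : ℤ)
    (P : ℝ × Space n) : ℝ :=
  ∑ j, ∑ i, kint 1 q (kerThree G l j i) (atIncr (fun Q => difv v j Q * difv v i Q) P)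

namespace HolderField

theorem sumHolder_gradTerm (hv : HolderField I Γ α v) (hG : IsTest Set.univ G) (hβ : 0 ≤ β)
    (hβα : β ≤ α) (h : β < 2 * α - 1) (l : Fin n) : SumHolder β (gradTerm G v l) :=
  SumHolder.sum _ fun j _ => SumHolder.sum _ fun i _ =>
    (hv.pairFun_two hβ hβα j i).sumHolder (isTest_kerThree hG l j i) hβ one_pos
      (by push_cast; linarith)

theorem tsum_gradTerm (hv : HolderField I Γ α v) (hG : IsTest Set.univ G) (hα : 1 / 2 < α)
    (l : Fin n) (P : ℝ × Space n) : ∑' q, gradTerm G v l q P = quadSing v (kerThree G l) P := by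
  have h : ∀ j i, Summable fun q => kint 1 q (kerThree G l j i)
      (atIncr (fun Q => difv v j Q * difv v i Q) P) := fun j i =>
    ((hv.pairFun_two le_rfl hv.pos.le j i).sumHolder (isTest_kerThree hG l j i) le_rfl one_pos
      (by push_cast; linarith)).summable P
  simp only [gradTerm, quadSing, sing]
  rw [Summable.tsum_finsetSum fun j _ => summable_sum fun i _ => h j i]
  exact Finset.sum_congr rfl fun j _ => Summable.tsum_finsetSum fun i _ => h j i

theorem continuous_gradTerm (hv : HolderField I Γ α v) (hG : IsTest Set.univ G) (l : Fin n)
    (q : ℤ) : Continuous (gradTerm G v l q) :=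
  continuous_finsetSum _ fun j _ => continuous_finsetSum _ fun i _ =>
    continuous_kint (isTest_kerThree hG l j i) 1 q
      (continuous_atIncr (hv.pairFun_two le_rfl hv.pos.le j i).continuous)

/-- Third derivatives commute, so the kernel is a derivative in j and also in i, as the replacement
by increments requires. -/
theorem sum_kint_kerThree (hv : HolderField I Γ α v) (hG : IsTest Set.univ G) (l : Fin n) (q : ℤ)
    {P : ℝ × Space n} (hP : P.1 ∈ I) :
    ∑ j, ∑ i, kint 1 q (kerThree G l j i) (slide (fun P => v P j * v P i) P)
      = gradTerm G v l q P :=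
  hv.sum_kint_two (M := fun i => partialDeriv l (partialDeriv i G))
    (fun i => (hG.partialDeriv i).partialDeriv l) (fun j i => kerThree_swap hG l j i)
    (fun j i => by
      rw [kerThree, partialDeriv_comm hG j i]; exact kerThree_swap hG l i j) 1 q hP

/-- The derivative on the test function moves to the kernel, which becomes of order 1, and the
convolution moves to the product of velocities. -/
theorem block_spaceDir (hv : HolderField I Γ α v) (hG : IsTest Set.univ G) (q : ℤ) (l : Fin n)
    {φ : ℝ × Space n → ℝ} (hφ : IsTest (slab n I : Set (ℝ × Space n)) φ) :
    block G v q (fun P => fderiv ℝ φ P (spaceDir l)) = ∫ P, φ P * gradTerm G v l q P := by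
  have hvv : ∀ j i, Continuous fun P => v P j * v P i := fun j i =>
    (hv.continuous_apply j).mul (hv.continuous_apply i)
  have hc : ∀ j i, Continuous fun P =>
      kint 1 q (kerThree G l j i) (slide (fun P => v P j * v P i) P) := fun j i =>
    continuous_kint (isTest_kerThree hG l j i) 1 q (continuous_slide (hvv j i))
  have e : ∀ i j, ∫ P, conv (scaled 0 q (partialDeriv j (partialDeriv i G)))
      (fun P => fderiv ℝ φ P (spaceDir l)) P * (v P j * v P i)
      = ∫ P, φ P * kint 1 q (kerThree G l j i) (slide (fun P => v P j * v P i) P) := fun i j => by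
    rw [conv_scaled_fderiv ((hG.partialDeriv i).partialDeriv j) 0 q hφ, zero_add]
    exact integral_conv_scaled_mul (isTest_kerThree hG l j i) 1 q hφ (hvv j i)
  simp only [block, e]
  rw [Finset.sum_comm]
  simp only [hφ.sum_integral_mul _ fun i _ => hc _ i]
  rw [hφ.sum_integral_mul _ fun j _ => continuous_finsetSum _ fun i _ => hc j i]
  exact hφ.integral_congr_slab fun P hP => hv.sum_kint_kerThree hG l q hP

end HolderField

end Pressure

end

/-! ### The time derivative of the pressure -/

section

variable {n : ℕ} {I : Opens ℝ} {v : ℝ × Space n → Space n} {Γ : Submodule ℤ (Space n)}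
  {α β : ℝ} {G : Space n → ℝ} {v' : Fin n → ℝ × Space n → ℝ}

/-- The material derivative of a product of two velocities. -/
def velDeriv (v : ℝ × Space n → Space n) (v' : Fin n → ℝ × Space n → ℝ) (j i : Fin n)
    (P : ℝ × Space n) : ℝ := v' j P * v P i + v P j * v' i P

/-- The contribution of the frequencies `2^q` to the time derivative of the pressure. -/
noncomputable def timeTerm (G : Space n → ℝ) (v : ℝ × Space n → Space n)
    (v' : Fin n → ℝ × Space n → ℝ) (q : ℤ) (P : ℝ × Space n) : ℝ :=
  -((∑ i, ∑ j, kint 0 q (partialDeriv j (partialDeriv i G)) (incr (velDeriv v v' j i) P))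
    + ((∑ k, ∑ j, ∑ i, kint 1 q (kerThree G k j i)
        (atIncr (fun Q => difv v k Q * (difv v j Q * difv v i Q)) P))
      + 3 * ∑ k, v P k * gradTerm G v k q P))

namespace HolderField

section

variable (hv : HolderField I Γ α v) {b : ℝ} (hb : 0 < b) (hv'b : ∀ l, BddHolder b (v' l))
  (hv'p : ∀ l, IsPer Γ (v' l))
  (hv' : ∀ l, HasDiv volume (slab n I : Set (ℝ × Space n)) (spaceTimeField v) (fun P => v P l)
    (v' l))
include hv hv'b

theorem bddHolder_velDeriv (hb0 : 0 ≤ b) (hbα : b ≤ α) (j i : Fin n) :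
    BddHolder b (velDeriv v v' j i) :=
  ((hv'b j).mul ((hv.holder i).mono hb0 hbα)).add (((hv.holder j).mono hb0 hbα).mul (hv'b i))

/-- The term of order 0 needs β < b. The cubic term of order 1 vanishes to order 3α, and the
remaining one is a bounded Hölder multiple of the gradient terms, which need β < 2α - 1. -/
theorem sumHolder_timeTerm [DiscreteTopology Γ] [IsZLattice ℝ Γ] (hv'p : ∀ l, IsPer Γ (v' l))
    (hG : IsTest Set.univ G) (hβ : 0 ≤ β) (hβb : β < b) (hbα : b ≤ α) (h : β < 2 * α - 1) :
    SumHolder β (timeTerm G v v') := by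
  have p := hv.pos
  refine SumHolder.neg (.add (.sum _ fun i _ => .sum _ fun j _ => ?_) (.add
    (.sum _ fun k _ => .sum _ fun j _ => .sum _ fun i _ => ?_) ?_))
  · exact sumHolder_kint_zero ((hG.partialDeriv i).partialDeriv j)
      (integral_partialDeriv_eq_zero (hG.partialDeriv i) j) hβ hβb
      (hv.bddHolder_velDeriv hv'b (by linarith) hbα j i)
      (((hv'p j).mul (hv.isPer_apply i)).add ((hv.isPer_apply j).mul (hv'p i)))
  · exact (hv.pairFun_dif_mul hβ (by linarith) k (by linarith) (by linarith)
      (hv.pairFun_two hβ (by linarith) j i) rfl).sumHolder (isTest_kerThree hG k j i) hβ one_pos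
      (by push_cast; linarith)
  · have h1 : BddHolder β fun _ : ℝ × Space n => (3 : ℝ) :=
      ⟨3, fun _ => by norm_num, fun _ _ => by simp only [sub_self, abs_zero]; positivity⟩
    exact SumHolder.bddHolder_mul h1 (.sum _ fun k _ => SumHolder.bddHolder_mul
      ((hv.holder k).mono hβ (by linarith)) (hv.sumHolder_gradTerm hG hβ (by linarith) h k))

include hb

theorem continuous_timeTerm (hG : IsTest Set.univ G) (q : ℤ) :
    Continuous (timeTerm G v v' q) := by
  have c := hv.continuous_apply
  have c' := fun l => (hv'b l).continuous hb
  have d : ∀ k, Continuous (difv v k) := fun k =>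
    (hv.pairFun_dif le_rfl hv.pos.le k).continuous
  refine Continuous.neg (.add (continuous_finsetSum _ fun i _ => continuous_finsetSum _ fun j _ => ?_)
    (.add (continuous_finsetSum _ fun k _ => continuous_finsetSum _ fun j _ =>
      continuous_finsetSum _ fun i _ => ?_) (continuous_const.mul
      (continuous_finsetSum _ fun k _ => (c k).mul (hv.continuous_gradTerm hG k q)))))
  · exact continuous_kint ((hG.partialDeriv i).partialDeriv j) 0 q
      (continuous_incr (((c' j).mul (c i)).add ((c j).mul (c' i))))
  · exact continuous_kint (isTest_kerThree hG k j i) 1 q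
      (continuous_atIncr ((d k).mul ((d j).mul (d i))))

include hv'

theorem hasDiv_vel_mul (hα : 1 < 3 * α) (j i : Fin n) :
    HasDiv volume (slab n I : Set (ℝ × Space n)) (spaceTimeField v) (fun P => v P j * v P i)
      (velDeriv v v' j i) :=
  HasDiv.mul_of_holder (slab n I).isOpen hv.hasDiv_one (hv' j) (hv' i) ((hv'b j).continuous hb)
    ((hv'b i).continuous hb) hv.pos hv.spaceTimeField_holder hv.pos hv.pos (hv.holder j)
    (hv.holder i) (by linarith)

/-- The time derivative of v^j v^i is traded for its material derivative minus the divergence of the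
cubic flux v^k v^j v^i. The flux derivative falls on the kernel, raising its order from 0 to 1,
where the cubic product can be written with increments. -/
theorem block_timeDir (hα : 1 < 3 * α) (hG : IsTest Set.univ G) (q : ℤ)
    {φ : ℝ × Space n → ℝ} (hφ : IsTest (slab n I : Set (ℝ × Space n)) φ) :
    block G v q (fun P => fderiv ℝ φ P (timeDir n)) = ∫ P, φ P * timeTerm G v v' q P := by
  have c := hv.continuous_apply
  have c' := fun l => (hv'b l).continuous hb
  have cA : ∀ j i, Continuous (velDeriv v v' j i) := fun j i =>
    ((c' j).mul (c i)).add ((c j).mul (c' i))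
  have c2 : ∀ j i, Continuous fun P => v P j * v P i := fun j i => (c j).mul (c i)
  have c3 : ∀ k j i, Continuous fun P => v P k * (v P j * v P i) := fun k j i => (c k).mul (c2 j i)
  have hL : ∀ j i, IsTest Set.univ (partialDeriv j (partialDeriv i G)) := fun j i =>
    (hG.partialDeriv i).partialDeriv j
  have hK := isTest_kerThree hG
  have d1 : ∀ j i, Continuous fun P =>
      kint 0 q (partialDeriv j (partialDeriv i G)) (slide (velDeriv v v' j i) P) := fun j i =>
    continuous_kint (hL j i) 0 q (continuous_slide (cA j i))
  have d2 : ∀ k j i, Continuous fun P =>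
      kint 1 q (kerThree G k j i) (slide (fun P => v P k * (v P j * v P i)) P) := fun k j i =>
    continuous_kint (hK k j i) 1 q (continuous_slide (c3 k j i))
  have e : ∀ i j, ∫ P, conv (scaled 0 q (partialDeriv j (partialDeriv i G)))
      (fun P => fderiv ℝ φ P (timeDir n)) P * (v P j * v P i)
      = ∫ P, φ P * -(kint 0 q (partialDeriv j (partialDeriv i G)) (slide (velDeriv v v' j i) P)
        + ∑ k, kint 1 q (kerThree G k j i) (slide (fun P => v P k * (v P j * v P i)) P)) := by
    intro i j
    have hs := (hL j i).scaled 0 q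
    have hΨ := (hφ.conv hs.continuous hs.hasCompactSupport).1
    -- The weak transport equation of v^j v^i is tested with the convolution of φ and the kernel.
    have h1 := hv.hasDiv_vel_mul hb hv'b hv' hα j i _ hΨ
    rw [integral_mul_fderiv_spaceTimeField hv.continuous (c2 j i) hΨ] at h1
    have h2 : ∀ k, ∫ P, fderiv ℝ (conv (scaled 0 q (partialDeriv j (partialDeriv i G))) φ) P
        (spaceDir k) * (v P k * (v P j * v P i))
        = ∫ P, φ P * kint 1 q (kerThree G k j i)
          (slide (fun P => v P k * (v P j * v P i)) P) := fun k => by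
      rw [← integral_conv_scaled_mul (hK k j i) 1 q hφ (c3 k j i)]
      congr 1; ext P
      rw [fderiv_conv_apply hs.continuous hφ.contDiff hφ.hasCompactSupport,
        conv_scaled_fderiv (hL j i) 0 q hφ, zero_add]
      rfl
    have h3 : ∫ P, velDeriv v v' j i P * conv (scaled 0 q (partialDeriv j (partialDeriv i G))) φ P
        = ∫ P, φ P * kint 0 q (partialDeriv j (partialDeriv i G))
          (slide (velDeriv v v' j i) P) := by
      rw [← integral_conv_scaled_mul (hL j i) 0 q hφ (cA j i)]
      simp only [mul_comm]
    simp only [h2, h3] at h1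
    simp only [fderiv_conv_apply hs.continuous hφ.contDiff hφ.hasCompactSupport] at h1
    rw [hφ.sum_integral_mul _ fun k _ => d2 k j i] at h1
    have hi : ∀ {f : ℝ × Space n → ℝ}, Continuous f → Integrable fun P => φ P * f P := fun hf => by
      simpa only [mul_comm] using hφ.integrable_mul hf volume
    simp only [mul_neg, mul_add, integral_neg]
    rw [integral_add (hi (d1 j i)) (hi (continuous_finsetSum _ fun k _ => d2 k j i))]
    linarith
  simp only [block, e]
  have c4 : ∀ i j, Continuous fun P =>
      -(kint 0 q (partialDeriv j (partialDeriv i G)) (slide (velDeriv v v' j i) P)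
        + ∑ k, kint 1 q (kerThree G k j i) (slide (fun P => v P k * (v P j * v P i)) P)) :=
    fun i j => ((d1 j i).add (continuous_finsetSum _ fun k _ => d2 k j i)).neg
  simp only [hφ.sum_integral_mul _ fun j _ => c4 _ j]
  rw [hφ.sum_integral_mul _ fun i _ => continuous_finsetSum _ fun j _ => c4 i j]
  refine hφ.integral_congr_slab fun P hP => ?_
  have s1 : ∀ i j, kint 0 q (partialDeriv j (partialDeriv i G)) (slide (velDeriv v v' j i) P)
      = kint 0 q (partialDeriv j (partialDeriv i G)) (incr (velDeriv v v' j i) P) := fun i j =>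
    kint_eq_of_integral_eq_zero (hL j i) (integral_partialDeriv_eq_zero (hG.partialDeriv i) j)
      ((continuous_slide (cA j i)).comp (.prodMk_right P)) 0 q (velDeriv v v' j i P)
  have s2 := hv.sum_kint_three (M := fun j i => partialDeriv j (partialDeriv i G)) hL
    (fun j i => partialDeriv_comm hG j i)
    (fun k j i => partialDeriv_comm (hG.partialDeriv i) k j) 1 q hP
  have s3 : ∀ k, ∑ j, ∑ i, kint 1 q (partialDeriv k (partialDeriv j (partialDeriv i G)))
          (atIncr (fun Q => difv v j Q * difv v i Q) P) = gradTerm G v k q P := fun _ => rfl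
  simp only [s3] at s2
  have s4 : ∑ i, ∑ j, ∑ k, kint 1 q (kerThree G k j i) (slide (fun P => v P k * (v P j * v P i)) P)
      = ∑ k, ∑ j, ∑ i, kint 1 q (partialDeriv k (partialDeriv j (partialDeriv i G)))
        (slide (fun P => v P k * (v P j * v P i)) P) := by
    rw [Finset.sum_congr rfl fun i _ => Finset.sum_comm, Finset.sum_comm]
    exact Finset.sum_congr rfl fun k _ => Finset.sum_comm
  simp only [Finset.sum_neg_distrib, Finset.sum_add_distrib, s1, s4, s2, timeTerm]
  rfl

end

end HolderField

end

/-! ### Transfer between the weak formulation and the regular representative -/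

section

variable {n : ℕ} {I : Opens ℝ} {u v : ℝ × Space n → Space n} {Γ : Submodule ℤ (Space n)}
  {α β : ℝ} {p : 𝓓'(slab n I, ℝ)}

theorem IsTest.integral_congr_ae {φ f g : ℝ × Space n → ℝ}
    (hφ : IsTest (slab n I : Set (ℝ × Space n)) φ)
    (h : ∀ᵐ P, P ∈ (slab n I : Set (ℝ × Space n)) → f P = g P) :
    ∫ P, φ P * f P = ∫ P, φ P * g P := by
  refine MeasureTheory.integral_congr_ae (h.mono fun P hP => ?_)
  by_cases hP' : P ∈ (slab n I : Set (ℝ × Space n))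
  · simp only [hP hP']
  · have : φ P = 0 := image_eq_zero_of_notMem_tsupport fun h' => hP' (hφ.tsupport_subset h')
    simp only [this, zero_mul]

/-- The weak equations see the velocity only up to null sets, so they hold for the continuous
representative. -/
theorem WeakEuler.congr (hE : WeakEuler I v p)
    (h : ∀ᵐ P, P ∈ (slab n I : Set (ℝ × Space n)) → u P = v P) : WeakEuler I u p where
  momentum l φ hφ := by
    rw [← hE.momentum l φ hφ, (hφ.fderiv_apply _).integral_congr_ae
      (f := fun P => u P l) (g := fun P => v P l) (h.mono fun P hP hP' => by rw [hP hP'])]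
    congr 2
    exact Finset.sum_congr rfl fun j _ => (hφ.fderiv_apply _).integral_congr_ae
      (h.mono fun P hP hP' => by rw [hP hP'])
  incompressible φ hφ := by
    rw [← hE.incompressible φ hφ]
    exact Finset.sum_congr rfl fun j _ => (hφ.fderiv_apply _).integral_congr_ae
      (h.mono fun P hP hP' => by rw [hP hP'])

theorem WeakEuler.hasDiv_one (hE : WeakEuler I v p) (hv : Continuous v) :
    HasDiv volume (slab n I : Set (ℝ × Space n)) (spaceTimeField v) (fun _ => 1) fun _ => 0 := by
  intro φ hφ
  rw [integral_mul_fderiv_spaceTimeField hv continuous_const hφ]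
  simp only [mul_one, hE.incompressible φ hφ, zero_mul, integral_zero, neg_zero, add_zero]
  exact integral_fderiv_apply_eq_zero hφ.contDiff hφ.hasCompactSupport _

/-- Two limits of the same dyadic sums are compared: the action of p from the representation of the
pressure, and the integral of the summed series. -/
theorem WeakEuler.act_spaceDir [DiscreteTopology Γ] [IsZLattice ℝ Γ] (hE : WeakEuler I v p)
    (hp0 : HasZeroMean Γ p) (hv : HolderField I Γ α v) (hα : 1 / 2 < α)
    {G η : Space n → ℝ} (hG : IsTest Set.univ G) (hη : IsTest Set.univ η) (hη1 : ∫ z, η z = 1)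
    (hGη : ∀ z, ∑ j, partialDeriv j (partialDeriv j G) z = 2 ^ n * η ((2 : ℝ) • z) - η z)
    (l : Fin n) {φ : ℝ × Space n → ℝ} (hφ : IsTest (slab n I : Set (ℝ × Space n)) φ) :
    act p (fun P => fderiv ℝ φ P (spaceDir l)) = - ∫ P, φ P * quadSing v (kerThree G l) P := by
  have h1 := hE.tendsto_sum_block hp0 hG hη hη1 hGη (hφ.fderiv_apply (spaceDir l))
  simp only [hv.block_spaceDir hG _ l hφ] at h1
  have h2 := (hv.sumHolder_gradTerm hG le_rfl hv.pos.le (by linarith) l).tendsto_integral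
    (hv.continuous_gradTerm hG l) hφ
  simp only [hv.tsum_gradTerm hG hα] at h2
  rw [← tendsto_nhds_unique h1 h2, neg_neg]

theorem WeakEuler.act_timeDir [DiscreteTopology Γ] [IsZLattice ℝ Γ] (hE : WeakEuler I v p)
    (hp0 : HasZeroMean Γ p) (hv : HolderField I Γ α v) (hα : 1 / 2 < α)
    {G η : Space n → ℝ} (hG : IsTest Set.univ G) (hη : IsTest Set.univ η) (hη1 : ∫ z, η z = 1)
    (hGη : ∀ z, ∑ j, partialDeriv j (partialDeriv j G) z = 2 ^ n * η ((2 : ℝ) • z) - η z)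
    {b : ℝ} (hb : 0 < b) (hbα : b ≤ α) {v' : Fin n → ℝ × Space n → ℝ}
    (hv'b : ∀ l, BddHolder b (v' l)) (hv'p : ∀ l, IsPer Γ (v' l))
    (hv' : ∀ l, HasDiv volume (slab n I : Set (ℝ × Space n)) (spaceTimeField v)
      (fun P => v P l) (v' l))
    {φ : ℝ × Space n → ℝ} (hφ : IsTest (slab n I : Set (ℝ × Space n)) φ) :
    act p (fun P => fderiv ℝ φ P (timeDir n)) = - ∫ P, φ P * ∑' q, timeTerm G v v' q P := by
  have h1 := hE.tendsto_sum_block hp0 hG hη hη1 hGη (hφ.fderiv_apply (timeDir n))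
  simp only [hv.block_timeDir hb hv'b hv' (by linarith) hG _ hφ] at h1
  have h2 := (hv.sumHolder_timeTerm hv'b hv'p hG le_rfl hb hbα (by linarith)).tendsto_integral
    (hv.continuous_timeTerm hb hv'b hG) hφ
  rw [← tendsto_nhds_unique h1 h2, neg_neg]

theorem IsPer.isPeriodicFun {F : Type*} {f : ℝ × Space n → F} (h : IsPer Γ f) :
    IsPeriodicFun I Γ f := fun t _ => h t

/-- Continuity is a separate hypothesis because β = 0 is allowed, where the Hölder bound does not
imply it. -/
theorem BddHolder.memHolder {f : ℝ × Space n → ℝ} (hf : BddHolder β f) (hc : Continuous f)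
    (hp : IsPer Γ f) : MemHolder I Γ β f := by
  obtain ⟨C, h1, h2⟩ := hf
  exact { periodic := hp.isPeriodicFun, continuousOn := hc.continuousOn
          bounded := ⟨C, fun z _ => h1 z⟩, holder := ⟨C, fun z _ w _ => h2 z w⟩ }

theorem memHolder_of_apply {f : Fin n → ℝ × Space n → ℝ} (hf : ∀ l, BddHolder β (f l))
    (hc : ∀ l, Continuous (f l)) (hp : ∀ l, IsPer Γ (f l)) :
    MemHolder I Γ β fun P => (WithLp.toLp 2 fun l => f l P : Space n) := by
  choose C h1 h2 using hf
  refine { periodic := fun t _ x γ hγ => ?_, continuousOn := ?_, bounded := ⟨∑ l, C l, ?_⟩,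
           holder := ⟨∑ l, C l, ?_⟩ }
  · simp only [hp _ t x γ hγ]
  · exact ((PiLp.continuous_toLp 2 _).comp (continuous_pi hc)).continuousOn
  · exact fun z _ => (norm_le_sum_abs _).trans (Finset.sum_le_sum fun l _ => h1 l z)
  · intro z _ w _
    rw [Finset.sum_mul]
    exact (norm_le_sum_abs _).trans (Finset.sum_le_sum fun l _ => h2 l z w)

/-- The material derivative is defined with the original v, while the transport identity holds for
the representative u; the fluxes agree almost everywhere. -/
theorem materialDeriv_eq (hv : SpaceHolder I α v) (hu : Continuous u)
    (h : ∀ᵐ P, P ∈ (slab n I : Set (ℝ × Space n)) → u P = v P) {f A : ℝ × Space n → ℝ}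
    (hf : Continuous f) (hA : Continuous A)
    (hfA : HasDiv volume (slab n I : Set (ℝ × Space n)) (spaceTimeField u) f A) :
    materialDeriv I v f = distOf I A := by
  have hloc : ∀ {g : ℝ × Space n → ℝ}, Continuous g →
      LocallyIntegrableOn g (slab n I : Set (ℝ × Space n)) := fun hg =>
    hg.locallyIntegrable.locallyIntegrableOn _
  have hvf : ∀ j, LocallyIntegrableOn (fun P => v P j * f P) (slab n I : Set (ℝ × Space n)) :=
    fun j => (hv.locallyIntegrableOn j).mul_continuousOn hf.continuousOn
      (slab n I).isOpen.isLocallyClosed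
  refine ext_act fun φ hφ => ?_
  rw [materialDeriv, act_add_left _ _ hφ, act_sum_left _ _ hφ, act_lineDerivOp _ hφ,
    act_distOf (hloc hf) (hφ.fderiv_apply _), act_distOf (hloc hA) hφ]
  simp only [act_lineDerivOp _ hφ, act_distOf (hvf _) (hφ.fderiv_apply _)]
  have key := hfA φ hφ
  rw [integral_mul_fderiv_spaceTimeField hu hf hφ] at key
  have e : ∀ k, ∫ P, fderiv ℝ φ P (spaceDir k) * (v P k * f P)
      = ∫ P, fderiv ℝ φ P (spaceDir k) * (u P k * f P) := fun k =>
    (hφ.fderiv_apply _).integral_congr_ae (h.mono fun P hP hP' => by rw [hP hP'])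
  simp only [e, Finset.sum_neg_distrib]
  simp only [mul_comm (φ _)]
  linarith

theorem lineDerivOp_eq_distOf {e : ℝ × Space n} {f : ℝ × Space n → ℝ} (hf : Continuous f)
    (h : ∀ φ, IsTest (slab n I : Set (ℝ × Space n)) φ →
      act p (fun P => fderiv ℝ φ P e) = - ∫ P, φ P * f P) : ∂_{e} p = distOf I f :=
  ext_act fun φ hφ => by
    rw [act_lineDerivOp _ hφ, act_distOf (hf.locallyIntegrable.locallyIntegrableOn _) hφ,
      h φ hφ, neg_neg]

end

/-! ### Assembly and choice of exponents -/

section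

variable {n : ℕ} {I : Opens ℝ} {v : ℝ × Space n → Space n} {Γ : Submodule ℤ (Space n)}
  {α : ℝ} {p : 𝓓'(slab n I, ℝ)}

theorem exists_pressure_derivatives (hn : 0 < n) [DiscreteTopology Γ] [IsZLattice ℝ Γ]
    (hI : (I : Set ℝ).OrdConnected) (hα : 1 / 2 < α) (hα1 : α < 1) (hv : MemCtCx I Γ α v)
    (hp0 : HasZeroMean Γ p) (hE : IsWeakEulerSolution I v p) :
    ∃ (q : ℝ × Space n → ℝ) (g : ℝ × Space n → Space n),
      ∂_{timeDir n} p = distOf I q ∧ (∀ l : Fin n, ∂_{spaceDir l} p = distOf I fun z => g z l) ∧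
      (∀ β : ℝ, 0 ≤ β → β < 2 * α - 1 → MemHolder I Γ β q ∧ MemHolder I Γ β g) ∧
      (2 / 3 < α → ∃ h : ℝ × Space n → Space n,
        (∀ l : Fin n, materialDeriv I v (fun z => g z l) = distOf I fun z => h z l) ∧
        (∀ β : ℝ, 0 ≤ β → β < 3 * α - 2 → MemHolder I Γ β h) ∧
        (3 / 4 < α → ∃ m : ℝ × Space n → Space n,
          (∀ l : Fin n, materialDeriv I v (fun z => h z l) = distOf I fun z => m z l) ∧
          MemC0 I Γ m)) := by
  have hvs := hv.spaceHolder
  have hE' := hE.weakEuler hvs.locallyIntegrableOn hvs.locallyIntegrableOn_mul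
  -- From here on all computations are made with this representative; v returns only through almost
  -- everywhere equality in the material derivatives.
  obtain ⟨u, hu, hup, huv⟩ := exists_holder_velocity hn hI hE' hp0 hv (by linarith) hα1
  obtain ⟨G, η, hG, hη, hη1, hGη⟩ := exists_kernel hn
  have hEu := hE'.congr huv
  have hpos : 0 < α := by linarith
  have huc : Continuous u := by
    have : Continuous fun P => (WithLp.toLp 2 fun l => u P l : Space n) :=
      (PiLp.continuous_toLp 2 _).comp (continuous_pi fun l => (hu l).continuous hpos)
    exact this
  have H : HolderField I Γ α u := ⟨hpos, hu, hup, hEu.hasDiv_one huc⟩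
  have hK := isTest_kerThree hG
  set g : Fin n → ℝ × Space n → ℝ := fun l => quadSing u (kerThree G l)
  have hg : ∀ l (b : ℝ), 0 ≤ b → b < 2 * α - 1 → BddHolder b (g l) := fun l b h0 h1 =>
    H.bddHolder_quadSing (hK l) h0 (by linarith) h1
  -- The exponent α - 1/2 is half of 2α - 1: positive and admissible.
  have hgc : ∀ l, Continuous (g l) := fun l =>
    (hg l (α - 1 / 2) (by linarith) (by linarith)).continuous (by linarith)
  have hgp : ∀ l, IsPer Γ (g l) := fun l => H.isPer_quadSing _
  -- The momentum equation reads D_t v = -∇p, so the material derivative of v is minus the gradient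
  -- just found.
  set v' : Fin n → ℝ × Space n → ℝ := fun l P => - g l P
  have hv' : ∀ l (b : ℝ), 0 ≤ b → b < 2 * α - 1 → BddHolder b (v' l) := fun l b h0 h1 =>
    (hg l b h0 h1).neg
  have hv'p : ∀ l, IsPer Γ (v' l) := fun l => (hgp l).neg
  have hgrad := fun l (φ : ℝ × Space n → ℝ) (hφ : IsTest (slab n I : Set (ℝ × Space n)) φ) =>
    hEu.act_spaceDir hp0 H hα hG hη hη1 hGη l hφ
  have hD : ∀ l, HasDiv volume (slab n I : Set (ℝ × Space n)) (spaceTimeField u)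
      (fun P => u P l) (v' l) := fun l φ hφ => by
    rw [integral_mul_fderiv_spaceTimeField huc (H.continuous_apply l) hφ]
    have h1 := hEu.momentum l φ hφ
    rw [hgrad l φ hφ] at h1
    simp only [v', g, mul_comm _ (φ _), mul_neg, integral_neg, neg_neg]
    linarith
  -- The gradient exponent b is the midpoint of β and 2α - 1, leaving room for the order 0 term.
  have hq : ∀ β : ℝ, 0 ≤ β → β < 2 * α - 1 →
      BddHolder β fun P => ∑' q, timeTerm G u v' q P := fun β h0 h1 =>
    (H.sumHolder_timeTerm (b := (β + (2 * α - 1)) / 2)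
      (fun l => hv' l _ (by linarith) (by linarith)) hv'p hG h0 (by linarith) (by linarith)
      h1).bddHolder_tsum
  have hqc := (hq (α - 1 / 2) (by linarith) (by linarith)).continuous (by linarith)
  have hqp : IsPer Γ fun P => ∑' q, timeTerm G u v' q P := by
    have d : ∀ l t x y, ∀ γ ∈ Γ, difv u l (t, (x + γ, y + γ)) = difv u l (t, (x, y)) := fun l =>
      (H.pairFun_dif le_rfl hpos.le l).periodic
    intro t x γ hγ
    have e1 : ∀ j i, incr (velDeriv u v' j i) (t, x + γ) = incr (velDeriv u v' j i) (t, x) :=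
      fun j i => funext fun z => by
        simp only [incr, velDeriv, add_right_comm x γ z, hv'p _ t _ γ hγ, hup t _ γ hγ]
    have e2 : ∀ k j i, atIncr (fun Q => difv u k Q * (difv u j Q * difv u i Q)) (t, x + γ)
        = atIncr (fun Q => difv u k Q * (difv u j Q * difv u i Q)) (t, x) :=
      fun k j i => funext fun z => by simp only [atIncr, add_right_comm x γ z, d _ t _ _ γ hγ]
    have e3 : ∀ j i, atIncr (fun Q => difv u j Q * difv u i Q) (t, x + γ)
        = atIncr (fun Q => difv u j Q * difv u i Q) (t, x) :=
      fun j i => funext fun z => by simp only [atIncr, add_right_comm x γ z, d _ t _ _ γ hγ]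
    simp only [timeTerm, gradTerm, e1, e2, e3, hup t _ γ hγ]
  refine ⟨fun P => ∑' q, timeTerm G u v' q P, fun P => WithLp.toLp 2 fun l => g l P,
    lineDerivOp_eq_distOf hqc fun φ hφ =>
      hEu.act_timeDir hp0 H hα hG hη hη1 hGη (b := α - 1 / 2) (by linarith) (by linarith)
        (fun l => hv' l _ (by linarith) (by linarith)) hv'p hD hφ,
    fun l => lineDerivOp_eq_distOf (hgc l) (hgrad l),
    fun β h0 h1 => ⟨(hq β h0 h1).memHolder hqc hqp,
      memHolder_of_apply (fun l => hg l β h0 h1) hgc hgp⟩, fun h23 => ?_⟩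
  set h : Fin n → ℝ × Space n → ℝ := fun l => quadDeriv u v' (kerThree G l)
  -- With b = (β + α)/2, both b < 2α - 1 and β + 1 < b + α are equivalent to β < 3α - 2.
  have hh : ∀ l (β : ℝ), 0 ≤ β → β < 3 * α - 2 → BddHolder β (h l) := fun l β h0 h1 =>
    H.bddHolder_quadDeriv (b := (β + α) / 2) (by linarith)
      (fun l => hv' l _ (by linarith) (by linarith)) hv'p (hK l) h0 (by linarith) (by linarith)
      (by linarith) (by linarith)
  have hhc : ∀ l, Continuous (h l) := fun l =>
    (hh l ((3 * α - 2) / 2) (by linarith) (by linarith)).continuous (by linarith)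
  have hhp : ∀ l, IsPer Γ (h l) := fun l =>
    H.isPer_quadDeriv (b := α / 2) (by linarith)
      (fun l => hv' l _ (by linarith) (by linarith)) hv'p _
  have hgh : ∀ l, HasDiv volume (slab n I : Set (ℝ × Space n)) (spaceTimeField u) (g l) (h l) :=
    fun l => H.hasDiv_quadSing (b := α / 2) (by linarith)
      (fun l => hv' l _ (by linarith) (by linarith)) hv'p hD (hK l) (by linarith) (by linarith)
  refine ⟨fun P => WithLp.toLp 2 fun l => h l P,
    fun l => materialDeriv_eq hvs huc huv (hgc l) (hhc l) (hgh l),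
    fun β h0 h1 => memHolder_of_apply (fun l => hh l β h0 h1) hhc hhp, fun h34 => ?_⟩
  -- Such b exists exactly when α > 3/4: below 2α - 1 to be a Hölder exponent of ∇p, above 1/2 and 2
  -- - 2α for the terms of order 1 and 2. Then 2b - α < 3α - 2 is a Hölder exponent of D_t∇p, as
  -- needed for the second derivative of v.
  obtain ⟨b, hb1, hb2⟩ : ∃ b, max (1 / 2) (2 - 2 * α) < b ∧ b < 2 * α - 1 :=
    exists_between (max_lt (by linarith) (by linarith))
  obtain ⟨hb3, hb4⟩ := max_lt_iff.1 hb1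
  have key := fun l => H.hasDiv_quadDeriv (b := b) (v'' := fun l P => - h l P) (by linarith)
    (fun l => hv' l _ (by linarith) (by linarith)) hv'p hD (hK l)
    (fun l => (hh l _ (by linarith) (by linarith)).neg) (fun l => (hhp l).neg)
    (fun l => (hgh l).neg) hα1 (by linarith) (by linarith) (by linarith)
  set m : Fin n → ℝ × Space n → ℝ := fun l =>
    quadDerivTwo u v' (fun l P => - h l P) (kerThree G l)
  have hmc : ∀ l, Continuous (m l) := fun l => by
    obtain ⟨β, hβ, hm⟩ := (key l).2.1
    exact hm.continuous hβ
  have hm0 : ∀ l, BddHolder 0 (m l) := fun l => by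
    obtain ⟨β, hβ, hm⟩ := (key l).2.1
    exact hm.mono le_rfl hβ.le
  exact ⟨fun P => WithLp.toLp 2 fun l => m l P,
    fun l => materialDeriv_eq hvs huc huv (hhc l) (hmc l) (key l).1,
    (memHolder_of_apply hm0 hmc fun l => (key l).2.2).toMemC0⟩

end

end EulerPressure

theorem mainTheorem8 (n : ℕ) (hn : 2 ≤ n)
    (Γ : Submodule ℤ (EulerPressure.Space n)) [DiscreteTopology Γ] [IsZLattice ℝ Γ]
    (I : Opens ℝ) (hI : (I : Set ℝ).OrdConnected)
    (α : ℝ) (hα : 1 / 2 < α) (hα1 : α < 1)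
    (v : ℝ × EulerPressure.Space n → EulerPressure.Space n)
    (p : 𝓓'(EulerPressure.slab n I, ℝ))
    (hv : EulerPressure.MemCtCx I Γ α v)
    (hp : EulerPressure.IsPeriodicDist Γ p)
    (hp0 : EulerPressure.HasZeroMean Γ p)
    (hE : EulerPressure.IsWeakEulerSolution I v p) :
    ∃ (q : ℝ × EulerPressure.Space n → ℝ) (g : ℝ × EulerPressure.Space n → EulerPressure.Space n),
      -- `∂_t p = q` and `∇p = g` belong to `C^β` for all `β < 2α - 1`
      ∂_{EulerPressure.timeDir n} p = EulerPressure.distOf I q ∧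
      (∀ l : Fin n, ∂_{EulerPressure.spaceDir l} p = EulerPressure.distOf I fun z => g z l) ∧
      (∀ β : ℝ, 0 ≤ β → β < 2 * α - 1 →
        EulerPressure.MemHolder I Γ β q ∧ EulerPressure.MemHolder I Γ β g) ∧
      (2 / 3 < α → ∃ h : ℝ × EulerPressure.Space n → EulerPressure.Space n,
        -- `D_t ∇p = h` belongs to `C^β` for all `β < 3α - 2`
        (∀ l : Fin n, EulerPressure.materialDeriv I v (fun z => g z l) =
          EulerPressure.distOf I fun z => h z l) ∧
        (∀ β : ℝ, 0 ≤ β → β < 3 * α - 2 → EulerPressure.MemHolder I Γ β h) ∧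
        (3 / 4 < α → ∃ m : ℝ × EulerPressure.Space n → EulerPressure.Space n,
          -- `D_t² ∇p = m` belongs to `C⁰`
          (∀ l : Fin n, EulerPressure.materialDeriv I v (fun z => h z l) =
            EulerPressure.distOf I fun z => m z l) ∧
          EulerPressure.MemC0 I Γ m)) := by
  exact EulerPressure.exists_pressure_derivatives (by omega) hI hα hα1 hv hp0 hE
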